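/- Let $k$ be an arbitrary field. All graded vector spaces are $\mathbb{Z}$-graded over $k$, $A=\bigoplus_{n\in\mathbb{Z}}A_n$, and tensor products of homogeneous maps follow the Koszul rule $(f\otimes g)(v\otimes w)=(-1)^{|g||v|}f(v)\otimes g(w)$. An $A_\infty$-algebra $(A,m)$ is a graded vector space $A$ with linear maps $m_n:A^{\otimes n}\to A$ of degree $n-2$ ($n\ge 1$) such that for all $n\ge1$ $$\sum_{\substack{r+s+t=n\\ s\ge 1,\ r,t\ge 0}}(-1)^{rs+t}\,m_{r+1+t}(\mathrm{id}^{\otimes r}\otimes m_s\otimes\mathrm{id}^{\otimes t})=0 .$$ In particular $m_1^2=0$; $H_*(A)$ denotes the (graded) homology of the chain complex $(A,m_1)$, and $[x]\otimes[y]\mapsto[m_2(x\otimes y)]$ is the induced product on it. A morphism of $A_\infty$-algebras $f:(A,m)\to(B,m')$ is a family of linear maps $f_n:A^{\otimes n}\to B$ of degree $n-1$ ($n\ge1$) such that for all $n\ge1$ $$\sum_{\substack{r+s+t=n\\ s\ge 1,\ r,t\ge 0}}(-1)^{rs+t}f_{r+1+t}(\mathrm{id}^{\otimes r}\otimes m_s\otimes\mathrm{id}^{\otimes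 t})=\sum_{\substack{i_1+\dots+i_r=n\\ r\ge 1,\ i_j\ge 1}}(-1)^{l(i_1,\dots,i_r)}m'_r(f_{i_1}\otimes\dots\otimes f_{i_r}),\qquad l(i_1,\dots,i_r)=\sum_{1\le j<l\le r}(i_l-1)\,i_j .$$ Morphisms compose by $(g\circ f)_n=\sum_{i_1+\dots+i_r=n}(-1)^{l(i_1,\dots,i_r)}g_r(f_{i_1}\otimes\dots\otimes f_{i_r})$; the identity morphism has $\mathrm{id}_1=\mathrm{id}$ and $\mathrm{id}_n=0$ for $n\ge2$; an isomorphism is a morphism with a two-sided inverse morphism. A morphism $f$ is a quasi-isomorphism if the chain map $f_1$ induces an isomorphism on homology. A minimal model of $(A,m)$ is an $A_\infty$-structure $m'$ on the graded vector space $H_*(A)$ with $m'_1=0$ and $m'_2$ the induced product, together with a quasi-isomorphism of $A_\infty$-algebras $i:(H_*(A),m')\to(A,m)$ such that $i_1$ induces the identity on homology, i.e. $i_1(x)$ is a cycle with class $x$ for every $x\in H_*(A)$. **Theorem (Kadeishvili).** Let $(A,m)$ be an $A_\infty$-algebra over $k$. Then $(A,m)$ has a minimal model $i:(H_*(A),m')\to(A,m)$.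 Moreover, the $A_\infty$-structure is unique up to isomorphism: if $i':(H_*(A),m')\to(A,m)$ and $i'':(H_*(A),m'')\to(A,m)$ are two minimal models of $(A,m)$, then $(H_*(A),m')$ and $(H_*(A),m'')$ are isomorphic as $A_\infty$-algebras. -/

import Mathlib

noncomputable section

namespace AInfinity

open scoped DirectSum

universe u v

section GradedSpaces

variable {k : Type u} [Field k]
variable {A : Type v} [AddCommGroup A] [Module k A]
variable {B : Type v} [AddCommGroup B] [Module k B]
variable {C : Type v} [AddCommGroup C] [Module k C]

/-- The sign involution of a `ℤ`-graded vector space: it is multiplication by `(-1) ^ n` on the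
component of degree `n`. Moving a map of degree `e` past `a` (Koszul rule) amounts to replacing
`a` by `signInv ^ e` applied to `a`. -/
def signInv (𝒜 : ℤ → Submodule k A) [DirectSum.Decomposition 𝒜] : A →ₗ[k] A :=
  DirectSum.toModule k ℤ A (fun n => (n.negOnePow : ℤ) • (𝒜 n).subtype) ∘ₗ
    (DirectSum.decomposeLinearEquiv 𝒜).toLinearMap

theorem signInv_of_mem (𝒜 : ℤ → Submodule k A) [DirectSum.Decomposition 𝒜] {n : ℤ} {a : A}
    (ha : a ∈ 𝒜 n) : signInv 𝒜 a = (n.negOnePow : ℤ) • a := by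
  have h := DirectSum.decomposeLinearEquiv_apply_coe 𝒜 n ⟨a, ha⟩
  simp only at h
  simp [signInv, h]

theorem signInv_signInv (𝒜 : ℤ → Submodule k A) [DirectSum.Decomposition 𝒜] (a : A) :
    signInv 𝒜 (signInv 𝒜 a) = a := by
  have : signInv 𝒜 ∘ₗ signInv 𝒜 = LinearMap.id := by
    refine DirectSum.decompose_lhom_ext 𝒜 fun i => ?_
    ext ⟨x, hx⟩
    simp only [LinearMap.comp_apply, Submodule.subtype_apply, signInv_of_mem 𝒜 hx, map_zsmul,
      LinearMap.id_apply]
    rcases Int.even_or_odd i with hi | hi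
    · simp [Int.negOnePow_even i hi]
    · simp [Int.negOnePow_odd i hi]
  exact LinearMap.congr_fun this a

/-- A family of linear maps `A^{⊗ n} → B`. Only the members with `n ≥ 1` are meaningful; the
member with `n = 0` is never used. -/
abbrev Family (k : Type u) [Field k] (A : Type v) [AddCommGroup A] [Module k A]
    (B : Type v) [AddCommGroup B] [Module k B] : Type v :=
  (n : ℕ) → MultilinearMap k (fun _ : Fin n => A) B

/-- `f n : A^{⊗ n} → B` is homogeneous of degree `n + e`, for all `n ≥ 1`. -/
def HasDegree (𝒜 : ℤ → Submodule k A) (ℬ : ℤ → Submodule k B) (f : Family k A B) (e : ℤ) :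
    Prop :=
  ∀ n : ℕ, 1 ≤ n → ∀ (d : Fin n → ℤ) (a : Fin n → A), (∀ i, a i ∈ 𝒜 (d i)) →
    f n a ∈ ℬ (∑ i, d i + (n + e))

/-- The value of `id^{⊗ r} ⊗ m_s ⊗ id^{⊗ t}` on `a 0 ⊗ ... ⊗ a (r + s + t - 1)`, as a pure tensor
of length `r + 1 + t`. As `m_s` has degree `s - 2`, the Koszul rule puts `signInv ^ s` on the
first `r` entries. -/
def insertAt (𝒜 : ℤ → Submodule k A) [DirectSum.Decomposition 𝒜] (m : Family k A A)
    (r s t : ℕ) (a : ℕ → A) : Fin (r + 1 + t) → A := fun i =>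
  if (i : ℕ) < r then (signInv 𝒜 ^ s) (a i)
  else if (i : ℕ) = r then m s (fun j : Fin s => a (r + j))
  else a (i + s - 1)

/-- `∑_{r + s + t = n, s ≥ 1} (-1)^{rs + t} f_{r+1+t} (id^{⊗ r} ⊗ m_s ⊗ id^{⊗ t})`, evaluated at
`a 0 ⊗ ... ⊗ a (n - 1)`. -/
def insertSum (𝒜 : ℤ → Submodule k A) [DirectSum.Decomposition 𝒜] (f : Family k A B)
    (m : Family k A A) (n : ℕ) (a : ℕ → A) : B :=
  ∑ s ∈ Finset.Icc 1 n, ∑ p ∈ Finset.HasAntidiagonal.antidiagonal (n - s),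
    (-1 : ℤ) ^ (p.1 * s + p.2) • f (p.1 + 1 + p.2) (insertAt 𝒜 m p.1 s p.2 a)

/-- The exponent `l(i_1, ..., i_r) = ∑_{j < l} (i_l - 1) i_j`. -/
def signExp {n : ℕ} (c : Composition n) : ℕ :=
  ∑ l : Fin c.length, ∑ j ∈ Finset.Iio l, (c.blocksFun l - 1) * c.blocksFun j

/-- `g_r (f_{i_1} ⊗ ... ⊗ f_{i_r})` for the composition `c = (i_1, ..., i_r)` of `n`, where
`f_i` has degree `i - 1`: the Koszul rule puts `signInv ^ (∑_{l > j} (i_l - 1))` on the entries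
of the `j`-th block. -/
def blockTerm (𝒜 : ℤ → Submodule k A) [DirectSum.Decomposition 𝒜] (g : Family k B C)
    (f : Family k A B) {n : ℕ} (c : Composition n) : MultilinearMap k (fun _ : Fin n => A) C :=
  ((g c.length).compMultilinearMap fun j : Fin c.length =>
    (f (c.blocksFun j)).compLinearMap fun _ =>
      signInv 𝒜 ^ (∑ l ∈ Finset.Ioi j, (c.blocksFun l - 1))).domDomCongr c.blocksFinEquiv

/-- `(g ∘ f)_n = ∑_{i_1 + ... + i_r = n} (-1)^{l(i_1, ..., i_r)} g_r (f_{i_1} ⊗ ... ⊗ f_{i_r})`,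
where `f_i` has degree `i - 1`. -/
def compose (𝒜 : ℤ → Submodule k A) [DirectSum.Decomposition 𝒜] (g : Family k B C)
    (f : Family k A B) : Family k A C := fun n =>
  ∑ c : Composition n, (-1 : ℤ) ^ signExp c • blockTerm 𝒜 g f c

/-- The identity family: the identity in arity one, zero in all other arities. -/
def idFamily (k : Type u) [Field k] (A : Type v) [AddCommGroup A] [Module k A] : Family k A A
  | 1 => MultilinearMap.ofSubsingleton k A A (0 : Fin 1) LinearMap.id
  | _ => 0

/-- The linear map given by the member of arity one. -/
def linPart (f : Family k A B) : A →ₗ[k] B :=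
  (MultilinearMap.ofSubsingleton k A B (0 : Fin 1)).symm (f 1)

theorem linPart_apply (f : Family k A B) (x : A) : linPart f x = f 1 (fun _ => x) := rfl

theorem insertSum_one (𝒜 : ℤ → Submodule k A) [DirectSum.Decomposition 𝒜] (f : Family k A B)
    (m : Family k A A) (a : ℕ → A) :
    insertSum 𝒜 f m 1 a = linPart f (linPart m (a 0)) := by
  simp only [insertSum, Finset.Icc_self, Finset.sum_singleton, Nat.sub_self,
    Finset.HasAntidiagonal.antidiagonal_zero, linPart_apply]
  simp only [Nat.zero_mul, Nat.zero_add, pow_zero, one_smul]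
  refine congrArg (f 1) (funext fun i => ?_)
  have hi : (i : ℕ) = 0 := by lia
  simp only [insertAt, hi, lt_self_iff_false, if_false, if_true]
  refine congrArg (m 1) (funext fun j => ?_)
  have : j = 0 := Subsingleton.elim _ _
  subst this
  rfl

theorem insertSum_two (𝒜 : ℤ → Submodule k A) [DirectSum.Decomposition 𝒜] (f : Family k A B)
    (m : Family k A A) (a : ℕ → A) :
    insertSum 𝒜 f m 2 a = linPart f (m 2 ![a 0, a 1])
      - f 2 ![linPart m (a 0), a 1] - f 2 ![signInv 𝒜 (a 0), linPart m (a 1)] := by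
  have e1 : insertAt 𝒜 m 0 1 1 a = ![linPart m (a 0), a 1] := by
    funext i
    fin_cases i
    · simp [insertAt, linPart_apply]
    · simp [insertAt]
  have e2 : insertAt 𝒜 m 1 1 0 a = ![signInv 𝒜 (a 0), linPart m (a 1)] := by
    funext i
    fin_cases i
    · simp [insertAt]
    · simp [insertAt, linPart_apply]
  have e3 : insertAt 𝒜 m 0 2 0 a = fun _ => m 2 ![a 0, a 1] := by
    funext i
    fin_cases i
    simp only [insertAt, lt_self_iff_false, if_false, if_true]
    refine congrArg (m 2) (funext fun j => ?_)
    fin_cases j <;> simp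
  have hI : Finset.Icc 1 2 = ({1, 2} : Finset ℕ) := by decide
  have hA : Finset.HasAntidiagonal.antidiagonal (2 - 1) = ({(0, 1), (1, 0)} : Finset (ℕ × ℕ)) := by decide
  rw [insertSum, hI, Finset.sum_pair (by decide), hA, Finset.sum_pair (by decide)]
  simp only [Nat.sub_self, Finset.HasAntidiagonal.antidiagonal_zero, Finset.sum_singleton, linPart_apply f]
  simp only [Nat.zero_mul, Nat.zero_add, Nat.add_zero, Nat.mul_one, pow_zero, pow_one, one_smul,
    neg_smul, Nat.reduceAdd, e1, e2, e3]
  abel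

theorem compose_one (𝒜 : ℤ → Submodule k A) [DirectSum.Decomposition 𝒜] (g : Family k B C)
    (f : Family k A B) (x : A) :
    compose 𝒜 g f 1 (fun _ => x) = linPart g (linPart f x) := by
  have key : ∀ (g : Family k B C) (f : Family k A B) (N : ℕ) (b : Fin N → ℕ) (e : Fin N → ℕ),
      N = 1 → (∀ j, b j = 1) → (∀ j, e j = 0) →
      (g N) (fun j => f (b j) (fun _ => (signInv 𝒜 ^ (e j)) x)) = linPart g (linPart f x) := by
    intro g f N b e hN hb he
    obtain rfl : b = fun _ => 1 := funext hb
    obtain rfl : e = fun _ => 0 := funext he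
    subst hN
    simp [linPart_apply]
  have hu : (Finset.univ : Finset (Composition 1)) = {Composition.ones 1} := by
    refine Finset.eq_singleton_iff_unique_mem.2 ⟨Finset.mem_univ _, fun c _ => ?_⟩
    rw [Composition.eq_ones_iff_length]
    have h1 := c.length_le
    have h2 : 0 < c.length := c.length_pos_iff.2 Nat.one_pos
    lia
  have hs : signExp (Composition.ones 1) = 0 := by
    simp [signExp]
  rw [compose, hu, Finset.sum_singleton, hs, pow_zero, one_smul]
  refine key g f _ (Composition.ones 1).blocksFun _ (Composition.ones_length 1)
    (fun j => Composition.ones_blocksFun 1 j) (fun j => ?_)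
  simp

end GradedSpaces

section Structures

variable {k : Type u} [Field k]
variable {A : Type v} [AddCommGroup A] [Module k A]
variable {B : Type v} [AddCommGroup B] [Module k B]

/-- An `A_∞`-algebra structure on the graded vector space `A = ⨁ 𝒜 n`: linear maps
`m_n : A^{⊗ n} → A` of degree `n - 2`, for `n ≥ 1`, with the higher associativity conditions. -/
structure Structure (𝒜 : ℤ → Submodule k A) [DirectSum.Decomposition 𝒜] where
  m : Family k A A
  degree : HasDegree 𝒜 𝒜 m (-2)
  assoc : ∀ n : ℕ, 1 ≤ n → ∀ a : ℕ → A, insertSum 𝒜 m m n a = 0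

variable {𝒜 : ℤ → Submodule k A} [DirectSum.Decomposition 𝒜]
variable {ℬ : ℤ → Submodule k B} [DirectSum.Decomposition ℬ]

/-- A morphism of `A_∞`-algebras: linear maps `f_n : A^{⊗ n} → B` of degree `n - 1`, for `n ≥ 1`,
with `∑ (-1)^{rs+t} f_{r+1+t} (id^{⊗ r} ⊗ m_s ⊗ id^{⊗ t})
  = ∑ (-1)^{l(i_1, ..., i_r)} m'_r (f_{i_1} ⊗ ... ⊗ f_{i_r})`. -/
structure Morphism (S : Structure 𝒜) (T : Structure ℬ) where
  f : Family k A B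
  degree : HasDegree 𝒜 ℬ f (-1)
  comm : ∀ n : ℕ, 1 ≤ n → ∀ a : ℕ → A,
    insertSum 𝒜 f S.m n a = compose 𝒜 T.m f n (fun i : Fin n => a i)

/-- Two `A_∞`-algebras are isomorphic: there are mutually inverse `A_∞`-morphisms. -/
def Isomorphic (S : Structure 𝒜) (T : Structure ℬ) : Prop :=
  ∃ (f : Morphism S T) (g : Morphism T S),
    (∀ n : ℕ, 1 ≤ n → compose 𝒜 g.f f.f n = idFamily k A n) ∧
    (∀ n : ℕ, 1 ≤ n → compose ℬ f.f g.f n = idFamily k B n)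

namespace Structure

variable (S : Structure 𝒜)

/-- The differential `m_1`. -/
def diff : A →ₗ[k] A := linPart S.m

theorem diff_diff (x : A) : S.diff (S.diff x) = 0 := by
  have h := S.assoc 1 le_rfl (fun _ => x)
  rwa [insertSum_one] at h

theorem diff_mem {n : ℤ} {x : A} (hx : x ∈ 𝒜 n) : S.diff x ∈ 𝒜 (n - 1) := by
  have h := S.degree 1 le_rfl (fun _ => n) (fun _ => x) (fun _ => hx)
  simp only [Finset.univ_unique, Finset.sum_const, Finset.card_singleton, one_smul,
    Nat.cast_one] at h
  exact h

theorem leibniz (x y : A) : S.diff (S.m 2 ![x, y]) =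
    S.m 2 ![S.diff x, y] + S.m 2 ![signInv 𝒜 x, S.diff y] := by
  have h := S.assoc 2 (by norm_num) (fun i => if i = 0 then x else y)
  rw [insertSum_two] at h
  simp only [if_true, one_ne_zero, if_false] at h
  rw [sub_sub, sub_eq_zero] at h
  exact h

theorem diff_signInv (x : A) : S.diff (signInv 𝒜 x) = - signInv 𝒜 (S.diff x) := by
  have : S.diff ∘ₗ signInv 𝒜 = - (signInv 𝒜 ∘ₗ S.diff) := by
    refine DirectSum.decompose_lhom_ext 𝒜 fun i => ?_
    ext ⟨y, hy⟩
    simp only [LinearMap.comp_apply, LinearMap.neg_apply, Submodule.subtype_apply,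
      signInv_of_mem 𝒜 hy, signInv_of_mem 𝒜 (S.diff_mem hy), map_zsmul]
    simp [Int.negOnePow_sub]
  exact LinearMap.congr_fun this x

/-- The cycles of the chain complex `(A, m_1)`. -/
def cycles : Submodule k A := LinearMap.ker S.diff

/-- The boundaries of the chain complex `(A, m_1)`, inside the cycles. -/
def boundaries : Submodule k S.cycles := (LinearMap.range S.diff).comap S.cycles.subtype

/-- The homology `H_*(A)` of the chain complex `(A, m_1)`. -/
abbrev Homology : Type v := S.cycles ⧸ S.boundaries

/-- The homology class of a cycle. -/
def cls : S.cycles →ₗ[k] S.Homology := S.boundaries.mkQ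

theorem mem_cycles {x : A} : x ∈ S.cycles ↔ S.diff x = 0 := LinearMap.mem_ker

theorem mem_boundaries {x : S.cycles} : x ∈ S.boundaries ↔ ∃ y, S.diff y = x := Iff.rfl

theorem cls_eq_zero {x : S.cycles} : S.cls x = 0 ↔ ∃ y, S.diff y = x := by
  rw [cls, Submodule.mkQ_apply, Submodule.Quotient.mk_eq_zero, mem_boundaries]

theorem cls_surjective : Function.Surjective S.cls := Submodule.mkQ_surjective _

/-- The grading of the homology: `H_n(A)` consists of the classes of cycles of degree `n`. -/
def homologyGrading (n : ℤ) : Submodule k S.Homology :=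
  ((𝒜 n).comap S.cycles.subtype).map S.cls

/-- The projection of `A` onto its component of degree `n`. -/
def proj (𝒜 : ℤ → Submodule k A) [DirectSum.Decomposition 𝒜] (n : ℤ) : A →ₗ[k] A :=
  (𝒜 n).subtype ∘ₗ DirectSum.component k ℤ (fun i => 𝒜 i) n ∘ₗ
    (DirectSum.decomposeLinearEquiv 𝒜).toLinearMap

theorem proj_apply (n : ℤ) (x : A) : proj 𝒜 n x = (DirectSum.decompose 𝒜 x n : A) := rfl

theorem diff_proj (n : ℤ) (x : A) : S.diff (proj 𝒜 n x) = proj 𝒜 (n - 1) (S.diff x) := by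
  have : S.diff ∘ₗ proj 𝒜 n = proj 𝒜 (n - 1) ∘ₗ S.diff := by
    refine DirectSum.decompose_lhom_ext 𝒜 fun i => ?_
    ext ⟨y, hy⟩
    simp only [LinearMap.comp_apply, Submodule.subtype_apply, proj_apply]
    by_cases h : i = n
    · subst h
      rw [DirectSum.decompose_of_mem_same 𝒜 hy,
        DirectSum.decompose_of_mem_same 𝒜 (S.diff_mem hy)]
    · rw [DirectSum.decompose_of_mem_ne 𝒜 hy h,
        DirectSum.decompose_of_mem_ne 𝒜 (S.diff_mem hy) (by lia), map_zero]
  exact LinearMap.congr_fun this x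

theorem proj_mem_cycles (n : ℤ) {x : A} (hx : x ∈ S.cycles) : proj 𝒜 n x ∈ S.cycles := by
  rw [mem_cycles] at hx ⊢
  rw [diff_proj, hx, map_zero]

/-- The projection of the homology onto its component of degree `n`. -/
def homologyProj (n : ℤ) : S.Homology →ₗ[k] S.Homology :=
  S.boundaries.mapQ S.boundaries
    ((proj 𝒜 n).restrict fun _ hx => S.proj_mem_cycles n hx) (by
      rintro x ⟨y, hy⟩
      refine ⟨proj 𝒜 (n + 1) y, ?_⟩
      rw [diff_proj, hy, add_sub_cancel_right]
      rfl)

theorem homologyProj_cls (n : ℤ) (x : S.cycles) :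
    S.homologyProj n (S.cls x) = S.cls ⟨proj 𝒜 n x, S.proj_mem_cycles n x.2⟩ := rfl

theorem homologyProj_of_mem {n : ℤ} {x : S.Homology} (hx : x ∈ S.homologyGrading n) :
    S.homologyProj n x = x := by
  obtain ⟨y, hy, rfl⟩ := hx
  rw [homologyProj_cls]
  exact congrArg _ (Subtype.ext (DirectSum.decompose_of_mem_same 𝒜 hy))

theorem homologyProj_of_mem_ne {n i : ℤ} (h : i ≠ n) {x : S.Homology}
    (hx : x ∈ S.homologyGrading i) : S.homologyProj n x = 0 := by
  obtain ⟨y, hy, rfl⟩ := hx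
  rw [homologyProj_cls]
  have : (⟨proj 𝒜 n y, S.proj_mem_cycles n y.2⟩ : S.cycles) = 0 :=
    Subtype.ext (DirectSum.decompose_of_mem_ne 𝒜 hy h)
  rw [this, map_zero]

/-- `H_*(A) = ⨁ H_n(A)`. -/
theorem homologyGrading_isInternal : DirectSum.IsInternal S.homologyGrading := by
  classical
  constructor
  · rw [injective_iff_map_eq_zero]
    intro z hz
    refine DFinsupp.ext fun n => Subtype.ext ?_
    have key : ∀ w : ⨁ i, S.homologyGrading i,
        S.homologyProj n (DirectSum.coeAddMonoidHom S.homologyGrading w) = w n := by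
      intro w
      induction w using DirectSum.induction_on with
      | zero => simp
      | of i x =>
        rw [DirectSum.coeAddMonoidHom_of]
        by_cases h : i = n
        · subst h
          rw [S.homologyProj_of_mem x.2, DirectSum.of_eq_same]
        · rw [S.homologyProj_of_mem_ne h x.2, DirectSum.of_eq_of_ne _ _ _ (Ne.symm h)]
          rfl
      | add x y hx hy => simp [hx, hy]
    rw [← key z, hz, map_zero]
    rfl
  · intro x
    obtain ⟨y, rfl⟩ := S.cls_surjective x
    refine ⟨∑ i ∈ (DirectSum.decompose 𝒜 (y : A)).support,
      DirectSum.of (fun i => S.homologyGrading i) i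
        ⟨S.cls ⟨proj 𝒜 i y, S.proj_mem_cycles i y.2⟩,
          ⟨_, (DirectSum.decompose 𝒜 (y : A) i).2, rfl⟩⟩, ?_⟩
    rw [map_sum]
    simp only [DirectSum.coeAddMonoidHom_of]
    rw [← map_sum]
    refine congrArg _ (Subtype.ext ?_)
    rw [AddSubmonoidClass.coe_finsetSum]
    exact DirectSum.sum_support_decompose 𝒜 (y : A)

instance homologyDecomposition : DirectSum.Decomposition S.homologyGrading :=
  S.homologyGrading_isInternal.chooseDecomposition

theorem mul_mem_cycles {x y : A} (hx : x ∈ S.cycles) (hy : y ∈ S.cycles) :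
    S.m 2 ![x, y] ∈ S.cycles := by
  rw [mem_cycles] at *
  rw [leibniz, hx, hy, (S.m 2).map_coord_zero 0 rfl, (S.m 2).map_coord_zero 1 rfl, add_zero]

theorem update_left {X : Type v} (x y z : X) : Function.update ![z, y] 0 x = ![x, y] := by
  ext i
  fin_cases i <;> simp

theorem update_right {X : Type v} (x y z : X) : Function.update ![x, z] 1 y = ![x, y] := by
  ext i
  fin_cases i <;> simp

/-- The product of two cycles, as a bilinear map. -/
def cycleMul : S.cycles →ₗ[k] S.cycles →ₗ[k] S.cycles :=
  LinearMap.mk₂ k (fun x y => ⟨S.m 2 ![x, y], S.mul_mem_cycles x.2 y.2⟩)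
    (fun x x' y => Subtype.ext <| by
      simpa only [update_left, Submodule.coe_add, Submodule.coe_smul] using
        (S.m 2).map_update_add ![0, (y : A)] 0 (x : A) (x' : A))
    (fun c x y => Subtype.ext <| by
      simpa only [update_left, Submodule.coe_add, Submodule.coe_smul] using
        (S.m 2).map_update_smul ![0, (y : A)] 0 c (x : A))
    (fun x y y' => Subtype.ext <| by
      simpa only [update_right, Submodule.coe_add, Submodule.coe_smul] using
        (S.m 2).map_update_add ![(x : A), 0] 1 (y : A) (y' : A))
    (fun c x y => Subtype.ext <| by
      simpa only [update_right, Submodule.coe_add, Submodule.coe_smul] using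
        (S.m 2).map_update_smul ![(x : A), 0] 1 c (y : A))

theorem cycleMul_coe (x y : S.cycles) : (S.cycleMul x y : A) = S.m 2 ![(x : A), (y : A)] := rfl

theorem cls_cycleMul_left (x y : S.cycles) (hx : x ∈ S.boundaries) :
    S.cls (S.cycleMul x y) = 0 := by
  obtain ⟨u, hu⟩ := hx
  have hu' : S.diff u = (x : A) := hu
  rw [cls_eq_zero]
  refine ⟨S.m 2 ![u, y], ?_⟩
  rw [leibniz, S.mem_cycles.1 y.2, (S.m 2).map_coord_zero (m := ![signInv 𝒜 u, 0]) 1 rfl,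
    add_zero, hu', cycleMul_coe]

theorem cls_cycleMul_right (x y : S.cycles) (hy : y ∈ S.boundaries) :
    S.cls (S.cycleMul x y) = 0 := by
  obtain ⟨u, hu⟩ := hy
  have hu' : S.diff u = (y : A) := hu
  rw [cls_eq_zero]
  refine ⟨S.m 2 ![signInv 𝒜 x, u], ?_⟩
  rw [leibniz, diff_signInv, S.mem_cycles.1 x.2, map_zero, neg_zero,
    (S.m 2).map_coord_zero (m := ![0, u]) 0 rfl, zero_add, signInv_signInv, hu', cycleMul_coe]

/-- The induced product `[x] ⊗ [y] ↦ [m_2 (x, y)]` on homology. -/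
def inducedProduct : S.Homology →ₗ[k] S.Homology →ₗ[k] S.Homology :=
  S.boundaries.liftQ
    (LinearMap.mk₂ k
      (fun (x : S.cycles) (y : S.Homology) =>
        S.boundaries.liftQ (S.cls ∘ₗ S.cycleMul x)
          (fun z hz => S.cls_cycleMul_right x z hz) y)
      (fun x x' y => by obtain ⟨y, rfl⟩ := S.cls_surjective y; simp [cls])
      (fun c x y => by obtain ⟨y, rfl⟩ := S.cls_surjective y; simp [cls])
      (fun x y y' => map_add _ y y')
      (fun c x y => map_smul _ c y))
    (fun x hx => by
      refine LinearMap.ext fun y => ?_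
      obtain ⟨y, rfl⟩ := S.cls_surjective y
      exact S.cls_cycleMul_left x y hx)

theorem inducedProduct_cls (x y : S.cycles) :
    S.inducedProduct (S.cls x) (S.cls y) = S.cls (S.cycleMul x y) := rfl

end Structure

namespace Morphism

variable {S : Structure 𝒜} {T : Structure ℬ} (φ : Morphism S T)

theorem linPart_diff (x : A) : linPart φ.f (S.diff x) = T.diff (linPart φ.f x) := by
  have h := φ.comm 1 le_rfl (fun _ => x)
  rwa [insertSum_one, compose_one] at h

/-- The map `H_*(A) → H_*(B)` that the chain map `f_1` induces. -/
def homologyMap : S.Homology →ₗ[k] T.Homology :=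
  S.boundaries.mapQ T.boundaries
    ((linPart φ.f).restrict (p := S.cycles) (q := T.cycles) fun x hx => by
      rw [Structure.mem_cycles] at hx ⊢
      rw [← linPart_diff, hx, map_zero])
    (by
      rintro x ⟨y, hy⟩
      refine ⟨linPart φ.f y, ?_⟩
      rw [← linPart_diff, hy]
      rfl)

/-- `φ` is a quasi-isomorphism: `f_1` induces an isomorphism on homology. -/
def IsQuasiIso : Prop := Function.Bijective φ.homologyMap

end Morphism

/-- A minimal model of the `A_∞`-algebra `(A, m)`: an `A_∞`-structure `m'` on `H_*(A)` with
`m'_1 = 0` and `m'_2` the induced product, and a quasi-isomorphism `i` from it to `(A, m)` such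
that `i_1` induces the identity on homology. As `m'_1 = 0`, all elements `x` of `H_*(A)` are cycles
for `m'_1`, and `H_*(A)` is identified with its own homology through `x ↦ cls x`. -/
structure MinimalModel (S : Structure 𝒜) where
  str : Structure S.homologyGrading
  m_one : str.m 1 = 0
  m_two : ∀ x y : S.Homology, str.m 2 ![x, y] = S.inducedProduct x y
  incl : Morphism str S
  quasiIso : incl.IsQuasiIso
  induces_id : ∀ x : str.cycles, incl.homologyMap (str.cls x) = (x : S.Homology)

end Structures

end AInfinity

end

/-! An `A_∞`-structure on `A` amounts to a coderivation of degree `-1` and square zero on the tensor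
coalgebra of the suspension of `A`, and an `A_∞`-morphism to a map of tensor coalgebras that
commutes with these coderivations. Such maps are determined by their components `T(A) → B`, which
can be prescribed freely as long as they vanish on `1` (`hat`, `coder`). The suspension is never
formed: the same space carries the shifted grading `barGrading`, `tau` is the sign involution of
that grading, and `twist` absorbs the signs of the definitions (`compose_apply`, `insertSum_eq`).

Over a field, `(A, m_1)` contracts onto its homology `H`: there are `i`, `p`, `h` with `p i = id`
and `d h + h d = i p - id` (`Structure.exists_contraction`). Everything else is recursion on word
length, measured by `VanishesBelow`: an operator that improves agreement by one letter has a fixed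
point (`exists_fixedPoint`), and a defect that gains one letter each time is zero
(`VanishesBelow.of_succ`).

Existence (`Contraction.exists_transfer`). Let `L` be the part of `b` of arity at least two. Solve
`I = i pr + h L hat(I)` and put `b' = p L hat(I)`. The failure `E` of `I` to be a morphism satisfies
`E = h L D`, where `D` is the coderivation with component `E`; as `L` kills single letters, `E = 0`.
Since `p i = id`, the relation for `b'` then follows from the one for `b`.

Uniqueness. Instead of inverting the inclusion of a minimal model, one constructs a single
`A_∞`-morphism `P` from `(A, m)` to some structure `b₀` on `H` whose linear part is `p`
(`Contraction.exists_cotransfer`). For every minimal model, `P` composed with the inclusion has the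
identity as linear part, so it is invertible (`IsBarMorphism.exists_inverse`). All minimal models
are therefore isomorphic to the same `(H, b₀)`. -/

noncomputable section

namespace AInfinity

open scoped DirectSum TensorProduct
open TensorAlgebra

universe u v w

/-! ### The tensor coalgebra: words and deconcatenation. -/

section TensorCoalgebra

variable {k : Type u} [Field k]
variable {A : Type v} [AddCommGroup A] [Module k A]
variable {B : Type w} [AddCommGroup B] [Module k B]
variable {X : Type*} [AddCommGroup X] [Module k X]

/-- The pure tensor `a₁ ⊗ ⋯ ⊗ aₙ` in the tensor algebra. -/
def word (k : Type u) [Field k] {A : Type v} [AddCommGroup A] [Module k A] (l : List A) :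
    TensorAlgebra k A := (l.map (ι k)).prod

@[simp] theorem word_nil : word k ([] : List A) = 1 := rfl

theorem word_cons (a : A) (l : List A) : word k (a :: l) = ι k a * word k l := by
  simp [word]

theorem word_singleton (a : A) : word k [a] = ι k a := by simp [word]

theorem word_append (l l' : List A) : word k (l ++ l') = word k l * word k l' := by
  simp [word]

theorem tprod_eq_word {n : ℕ} (a : Fin n → A) :
    TensorAlgebra.tprod k A n a = word k (List.ofFn a) := by
  rw [TensorAlgebra.tprod_apply, word, List.map_ofFn]
  rfl

theorem span_word : Submodule.span k (Set.range (word k (A := A))) = ⊤ := by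
  rw [eq_top_iff, ← Algebra.top_toSubmodule, ← TensorAlgebra.adjoin_range_ι,
    Algebra.adjoin_eq_span]
  refine Submodule.span_mono fun x hx => ?_
  induction hx using Submonoid.closure_induction with
  | mem x hx =>
    obtain ⟨a, rfl⟩ := hx
    exact ⟨[a], word_singleton a⟩
  | one => exact ⟨[], rfl⟩
  | mul x y _ _ hx hy =>
    obtain ⟨l, rfl⟩ := hx
    obtain ⟨l', rfl⟩ := hy
    exact ⟨l ++ l', word_append l l'⟩

theorem ext_word {f g : TensorAlgebra k A →ₗ[k] X} (h : ∀ l, f (word k l) = g (word k l)) :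
    f = g := by
  refine LinearMap.ext_on_range (v := word k (A := A)) span_word h

/-- The linear map on the tensor algebra given by a multilinear map in each arity. -/
def glue (f : (n : ℕ) → MultilinearMap k (fun _ : Fin n => A) X) : TensorAlgebra k A →ₗ[k] X :=
  DirectSum.toModule k ℕ X (fun n => PiTensorProduct.lift (f n)) ∘ₗ
    TensorAlgebra.toDirectSum.toLinearMap

theorem glue_ofFn (f : (n : ℕ) → MultilinearMap k (fun _ : Fin n => A) X) {n : ℕ}
    (a : Fin n → A) : glue f (word k (List.ofFn a)) = f n a := by
  rw [← tprod_eq_word, glue, LinearMap.comp_apply, AlgHom.toLinearMap_apply,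
    TensorAlgebra.toDirectSum_tensorPower_tprod, ← DirectSum.lof_eq_of k, DirectSum.toModule_lof,
    PiTensorProduct.lift.tprod]

theorem glue_word (f : (n : ℕ) → MultilinearMap k (fun _ : Fin n => A) X) (l : List A) :
    glue f (word k l) = f l.length l.get := by
  rw [← glue_ofFn, List.ofFn_get]

/-- The recursion that defines the deconcatenation. -/
def comulStep : A →ₗ[k] Module.End k
    ((TensorAlgebra k A ⊗[k] TensorAlgebra k A) × TensorAlgebra k A) :=
  LinearMap.mk₂ k (fun a y => ((ι k a ⊗ₜ 1) * y.1 + 1 ⊗ₜ (ι k a * y.2), ι k a * y.2))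
    (fun a a' y => by
      ext <;> simp [TensorProduct.add_tmul, TensorProduct.tmul_add, add_mul]; abel)
    (fun c a y => by
      ext <;> simp [← TensorProduct.smul_tmul'])
    (fun a y y' => by
      ext <;> simp [TensorProduct.tmul_add, mul_add]; abel)
    (fun c a y => by
      ext <;> simp)

/-- The deconcatenation coproduct of the tensor algebra. -/
def deconcat : TensorAlgebra k A →ₗ[k] TensorAlgebra k A ⊗[k] TensorAlgebra k A :=
  LinearMap.fst k _ _ ∘ₗ LinearMap.applyₗ (1 ⊗ₜ 1, 1) ∘ₗ
    (TensorAlgebra.lift k (comulStep (k := k) (A := A))).toLinearMap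

/-- Deconcatenation is not multiplicative, so it is encoded as an action of the tensor algebra on
pairs: the second entry carries the word read so far, which the recursion for the first entry needs.
-/
theorem lift_comulStep_snd (x : TensorAlgebra k A) :
    (TensorAlgebra.lift k (comulStep (k := k) (A := A)) x (1 ⊗ₜ 1, 1)).2 = x := by
  have : LinearMap.snd k _ _ ∘ₗ LinearMap.applyₗ (1 ⊗ₜ 1, 1) ∘ₗ
    (TensorAlgebra.lift k (comulStep (k := k) (A := A))).toLinearMap = LinearMap.id := by
    refine ext_word fun l => ?_
    induction l with
    | nil => simp
    | cons a l ih =>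
      simp only [LinearMap.comp_apply, LinearMap.applyₗ_apply_apply, LinearMap.snd_apply,
        AlgHom.toLinearMap_apply, LinearMap.id_apply, word_cons, map_mul, lift_ι_apply,
        Module.End.mul_apply] at ih ⊢
      conv_rhs => rw [← ih]
      rfl
  exact LinearMap.congr_fun this x

@[simp] theorem deconcat_one : deconcat (1 : TensorAlgebra k A) = 1 ⊗ₜ 1 := by
  simp [deconcat]

theorem deconcat_ι_mul (a : A) (x : TensorAlgebra k A) :
    deconcat (ι k a * x) = (ι k a ⊗ₜ 1) * deconcat x + 1 ⊗ₜ (ι k a * x) := by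
  simp only [deconcat, LinearMap.comp_apply, LinearMap.applyₗ_apply_apply, LinearMap.fst_apply,
        AlgHom.toLinearMap_apply, map_mul, lift_ι_apply, Module.End.mul_apply]
  conv_rhs =>
    enter [2, 3]
    rw [← lift_comulStep_snd x]
  rfl

theorem deconcat_word (l : List A) : deconcat (word k l) =
    ∑ i ∈ Finset.range (l.length + 1), word k (l.take i) ⊗ₜ word k (l.drop i) := by
  induction l with
  | nil => simp
  | cons a l ih =>
    rw [word_cons, deconcat_ι_mul, ih, List.length_cons, Finset.sum_range_succ' _ (l.length + 1), Finset.mul_sum]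
    simp [word_cons]

theorem assoc_deconcat_mul (a : A) (y : TensorAlgebra k A ⊗[k] TensorAlgebra k A) :
    TensorProduct.assoc k _ _ _ (deconcat.rTensor _ ((ι k a ⊗ₜ 1) * y)) =
      (ι k a ⊗ₜ 1) * TensorProduct.assoc k _ _ _ (deconcat.rTensor _ y) +
        1 ⊗ₜ ((ι k a ⊗ₜ 1) * y) := by
  induction y using TensorProduct.induction_on with
  | zero => simp
  | tmul u v =>
    simp only [Algebra.TensorProduct.tmul_mul_tmul, one_mul, LinearMap.rTensor_tmul,
      deconcat_ι_mul, TensorProduct.add_tmul, map_add, TensorProduct.assoc_tmul]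
    congr 1
    induction deconcat u using TensorProduct.induction_on with
    | zero => simp
    | tmul p q => simp
    | add p q hp hq =>
      simp only [mul_add, TensorProduct.add_tmul, map_add, hp, hq]
  | add p q hp hq =>
    simp only [mul_add, TensorProduct.tmul_add, map_add, hp, hq]
    abel

theorem lTensor_deconcat_mul (a : A) (y : TensorAlgebra k A ⊗[k] TensorAlgebra k A) :
    deconcat.lTensor _ ((ι k a ⊗ₜ 1) * y) = (ι k a ⊗ₜ 1) * deconcat.lTensor _ y := by
  induction y using TensorProduct.induction_on with
  | zero => simp
  | tmul u v => simp
  | add p q hp hq => simp only [mul_add, map_add, hp, hq]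

theorem deconcat_coassoc (x : TensorAlgebra k A) :
    TensorProduct.assoc k _ _ _ (deconcat.rTensor _ (deconcat x)) =
      deconcat.lTensor _ (deconcat x) := by
  have : (TensorProduct.assoc k _ _ _).toLinearMap ∘ₗ deconcat.rTensor _ ∘ₗ deconcat (k := k) =
      deconcat.lTensor (TensorAlgebra k A) ∘ₗ deconcat := by
    refine ext_word fun l => ?_
    induction l with
    | nil => simp
    | cons a l ih =>
      simp only [LinearMap.comp_apply, LinearEquiv.coe_coe] at ih ⊢
      rw [word_cons, deconcat_ι_mul, map_add, map_add, assoc_deconcat_mul, ih, map_add,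
        lTensor_deconcat_mul, LinearMap.lTensor_tmul, deconcat_ι_mul, LinearMap.rTensor_tmul,
        deconcat_one, TensorProduct.assoc_tmul, TensorProduct.tmul_add]
      abel
  exact LinearMap.congr_fun this x

theorem algebraMapInv_word_cons (a : A) (l : List A) :
    algebraMapInv (word k (a :: l)) = 0 := by
  simp [word_cons, algebraMapInv]

theorem rTensor_counit_deconcat (x : TensorAlgebra k A) :
    (algebraMapInv (R := k)).toLinearMap.rTensor _ (deconcat x) = 1 ⊗ₜ x := by
  have : (algebraMapInv (R := k)).toLinearMap.rTensor _ ∘ₗ deconcat =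
      TensorProduct.mk k k (TensorAlgebra k A) 1 := by
    refine ext_word fun l => ?_
    rw [LinearMap.comp_apply, deconcat_word, map_sum, Finset.sum_eq_single 0]
    · simp
    · intro i hi h0
      cases l with
      | nil => simp at hi; omega
      | cons a l =>
        obtain ⟨i, rfl⟩ := Nat.exists_eq_succ_of_ne_zero h0
        simp [algebraMapInv_word_cons]
    · simp
  exact LinearMap.congr_fun this x

theorem lTensor_counit_deconcat (x : TensorAlgebra k A) :
    (algebraMapInv (R := k)).toLinearMap.lTensor _ (deconcat x) = x ⊗ₜ 1 := by
  have : (algebraMapInv (R := k)).toLinearMap.lTensor _ ∘ₗ deconcat =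
      (TensorProduct.mk k (TensorAlgebra k A) k).flip 1 := by
    refine ext_word fun l => ?_
    rw [LinearMap.comp_apply, deconcat_word, map_sum, Finset.sum_eq_single l.length]
    · simp
    · intro i hi h0
      have hi' : i < l.length := by
        have := Finset.mem_range.1 hi
        omega
      rw [List.drop_eq_getElem_cons hi', LinearMap.lTensor_tmul, AlgHom.toLinearMap_apply,
        algebraMapInv_word_cons, TensorProduct.tmul_zero]
    · simp
  exact LinearMap.congr_fun this x

/-- The tensor coalgebra: the tensor algebra with the deconcatenation coproduct. -/
instance tensorCoalgebra : Coalgebra k (TensorAlgebra k A) where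
  comul := deconcat
  counit := algebraMapInv.toLinearMap
  coassoc := LinearMap.ext deconcat_coassoc
  rTensor_counit_comp_comul := LinearMap.ext rTensor_counit_deconcat
  lTensor_counit_comp_comul := LinearMap.ext lTensor_counit_deconcat

theorem comul_word (l : List A) : Coalgebra.comul (R := k) (word k l) =
    ∑ i ∈ Finset.range (l.length + 1), word k (l.take i) ⊗ₜ word k (l.drop i) :=
  deconcat_word l

theorem comul_ι_mul (a : A) (x : TensorAlgebra k A) :
    Coalgebra.comul (R := k) (ι k a * x) =
      (ι k a ⊗ₜ 1) * Coalgebra.comul (R := k) x + 1 ⊗ₜ (ι k a * x) :=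
  deconcat_ι_mul a x

theorem comul_one : Coalgebra.comul (R := k) (1 : TensorAlgebra k A) = 1 ⊗ₜ 1 :=
  deconcat_one

theorem counit_eq (x : TensorAlgebra k A) :
    Coalgebra.counit (R := k) x = algebraMapInv x := rfl

@[simp] theorem counit_one : Coalgebra.counit (R := k) (1 : TensorAlgebra k A) = 1 := by
  simp [counit_eq]

@[simp] theorem counit_ι (a : A) : Coalgebra.counit (R := k) (ι k a) = 0 := by
  simp [counit_eq, algebraMapInv]

@[simp] theorem counit_mul (x y : TensorAlgebra k A) : Coalgebra.counit (R := k) (x * y) =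
    Coalgebra.counit (R := k) x * Coalgebra.counit (R := k) y := by
  simp [counit_eq]

theorem counit_word_cons (a : A) (l : List A) :
    Coalgebra.counit (R := k) (word k (a :: l)) = 0 := algebraMapInv_word_cons a l

theorem convMul_word {R : Type*} [Ring R] [Algebra k R]
    (f g : WithConv (TensorAlgebra k A →ₗ[k] R)) (l : List A) :
    (f * g).ofConv (word k l) = ∑ i ∈ Finset.range (l.length + 1),
      f.ofConv (word k (l.take i)) * g.ofConv (word k (l.drop i)) := by
  rw [LinearMap.convMul_apply, comul_word]
  simp

/-- The projection of the tensor algebra onto `A`. -/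
def pr (k : Type u) [Field k] (A : Type v) [AddCommGroup A] [Module k A] :
    TensorAlgebra k A →ₗ[k] A := glue (idFamily k A)

@[simp] theorem pr_one : pr k A 1 = 0 := by
  rw [← word_nil, pr, glue_word]
  rfl

@[simp] theorem pr_ι (a : A) : pr k A (ι k a) = a := by
  rw [← word_singleton, pr, glue_word]
  rfl

theorem pr_word_of_length_ne {l : List A} (h : l.length ≠ 1) : pr k A (word k l) = 0 := by
  match l, h with
  | [], _ => exact pr_one
  | [a], h => simp at h
  | a :: b :: l, _ =>
    rw [pr, glue_word]
    rfl

theorem pr_comp_ι : pr k A ∘ₗ ι k = LinearMap.id := LinearMap.ext pr_ι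

/-- A product of words is a single letter only if one factor is empty and the other is a letter. -/
theorem pr_mul (x y : TensorAlgebra k A) : pr k A (x * y) =
    Coalgebra.counit (R := k) x • pr k A y + Coalgebra.counit (R := k) y • pr k A x := by
  have key : ∀ l l' : List A, pr k A (word k l * word k l') =
      Coalgebra.counit (R := k) (word k l) • pr k A (word k l') +
        Coalgebra.counit (R := k) (word k l') • pr k A (word k l) := by
    intro l l'
    rcases l with _ | ⟨a, l⟩
    · simp
    rcases l' with _ | ⟨a', l'⟩
    · simp
    rw [← word_append, counit_word_cons, counit_word_cons, pr_word_of_length_ne (by simp)]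
    simp
  have h1 : ∀ l, pr k A ∘ₗ LinearMap.mulLeft k (word k l) =
      Coalgebra.counit (R := k) (word k l) • pr k A +
        (Coalgebra.counit (R := k)).smulRight (pr k A (word k l)) := fun l =>
    ext_word fun l' => by simpa using key l l'
  have h2 : pr k A ∘ₗ LinearMap.mulRight k y =
      (Coalgebra.counit (R := k)).smulRight (pr k A y) +
        Coalgebra.counit (R := k) y • pr k A :=
    ext_word fun l => by simpa using LinearMap.congr_fun (h1 l) y
  simpa using LinearMap.congr_fun h2 x

/-- Every tensor is recovered from its first letters and the corresponding remainders. -/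
theorem eq_counit_add_mul_pr_comul (x : TensorAlgebra k A) :
    x = algebraMap k _ (Coalgebra.counit (R := k) x) +
      LinearMap.mul' k _ (TensorProduct.map (ι k ∘ₗ pr k A) LinearMap.id
        (Coalgebra.comul (R := k) x)) := by
  have : LinearMap.id = Algebra.linearMap k _ ∘ₗ Coalgebra.counit (R := k) +
      LinearMap.mul' k _ ∘ₗ TensorProduct.map (ι k ∘ₗ pr k A) LinearMap.id ∘ₗ
        Coalgebra.comul (R := k) := by
    refine ext_word fun l => ?_
    simp only [LinearMap.add_apply, LinearMap.comp_apply, comul_word, map_sum,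
      TensorProduct.map_tmul, LinearMap.mul'_apply, LinearMap.id_apply]
    rcases l with _ | ⟨a, l⟩
    · simp
    -- Only the cut after the first letter survives the projection onto single letters.
    rw [Finset.sum_eq_single 1]
    · simp [word_cons]
    · intro i hi h1
      rw [pr_word_of_length_ne, map_zero, zero_mul]
      simp at hi ⊢
      omega
    · simp
  exact LinearMap.congr_fun this x

end TensorCoalgebra

/-! ### Convolution, recursive equations, coalgebra maps and coderivations. -/

section Convolution

variable {k : Type u} [Field k]
variable {A : Type v} [AddCommGroup A] [Module k A]
variable {B : Type w} [AddCommGroup B] [Module k B]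
variable {C : Type*} [AddCommGroup C] [Module k C]
variable {X : Type*} [AddCommGroup X] [Module k X]
variable {Y : Type*} [AddCommGroup Y] [Module k Y]
variable {R : Type*} [Ring R] [Algebra k R]
variable {S : Type*} [Ring S] [Algebra k S]

/-- The convolution of two linear maps from the tensor coalgebra to an algebra. -/
def conv (f g : TensorAlgebra k A →ₗ[k] R) : TensorAlgebra k A →ₗ[k] R :=
  (WithConv.toConv f * WithConv.toConv g).ofConv

local notation:70 f:70 "⋆" g:71 => conv f g

/-- The unit of the convolution product. -/
def convUnit (k : Type u) [Field k] (A : Type v) [AddCommGroup A] [Module k A]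
    (R : Type*) [Ring R] [Algebra k R] : TensorAlgebra k A →ₗ[k] R :=
  Algebra.linearMap k R ∘ₗ Coalgebra.counit

theorem conv_apply (f g : TensorAlgebra k A →ₗ[k] R) (x : TensorAlgebra k A) :
    (f ⋆ g) x = LinearMap.mul' k R (TensorProduct.map f g (Coalgebra.comul x)) := rfl

theorem conv_word (f g : TensorAlgebra k A →ₗ[k] R) (l : List A) :
    (f ⋆ g) (word k l) = ∑ i ∈ Finset.range (l.length + 1),
      f (word k (l.take i)) * g (word k (l.drop i)) := convMul_word _ _ l

theorem conv_assoc (f g h : TensorAlgebra k A →ₗ[k] R) : f ⋆ g ⋆ h = f ⋆ (g ⋆ h) :=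
  congrArg WithConv.ofConv
    (mul_assoc (WithConv.toConv f) (WithConv.toConv g) (WithConv.toConv h))

@[simp] theorem convUnit_conv (f : TensorAlgebra k A →ₗ[k] R) : convUnit k A R ⋆ f = f :=
  congrArg WithConv.ofConv (one_mul (WithConv.toConv f))

@[simp] theorem conv_convUnit (f : TensorAlgebra k A →ₗ[k] R) : f ⋆ convUnit k A R = f :=
  congrArg WithConv.ofConv (mul_one (WithConv.toConv f))

theorem conv_add (f g h : TensorAlgebra k A →ₗ[k] R) : f ⋆ (g + h) = f ⋆ g + f ⋆ h :=
  congrArg WithConv.ofConv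
    (mul_add (WithConv.toConv f) (WithConv.toConv g) (WithConv.toConv h))

theorem add_conv (f g h : TensorAlgebra k A →ₗ[k] R) : (f + g) ⋆ h = f ⋆ h + g ⋆ h :=
  congrArg WithConv.ofConv
    (add_mul (WithConv.toConv f) (WithConv.toConv g) (WithConv.toConv h))

theorem conv_sub (f g h : TensorAlgebra k A →ₗ[k] R) : f ⋆ (g - h) = f ⋆ g - f ⋆ h :=
  congrArg WithConv.ofConv
    (mul_sub (WithConv.toConv f) (WithConv.toConv g) (WithConv.toConv h))

theorem sub_conv (f g h : TensorAlgebra k A →ₗ[k] R) : (f - g) ⋆ h = f ⋆ h - g ⋆ h :=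
  congrArg WithConv.ofConv
    (sub_mul (WithConv.toConv f) (WithConv.toConv g) (WithConv.toConv h))

theorem algHom_comp_conv (φ : R →ₐ[k] S) (f g : TensorAlgebra k A →ₗ[k] R) :
    φ.toLinearMap ∘ₗ (f ⋆ g) = (φ.toLinearMap ∘ₗ f) ⋆ (φ.toLinearMap ∘ₗ g) :=
  LinearMap.algHom_comp_convMul_distrib φ (WithConv.toConv f) (WithConv.toConv g)

theorem algHom_comp_convUnit (φ : R →ₐ[k] S) :
    φ.toLinearMap ∘ₗ convUnit k A R = convUnit k A S := by
  ext x
  simp [convUnit]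

@[simp] theorem convUnit_one : convUnit k A R 1 = 1 := by simp [convUnit]

@[simp] theorem convUnit_word_cons (a : A) (l : List A) : convUnit k A R (word k (a :: l)) = 0 := by
  rw [convUnit, LinearMap.comp_apply, counit_word_cons, map_zero]

theorem convUnit_word_of_ne {l : List A} (h : l ≠ []) : convUnit k A R (word k l) = 0 := by
  obtain ⟨a, l, rfl⟩ := List.exists_cons_of_ne_nil h
  exact convUnit_word_cons a l

/-- A linear map that is zero on all words of length less than `n`. -/
def VanishesBelow (n : ℕ) (f : TensorAlgebra k A →ₗ[k] X) : Prop :=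
  ∀ l : List A, l.length < n → f (word k l) = 0

namespace VanishesBelow

theorem zero (f : TensorAlgebra k A →ₗ[k] X) : VanishesBelow 0 f := fun _ h => absurd h (by simp)

theorem mono {m n : ℕ} {f : TensorAlgebra k A →ₗ[k] X} (h : VanishesBelow n f) (hmn : m ≤ n) :
    VanishesBelow m f := fun l hl => h l (by omega)

theorem add {n : ℕ} {f g : TensorAlgebra k A →ₗ[k] X} (hf : VanishesBelow n f)
    (hg : VanishesBelow n g) : VanishesBelow n (f + g) := fun l hl => by
  simp [hf l hl, hg l hl]

theorem sub {n : ℕ} {f g : TensorAlgebra k A →ₗ[k] X} (hf : VanishesBelow n f)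
    (hg : VanishesBelow n g) : VanishesBelow n (f - g) := fun l hl => by
  simp [hf l hl, hg l hl]

theorem neg {n : ℕ} {f : TensorAlgebra k A →ₗ[k] X} (hf : VanishesBelow n f) :
    VanishesBelow n (-f) := fun l hl => by
  simp [hf l hl]

theorem comp {n : ℕ} {f : TensorAlgebra k A →ₗ[k] X} (hf : VanishesBelow n f) (g : X →ₗ[k] Y) :
    VanishesBelow n (g ∘ₗ f) := fun l hl => by
  simp [hf l hl]

theorem conv {m n : ℕ} {f g : TensorAlgebra k A →ₗ[k] R} (hf : VanishesBelow m f)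
    (hg : VanishesBelow n g) : VanishesBelow (m + n) (f ⋆ g) := fun l hl => by
  rw [conv_word]
  refine Finset.sum_eq_zero fun i hi => ?_
  rw [Finset.mem_range] at hi
  by_cases h : i < m
  · rw [hf _ (by simp; omega), zero_mul]
  · rw [hg _ (by simp; omega), mul_zero]

theorem eq_zero {f : TensorAlgebra k A →ₗ[k] X} (h : ∀ n, VanishesBelow n f) : f = 0 :=
  ext_word fun l => h (l.length + 1) l (by simp)

theorem of_map_one {f : TensorAlgebra k A →ₗ[k] X} (h : f 1 = 0) : VanishesBelow 1 f :=
  fun l hl => by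
    obtain rfl : l = [] := by simpa using hl
    exact h

theorem map_one {n : ℕ} {f : TensorAlgebra k A →ₗ[k] X} (h : VanishesBelow n f) (hn : 1 ≤ n) :
    f 1 = 0 := h [] hn

/-- The form in which defects are shown to vanish: an equation expressing `f` through itself gains
one letter. -/
theorem of_succ {f : TensorAlgebra k A →ₗ[k] X}
    (h : ∀ n, VanishesBelow n f → VanishesBelow (n + 1) f) : f = 0 :=
  eq_zero fun n => Nat.rec (zero f) h n

end VanishesBelow

/-- On words of length `n` the sequence is constant from index `n + 1` on, and that value defines
the limit. -/
theorem exists_limit (s : ℕ → TensorAlgebra k A →ₗ[k] X)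
    (hs : ∀ n, VanishesBelow n (s (n + 1) - s n)) :
    ∃ f : TensorAlgebra k A →ₗ[k] X, ∀ n, VanishesBelow n (f - s n) := by
  have hword (l : List A) : glue (fun n => (s (n + 1)).compMultilinearMap
      (TensorAlgebra.tprod k A n)) (word k l) = s (l.length + 1) (word k l) := by
    rw [glue_word, LinearMap.compMultilinearMap_apply, tprod_eq_word, List.ofFn_get]
  refine ⟨glue fun n => (s (n + 1)).compMultilinearMap (TensorAlgebra.tprod k A n),
    fun n l hl => ?_⟩
  rw [LinearMap.sub_apply, hword, sub_eq_zero]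
  obtain ⟨m, rfl⟩ := Nat.exists_eq_add_of_le (Nat.succ_le_of_lt hl)
  clear hl
  induction m with
  | zero => rfl
  | succ m ih =>
    rw [ih]
    exact (sub_eq_zero.1 (hs (l.length.succ + m) l (by omega))).symm

/-- A map that improves the agreement of linear maps on words by one letter has a fixed point,
which is the limit of the iterates. -/
theorem exists_fixedPoint (Θ : (TensorAlgebra k A →ₗ[k] X) → TensorAlgebra k A →ₗ[k] X)
    (P : (TensorAlgebra k A →ₗ[k] X) → Prop) (h0 : P 0) (hP : ∀ f, P f → P (Θ f))
    (hlim : ∀ f, (∀ n, ∃ g, P g ∧ VanishesBelow n (f - g)) → P f)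
    (hΘ : ∀ n f g, P f → P g → VanishesBelow n (f - g) → VanishesBelow (n + 1) (Θ f - Θ g)) :
    ∃ f, P f ∧ Θ f = f := by
  have hPn (n : ℕ) : P (Θ^[n] 0) := by
    induction n with
    | zero => exact h0
    | succ n ih => rw [Function.iterate_succ_apply']; exact hP _ ih
  obtain ⟨f, hf⟩ := exists_limit (fun n => Θ^[n] 0) (fun n => by
    induction n with
    | zero => exact .zero _
    | succ n ih =>
      simp only [Function.iterate_succ_apply'] at ih ⊢
      have h1 := hPn n
      exact hΘ _ _ _ (hP _ h1) h1 ih)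
  have hPf : P f := hlim f fun n => ⟨_, hPn n, hf n⟩
  refine ⟨f, hPf, sub_eq_zero.1 (VanishesBelow.eq_zero fun n => ?_)⟩
  -- Both `Θ f` and `f` agree with iterate `n + 1` on words of length at most `n`.
  have h1 := hΘ n f _ hPf (hPn n) (hf n)
  have h2 := hf (n + 1)
  rw [Function.iterate_succ_apply'] at h2
  simpa using (h1.sub h2).mono (Nat.le_succ n)

/-- Solutions of `Z = K + φ ⋆ Z` inherit properties that can be checked on words. -/
theorem mem_of_eq_add_conv {φ K Z : TensorAlgebra k A →ₗ[k] R} (hφ : φ 1 = 0)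
    (hZ : Z = K + φ ⋆ Z) (Q : List A → Submodule k R) (hK : ∀ l, K (word k l) ∈ Q l)
    (hQ : ∀ l l' y, y ∈ Q l' → φ (word k l) * y ∈ Q (l ++ l')) (l : List A) :
    Z (word k l) ∈ Q l := by
  induction hn : l.length using Nat.strong_induction_on generalizing l with
  | _ n ih =>
    rw [hZ, LinearMap.add_apply, conv_word]
    refine Submodule.add_mem _ (hK l) (Submodule.sum_mem _ fun i hi => ?_)
    rw [Finset.mem_range] at hi
    -- The cut at `0` is the only one where `Z` sees the whole word again, and `φ 1 = 0` removes it.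
    rcases Nat.eq_zero_or_pos i with rfl | h
    · simp [hφ]
    · have := hQ (l.take i) (l.drop i) _ (ih (l.drop i).length (by simp; omega) _ rfl)
      rwa [List.take_append_drop] at this

theorem eq_zero_of_eq_conv {φ Z : TensorAlgebra k A →ₗ[k] R} (hφ : φ 1 = 0) (hZ : Z = φ ⋆ Z) :
    Z = 0 :=
  ext_word fun l => by
    simpa using mem_of_eq_add_conv hφ (K := 0) (by simpa using hZ) (fun _ => ⊥) (by simp)
      (by simp) l

/-- As `φ 1 = 0`, the equation determines `Z` on a word from its values on shorter words. Coalgebra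
maps and coderivations are identified below by showing that both sides solve the same such equation.
-/
theorem eq_of_eq_add_conv {φ K Z Z' : TensorAlgebra k A →ₗ[k] R} (hφ : φ 1 = 0)
    (hZ : Z = K + φ ⋆ Z) (hZ' : Z' = K + φ ⋆ Z') : Z = Z' := by
  rw [← sub_eq_zero]
  refine eq_zero_of_eq_conv hφ ?_
  rw [conv_sub]
  nth_rewrite 1 [hZ, hZ']
  abel

theorem exists_eq_add_conv {φ : TensorAlgebra k A →ₗ[k] R} (hφ : φ 1 = 0)
    (K : TensorAlgebra k A →ₗ[k] R) : ∃ Z, Z = K + φ ⋆ Z := by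
  obtain ⟨Z, -, hZ⟩ := exists_fixedPoint (fun Z => K + φ ⋆ Z) (fun _ => True) trivial
    (fun _ _ => trivial) (fun _ _ => trivial) (fun n f g _ _ h => by
      rw [add_sub_add_left_eq_sub, ← conv_sub, add_comm n]
      exact (VanishesBelow.of_map_one hφ).conv h)
  exact ⟨Z, hZ.symm⟩

open Classical in
/-- The map of tensor coalgebras with a given component `F`, for `F 1 = 0`. -/
def hat (F : TensorAlgebra k A →ₗ[k] B) : TensorAlgebra k A →ₗ[k] TensorAlgebra k B :=
  if h : (ι k ∘ₗ F) 1 = 0 then (exists_eq_add_conv h (convUnit k A _)).choose else 0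

/-- `hat F` sums over all ways to cut a word into blocks and applies `F` to each; the equation
splits off the first block. -/
theorem hat_eq {F : TensorAlgebra k A →ₗ[k] B} (h : F 1 = 0) :
    hat F = convUnit k A _ + (ι k ∘ₗ F) ⋆ hat F := by
  have h' : (ι k ∘ₗ F) 1 = 0 := by simp [h]
  rw [hat, dif_pos h']
  exact (exists_eq_add_conv h' (convUnit k A _)).choose_spec

/-- A map of tensor coalgebras. -/
structure IsCoalgHom (Φ : TensorAlgebra k A →ₗ[k] TensorAlgebra k B) : Prop where
  comul (x) : Coalgebra.comul (R := k) (Φ x) = TensorProduct.map Φ Φ (Coalgebra.comul (R := k) x)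
  counit (x) : Coalgebra.counit (R := k) (Φ x) = Coalgebra.counit (R := k) x
  map_one : Φ 1 = 1

/-- A coderivation along the coalgebra maps `Φ` and `Ψ`. -/
structure IsCoder (Φ Ψ D : TensorAlgebra k A →ₗ[k] TensorAlgebra k B) : Prop where
  comul (x) : Coalgebra.comul (R := k) (D x) =
    TensorProduct.map Φ D (Coalgebra.comul (R := k) x) +
      TensorProduct.map D Ψ (Coalgebra.comul (R := k) x)
  counit (x) : Coalgebra.counit (R := k) (D x) = 0

/-- The inclusion of the left factor of the tensor square. -/
abbrev inl (k : Type u) [Field k] (B : Type w) [AddCommGroup B] [Module k B] :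
    TensorAlgebra k B →ₐ[k] TensorAlgebra k B ⊗[k] TensorAlgebra k B :=
  Algebra.TensorProduct.includeLeft

/-- The inclusion of the right factor of the tensor square. -/
abbrev inr (k : Type u) [Field k] (B : Type w) [AddCommGroup B] [Module k B] :
    TensorAlgebra k B →ₐ[k] TensorAlgebra k B ⊗[k] TensorAlgebra k B :=
  Algebra.TensorProduct.includeRight

theorem map_comp_comul (Φ Ψ : TensorAlgebra k A →ₗ[k] TensorAlgebra k B) :
    TensorProduct.map Φ Ψ ∘ₗ Coalgebra.comul =
      ((inl k B).toLinearMap ∘ₗ Φ) ⋆ ((inr k B).toLinearMap ∘ₗ Ψ) :=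
  ext_word fun l => by
    rw [conv_word, LinearMap.comp_apply, comul_word]
    simp

/-- This is `comul_ι_mul` written with convolutions in the algebra `T(B) ⊗ T(B)`, so that the
uniqueness of solutions applies there. -/
theorem comul_comp_conv (E : TensorAlgebra k A →ₗ[k] B)
    (Z : TensorAlgebra k A →ₗ[k] TensorAlgebra k B) :
    Coalgebra.comul ∘ₗ ((ι k ∘ₗ E) ⋆ Z) =
      ((inl k B).toLinearMap ∘ₗ ι k ∘ₗ E) ⋆ (Coalgebra.comul ∘ₗ Z) +
        (inr k B).toLinearMap ∘ₗ ((ι k ∘ₗ E) ⋆ Z) :=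
  ext_word fun l => by
    rw [LinearMap.add_apply, conv_word]
    simp only [LinearMap.comp_apply, conv_word, map_sum, comul_ι_mul, Finset.sum_add_distrib]
    simp

theorem comul_comp_convUnit :
    Coalgebra.comul ∘ₗ convUnit k A (TensorAlgebra k B) = convUnit k A _ := by
  ext x
  simp [convUnit, Algebra.algebraMap_eq_smul_one, comul_one, Algebra.TensorProduct.one_def]

theorem hat_one {F : TensorAlgebra k A →ₗ[k] B} (h : F 1 = 0) : hat F 1 = 1 := by
  rw [hat_eq h, ← word_nil, LinearMap.add_apply, conv_word]
  simp [h]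

theorem counit_hat {F : TensorAlgebra k A →ₗ[k] B} (h : F 1 = 0) (x : TensorAlgebra k A) :
    Coalgebra.counit (R := k) (hat F x) = Coalgebra.counit (R := k) x := by
  have : Coalgebra.counit (R := k) ∘ₗ hat F = Coalgebra.counit :=
    ext_word fun l => by
      rw [hat_eq h, LinearMap.comp_apply, LinearMap.add_apply, conv_word]
      simp [convUnit, counit_eq]
      simp [algebraMapInv]
  exact LinearMap.congr_fun this x

/-- For compatibility with the coproduct, `Δ ∘ hat F` and `(hat F ⊗ hat F) ∘ Δ` both solve `Z = inr
∘ hat F + (inl ∘ ι ∘ F) ⋆ Z`. -/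
theorem isCoalgHom_hat {F : TensorAlgebra k A →ₗ[k] B} (h : F 1 = 0) : IsCoalgHom (hat F) where
  comul x := by
    refine LinearMap.congr_fun (f := Coalgebra.comul ∘ₗ hat F)
      (g := TensorProduct.map (hat F) (hat F) ∘ₗ Coalgebra.comul) ?_ x
    refine eq_of_eq_add_conv (φ := (inl k B).toLinearMap ∘ₗ ι k ∘ₗ F)
      (K := (inr k B).toLinearMap ∘ₗ hat F) (by simp [h]) ?_ ?_
    · conv_lhs => rw [hat_eq h, LinearMap.comp_add, comul_comp_conv, comul_comp_convUnit]
      conv_rhs => enter [1]; rw [hat_eq h, LinearMap.comp_add, algHom_comp_convUnit]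
      abel
    · conv_lhs => rw [map_comp_comul]
      conv_lhs => enter [1]; rw [hat_eq h, LinearMap.comp_add, algHom_comp_conv]
      rw [algHom_comp_convUnit, add_conv, convUnit_conv, conv_assoc, map_comp_comul]
  counit := counit_hat h
  map_one := hat_one h

theorem pr_comp_conv_of_counit {E : TensorAlgebra k A →ₗ[k] B}
    {Ψ : TensorAlgebra k A →ₗ[k] TensorAlgebra k B}
    (hΨ : ∀ x, Coalgebra.counit (R := k) (Ψ x) = Coalgebra.counit (R := k) x) :
    pr k B ∘ₗ ((ι k ∘ₗ E) ⋆ Ψ) = E :=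
  ext_word fun l => by
    rw [LinearMap.comp_apply, conv_word, map_sum, Finset.sum_eq_single l.length]
    · simp [pr_mul, hΨ]
    · intro i hi h0
      have hi' : i < l.length := by
        have := Finset.mem_range.1 hi
        omega
      rw [pr_mul, hΨ, List.drop_eq_getElem_cons hi', counit_word_cons]
      simp
    · simp

theorem pr_comp_conv_of_counit_eq_zero {Φ Z : TensorAlgebra k A →ₗ[k] TensorAlgebra k B}
    (hΦ : ∀ x, Coalgebra.counit (R := k) (Φ x) = Coalgebra.counit (R := k) x)
    (hZ : ∀ x, Coalgebra.counit (R := k) (Z x) = 0) :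
    pr k B ∘ₗ (Φ ⋆ Z) = pr k B ∘ₗ Z :=
  ext_word fun l => by
    rw [LinearMap.comp_apply, conv_word, map_sum, Finset.sum_eq_single 0]
    · simp [pr_mul, hΦ, hZ]
    · intro i hi h0
      rw [Finset.mem_range] at hi
      rcases l with _ | ⟨a, l⟩
      · simp at hi; omega
      obtain ⟨i, rfl⟩ := Nat.exists_eq_succ_of_ne_zero h0
      rw [pr_mul, hΦ, hZ, List.take_succ_cons, counit_word_cons]
      simp
    · simp

theorem pr_comp_hat {F : TensorAlgebra k A →ₗ[k] B} (h : F 1 = 0) : pr k B ∘ₗ hat F = F := by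
  rw [hat_eq h, LinearMap.comp_add, pr_comp_conv_of_counit (counit_hat h)]
  ext x
  simp [convUnit, Algebra.algebraMap_eq_smul_one]

theorem pr_hat {F : TensorAlgebra k A →ₗ[k] B} (h : F 1 = 0) (x : TensorAlgebra k A) :
    pr k B (hat F x) = F x := LinearMap.congr_fun (pr_comp_hat h) x

namespace IsCoalgHom

variable {Φ Ψ : TensorAlgebra k A →ₗ[k] TensorAlgebra k B}

/-- Apply `eq_counit_add_mul_pr_comul` to `Φ x`. A coalgebra map thus satisfies the recursion of
`hat` for its own component, hence is determined by it. -/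
theorem eq_add_conv (hΦ : IsCoalgHom Φ) :
    Φ = convUnit k A _ + (ι k ∘ₗ pr k B ∘ₗ Φ) ⋆ Φ := by
  ext x
  conv_lhs => rw [eq_counit_add_mul_pr_comul (Φ x)]
  rw [hΦ.comul, hΦ.counit, LinearMap.add_apply, conv_apply,
    TensorProduct.map_map]
  rfl

theorem ext (hΦ : IsCoalgHom Φ) (hΨ : IsCoalgHom Ψ) (h : pr k B ∘ₗ Φ = pr k B ∘ₗ Ψ) : Φ = Ψ := by
  have h1 := hΨ.eq_add_conv
  rw [← h] at h1
  exact eq_of_eq_add_conv (by simp [hΦ.map_one]) hΦ.eq_add_conv h1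

theorem pr_one (hΦ : IsCoalgHom Φ) : (pr k B ∘ₗ Φ) 1 = 0 := by simp [hΦ.map_one]

theorem eq_hat (hΦ : IsCoalgHom Φ) : Φ = hat (pr k B ∘ₗ Φ) :=
  hΦ.ext (isCoalgHom_hat hΦ.pr_one) (pr_comp_hat hΦ.pr_one).symm

theorem comp {Φ' : TensorAlgebra k B →ₗ[k] TensorAlgebra k C} (hΦ' : IsCoalgHom Φ')
    (hΦ : IsCoalgHom Φ) : IsCoalgHom (Φ' ∘ₗ Φ) where
  comul x := by
    rw [LinearMap.comp_apply, hΦ'.comul, hΦ.comul, TensorProduct.map_comp]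
    rfl
  counit x := by rw [LinearMap.comp_apply, hΦ'.counit, hΦ.counit]
  map_one := by rw [LinearMap.comp_apply, hΦ.map_one, hΦ'.map_one]

theorem id : IsCoalgHom (LinearMap.id : TensorAlgebra k A →ₗ[k] TensorAlgebra k A) where
  comul x := by simp
  counit x := rfl
  map_one := rfl

end IsCoalgHom

theorem hat_comp_hat {G : TensorAlgebra k B →ₗ[k] C} {F : TensorAlgebra k A →ₗ[k] B}
    (hG : G 1 = 0) (hF : F 1 = 0) : hat G ∘ₗ hat F = hat (G ∘ₗ hat F) := by
  rw [((isCoalgHom_hat hG).comp (isCoalgHom_hat hF)).eq_hat, ← LinearMap.comp_assoc,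
    pr_comp_hat hG]

theorem hat_pr : hat (pr k A) = LinearMap.id := IsCoalgHom.id.eq_hat.symm

/-- The coderivation along `Φ` and `Ψ` with component `E`. -/
def coder (Φ : TensorAlgebra k A →ₗ[k] TensorAlgebra k B) (E : TensorAlgebra k A →ₗ[k] B)
    (Ψ : TensorAlgebra k A →ₗ[k] TensorAlgebra k B) : TensorAlgebra k A →ₗ[k] TensorAlgebra k B :=
  Φ ⋆ ((ι k ∘ₗ E) ⋆ Ψ)

section

variable {Φ Ψ : TensorAlgebra k A →ₗ[k] TensorAlgebra k B}

theorem coder_eq (hΦ : IsCoalgHom Φ) (E : TensorAlgebra k A →ₗ[k] B) :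
    coder Φ E Ψ = (ι k ∘ₗ E) ⋆ Ψ + (ι k ∘ₗ pr k B ∘ₗ Φ) ⋆ coder Φ E Ψ := by
  conv_lhs => rw [coder, hΦ.eq_add_conv, add_conv, convUnit_conv, conv_assoc]
  rfl

theorem counit_ι_conv (E : TensorAlgebra k A →ₗ[k] B) (x : TensorAlgebra k A) :
    Coalgebra.counit (R := k) (((ι k ∘ₗ E) ⋆ Ψ) x) = 0 := by
  have : Coalgebra.counit (R := k) ∘ₗ ((ι k ∘ₗ E) ⋆ Ψ) = 0 :=
    ext_word fun l => by
      rw [LinearMap.comp_apply, conv_word, map_sum]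
      simp
  exact LinearMap.congr_fun this x

theorem counit_coder (E : TensorAlgebra k A →ₗ[k] B) (x : TensorAlgebra k A) :
    Coalgebra.counit (R := k) (coder Φ E Ψ x) = 0 := by
  have : Coalgebra.counit (R := k) ∘ₗ coder Φ E Ψ = 0 :=
    ext_word fun l => by
      rw [LinearMap.comp_apply, coder, conv_word, map_sum]
      simp [counit_ι_conv]
  exact LinearMap.congr_fun this x

/-- Splitting off the first block produced by `Φ` shows that both sides of the coderivation identity
solve one equation in `T(B) ⊗ T(B)`. `TensorProduct.map` carries no Koszul sign; in the applications
the sign sits in `Φ`, through `tau`. -/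
theorem isCoder_coder (hΦ : IsCoalgHom Φ) (hΨ : IsCoalgHom Ψ) (E : TensorAlgebra k A →ₗ[k] B) :
    IsCoder Φ Ψ (coder Φ E Ψ) where
  counit := counit_coder E
  comul x := by
    set D := coder Φ E Ψ with hD
    refine LinearMap.congr_fun (f := Coalgebra.comul ∘ₗ D)
      (g := TensorProduct.map Φ D ∘ₗ Coalgebra.comul +
        TensorProduct.map D Ψ ∘ₗ Coalgebra.comul) ?_ x
    have hΨ' : Coalgebra.comul ∘ₗ Ψ =
      ((inl k B).toLinearMap ∘ₗ Ψ) ⋆ ((inr k B).toLinearMap ∘ₗ Ψ) := by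
      rw [← map_comp_comul]
      exact LinearMap.ext hΨ.comul
    refine eq_of_eq_add_conv (φ := (inl k B).toLinearMap ∘ₗ ι k ∘ₗ pr k B ∘ₗ Φ)
      (K := ((inl k B).toLinearMap ∘ₗ ι k ∘ₗ E) ⋆ (Coalgebra.comul ∘ₗ Ψ) +
        (inr k B).toLinearMap ∘ₗ D) (by simp [hΦ.map_one]) ?_ ?_
    · conv_lhs => rw [hD, coder_eq hΦ, LinearMap.comp_add, comul_comp_conv, comul_comp_conv, ← hD]
      conv_rhs => enter [1, 2]; rw [hD, coder_eq hΦ, LinearMap.comp_add, ← hD]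
      abel
    · conv_lhs => rw [map_comp_comul, map_comp_comul]
      conv_lhs => enter [1, 1]; rw [hΦ.eq_add_conv, LinearMap.comp_add, algHom_comp_conv]
      conv_lhs =>
        enter [2, 1]; rw [hD, coder_eq hΦ, LinearMap.comp_add, algHom_comp_conv, algHom_comp_conv]
      rw [algHom_comp_convUnit, add_conv, add_conv, convUnit_conv, conv_assoc, conv_assoc, hΨ',
        conv_assoc, conv_add, map_comp_comul, map_comp_comul]
      abel

theorem pr_comp_coder (hΦ : IsCoalgHom Φ) (hΨ : IsCoalgHom Ψ) (E : TensorAlgebra k A →ₗ[k] B) :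
    pr k B ∘ₗ coder Φ E Ψ = E := by
  rw [coder, pr_comp_conv_of_counit_eq_zero hΦ.counit (counit_ι_conv E),
    pr_comp_conv_of_counit hΨ.counit]

namespace IsCoder

variable {D D' : TensorAlgebra k A →ₗ[k] TensorAlgebra k B}

/-- The first block of `D` comes either from `D` itself, after which only `Ψ` acts, or from `Φ`,
after which `D` is still to act. -/
theorem eq_add_conv (hD : IsCoder Φ Ψ D) :
    D = (ι k ∘ₗ pr k B ∘ₗ D) ⋆ Ψ + (ι k ∘ₗ pr k B ∘ₗ Φ) ⋆ D := by
  ext x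
  conv_lhs => rw [eq_counit_add_mul_pr_comul (D x)]
  rw [hD.comul, hD.counit, map_zero, zero_add, map_add, map_add,
    TensorProduct.map_map, TensorProduct.map_map, add_comm]
  rfl

theorem ext (hΦ : IsCoalgHom Φ) (hD : IsCoder Φ Ψ D) (hD' : IsCoder Φ Ψ D')
    (h : pr k B ∘ₗ D = pr k B ∘ₗ D') : D = D' := by
  have h1 := hD'.eq_add_conv
  rw [← h] at h1
  exact eq_of_eq_add_conv (by simp [hΦ.map_one]) hD.eq_add_conv h1

theorem eq_coder (hΦ : IsCoalgHom Φ) (hΨ : IsCoalgHom Ψ) (hD : IsCoder Φ Ψ D) :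
    D = coder Φ (pr k B ∘ₗ D) Ψ :=
  hD.ext hΦ (isCoder_coder hΦ hΨ _) (pr_comp_coder hΦ hΨ _).symm

theorem add (hD : IsCoder Φ Ψ D) (hD' : IsCoder Φ Ψ D') : IsCoder Φ Ψ (D + D') where
  comul x := by
    simp only [LinearMap.add_apply, map_add, hD.comul, hD'.comul, TensorProduct.map_add_left,
      TensorProduct.map_add_right]
    abel
  counit x := by simp [hD.counit, hD'.counit]

theorem neg (hD : IsCoder Φ Ψ D) : IsCoder Φ Ψ (-D) where
  comul x := by
    have h1 (y : TensorAlgebra k A ⊗[k] TensorAlgebra k A) :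
        TensorProduct.map Φ (-D) y = -TensorProduct.map Φ D y := by
      rw [eq_neg_iff_add_eq_zero, ← LinearMap.add_apply, ← TensorProduct.map_add_right,
        neg_add_cancel, TensorProduct.map_zero_right, LinearMap.zero_apply]
    have h2 (y : TensorAlgebra k A ⊗[k] TensorAlgebra k A) :
        TensorProduct.map (-D) Ψ y = -TensorProduct.map D Ψ y := by
      rw [eq_neg_iff_add_eq_zero, ← LinearMap.add_apply, ← TensorProduct.map_add_left,
        neg_add_cancel, TensorProduct.map_zero_left, LinearMap.zero_apply]
    rw [LinearMap.neg_apply, map_neg, hD.comul, h1, h2]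
    abel
  counit x := by simp [hD.counit]

theorem sub (hD : IsCoder Φ Ψ D) (hD' : IsCoder Φ Ψ D') : IsCoder Φ Ψ (D - D') := by
  rw [sub_eq_add_neg]
  exact hD.add hD'.neg

theorem comp_left {Θ : TensorAlgebra k B →ₗ[k] TensorAlgebra k C} (hΘ : IsCoalgHom Θ)
    (hD : IsCoder Φ Ψ D) : IsCoder (Θ ∘ₗ Φ) (Θ ∘ₗ Ψ) (Θ ∘ₗ D) where
  comul x := by
    rw [LinearMap.comp_apply, hΘ.comul, hD.comul, map_add, TensorProduct.map_comp,
      TensorProduct.map_comp]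
    rfl
  counit x := by rw [LinearMap.comp_apply, hΘ.counit, hD.counit]

theorem comp_right {Θ : TensorAlgebra k C →ₗ[k] TensorAlgebra k A} (hΘ : IsCoalgHom Θ)
    (hD : IsCoder Φ Ψ D) : IsCoder (Φ ∘ₗ Θ) (Ψ ∘ₗ Θ) (D ∘ₗ Θ) where
  comul x := by
    rw [LinearMap.comp_apply, hD.comul, hΘ.comul, TensorProduct.map_comp,
      TensorProduct.map_comp]
    rfl
  counit x := by rw [LinearMap.comp_apply, hD.counit]

end IsCoder

end

end Convolution

/-! ### Word-length estimates for coalgebra maps and coderivations. -/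

section Filtration

variable {k : Type u} [Field k]
variable {A : Type v} [AddCommGroup A] [Module k A]
variable {B : Type w} [AddCommGroup B] [Module k B]
variable {C : Type*} [AddCommGroup C] [Module k C]
variable {X : Type*} [AddCommGroup X] [Module k X]

local notation:70 f:70 "⋆" g:71 => conv f g

/-- The map of tensor algebras induced by a linear map. -/
def tmap (f : A →ₗ[k] B) : TensorAlgebra k A →ₗ[k] TensorAlgebra k B :=
  (TensorAlgebra.lift k (ι k ∘ₗ f)).toLinearMap

@[simp] theorem tmap_word (f : A →ₗ[k] B) (l : List A) :
    tmap f (word k l) = word k (l.map f) := by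
  simp [tmap, word, map_list_prod, Function.comp_def]

theorem tmap_comp (g : B →ₗ[k] C) (f : A →ₗ[k] B) : tmap g ∘ₗ tmap f = tmap (g ∘ₗ f) :=
  ext_word fun l => by simp

theorem tmap_id : tmap (LinearMap.id : A →ₗ[k] A) = LinearMap.id :=
  ext_word fun l => by simp

theorem counit_word_eq (l : List A) :
    Coalgebra.counit (R := k) (word k l) = if l.length = 0 then 1 else 0 := by
  cases l with
  | nil => simp
  | cons a l => simp [counit_word_cons]

theorem isCoalgHom_tmap (f : A →ₗ[k] B) : IsCoalgHom (tmap f) where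
  comul x := by
    refine LinearMap.congr_fun (f := Coalgebra.comul ∘ₗ tmap f)
      (g := TensorProduct.map (tmap f) (tmap f) ∘ₗ Coalgebra.comul) (ext_word fun l => ?_) x
    simp [comul_word, List.map_take, List.map_drop]
  counit x := by
    refine LinearMap.congr_fun (f := Coalgebra.counit ∘ₗ tmap f)
      (g := Coalgebra.counit) (ext_word fun l => ?_) x
    simp [counit_word_eq]
  map_one := by simp [tmap]

theorem pr_comp_tmap (f : A →ₗ[k] B) : pr k B ∘ₗ tmap f = f ∘ₗ pr k A :=
  ext_word fun l => by
    by_cases h : l.length = 1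
    · obtain ⟨a, rfl⟩ := List.length_eq_one_iff.1 h
      rw [LinearMap.comp_apply, tmap_word]
      simp [word_singleton]
    · simp [pr_word_of_length_ne h, pr_word_of_length_ne (l := l.map f) (by simpa using h)]

theorem tmap_comp_ι (f : A →ₗ[k] B) : tmap f ∘ₗ ι k = ι k ∘ₗ f := by
  ext a
  simp [tmap]

/-- The difference of the two recursions, arranged so that it is again a recursion of the form `Z =
K + φ ⋆ Z`. -/
theorem hat_sub_hat_eq {F G : TensorAlgebra k A →ₗ[k] B} (hF : F 1 = 0) (hG : G 1 = 0) :
    hat F - hat G = (ι k ∘ₗ (F - G)) ⋆ hat F + (ι k ∘ₗ G) ⋆ (hat F - hat G) := by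
  conv_lhs => rw [hat_eq hF, hat_eq hG]
  rw [LinearMap.comp_sub, sub_conv, conv_sub]
  abel

theorem vanishesBelow_sub_convUnit {Φ : TensorAlgebra k A →ₗ[k] TensorAlgebra k B} (h : Φ 1 = 1) :
    VanishesBelow 1 (Φ - convUnit k A _) :=
  .of_map_one (by simp [h])

theorem vanishesBelow_hat_sub_hat {F G : TensorAlgebra k A →ₗ[k] B} (hF : F 1 = 0) (hG : G 1 = 0)
    {n : ℕ} (h : VanishesBelow n (F - G)) : VanishesBelow n (hat F - hat G) := by
  have key (m : ℕ) (hm : m ≤ n) : VanishesBelow m (hat F - hat G) := by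
    induction m with
    | zero => exact .zero _
    | succ m ih =>
      rw [hat_sub_hat_eq hF hG]
      refine .add (((h.comp (ι k)).conv (.zero (hat F))).mono (by omega)) ?_
      rw [add_comm m]
      exact (VanishesBelow.of_map_one (f := ι k ∘ₗ G) (by simp [hG])).conv (ih (by omega))
  exact key n le_rfl

/-- On a word of length at most `n`, a proper block has fewer than `n` letters, where `F` and `G`
agree; only the term with a single block survives. -/
theorem vanishesBelow_hat_sub_hat_sub {F G : TensorAlgebra k A →ₗ[k] B} (hF : F 1 = 0)
    (hG : G 1 = 0) {n : ℕ} (h : VanishesBelow n (F - G)) :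
    VanishesBelow (n + 1) (hat F - hat G - ι k ∘ₗ (F - G)) := by
  have : hat F - hat G - ι k ∘ₗ (F - G) =
      (ι k ∘ₗ (F - G)) ⋆ (hat F - convUnit k A _) + (ι k ∘ₗ G) ⋆ (hat F - hat G) := by
    conv_lhs => rw [hat_sub_hat_eq hF hG]
    rw [conv_sub _ _ (convUnit k A _), conv_convUnit]
    abel
  rw [this]
  refine .add ((h.comp (ι k)).conv (vanishesBelow_sub_convUnit (hat_one hF))) ?_
  rw [add_comm n]
  exact (VanishesBelow.of_map_one (f := ι k ∘ₗ G) (by simp [hG])).conv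
    (vanishesBelow_hat_sub_hat hF hG h)

theorem vanishesBelow_coder_sub {Φ Ψ : TensorAlgebra k A →ₗ[k] TensorAlgebra k B} (hΦ : Φ 1 = 1)
    (hΨ : Ψ 1 = 1) {E : TensorAlgebra k A →ₗ[k] B} {n : ℕ} (h : VanishesBelow n E) :
    VanishesBelow (n + 1) (coder Φ E Ψ - ι k ∘ₗ E) := by
  have : coder Φ E Ψ - ι k ∘ₗ E = (Φ - convUnit k A _) ⋆ ((ι k ∘ₗ E) ⋆ Ψ) +
      (ι k ∘ₗ E) ⋆ (Ψ - convUnit k A _) := by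
    rw [coder, sub_conv, convUnit_conv, conv_sub, conv_convUnit]
    abel
  rw [this]
  refine .add ?_ ((h.comp (ι k)).conv (vanishesBelow_sub_convUnit hΨ))
  rw [add_comm n]
  exact (vanishesBelow_sub_convUnit hΦ).conv ((h.comp (ι k)).conv (.zero _))

/-- On words of length at most `n` the coderivation reduces to `ι ∘ E`, a single letter, which `F`
kills. This is where the defects below gain a letter. -/
theorem VanishesBelow.comp_coder {Φ Ψ : TensorAlgebra k A →ₗ[k] TensorAlgebra k B} (hΦ : Φ 1 = 1)
    (hΨ : Ψ 1 = 1) {E : TensorAlgebra k A →ₗ[k] B} {n : ℕ} (h : VanishesBelow n E)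
    {F : TensorAlgebra k B →ₗ[k] X} (hF : F ∘ₗ ι k = 0) :
    VanishesBelow (n + 1) (F ∘ₗ coder Φ E Ψ) := by
  have := (vanishesBelow_coder_sub hΦ hΨ h).comp F
  rwa [LinearMap.comp_sub, ← LinearMap.comp_assoc, hF, LinearMap.zero_comp, sub_zero] at this

/-- The counterpart of `VanishesBelow.comp_coder` for coalgebra maps: it makes `F ↦ L ∘ hat F` gain
a letter of agreement, as `exists_fixedPoint` requires. -/
theorem VanishesBelow.comp_hat_sub_hat {F G : TensorAlgebra k A →ₗ[k] B} (hF : F 1 = 0)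
    (hG : G 1 = 0) {n : ℕ} (h : VanishesBelow n (F - G))
    {L : TensorAlgebra k B →ₗ[k] X} (hL : L ∘ₗ ι k = 0) :
    VanishesBelow (n + 1) (L ∘ₗ hat F - L ∘ₗ hat G) := by
  have := (vanishesBelow_hat_sub_hat_sub hF hG h).comp L
  rwa [LinearMap.comp_sub, ← LinearMap.comp_assoc, hL, LinearMap.zero_comp, sub_zero,
    LinearMap.comp_sub] at this

/-- The span of the words of length at most `n`. -/
def lengthLE (k : Type u) [Field k] (A : Type v) [AddCommGroup A] [Module k A] (n : ℤ) :
    Submodule k (TensorAlgebra k A) :=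
  Submodule.span k {x | ∃ l : List A, (l.length : ℤ) ≤ n ∧ word k l = x}

theorem word_mem_lengthLE {l : List A} {n : ℤ} (h : (l.length : ℤ) ≤ n) :
    word k l ∈ lengthLE k A n := Submodule.subset_span ⟨l, h, rfl⟩

theorem mul_mem_lengthLE {m n : ℤ} {x y : TensorAlgebra k A} (hx : x ∈ lengthLE k A m)
    (hy : y ∈ lengthLE k A n) : x * y ∈ lengthLE k A (m + n) := by
  have := Submodule.mul_mem_mul hx hy
  rw [lengthLE, lengthLE, Submodule.span_mul_span] at this
  refine Submodule.span_mono ?_ this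
  rintro _ ⟨_, ⟨l, hl, rfl⟩, _, ⟨l', hl', rfl⟩, rfl⟩
  exact ⟨l ++ l', by push_cast [List.length_append]; omega, word_append l l'⟩

theorem VanishesBelow.apply_eq_zero {n : ℕ} {F : TensorAlgebra k A →ₗ[k] X}
    (h : VanishesBelow n F) {m : ℤ} (hm : m < n) {x : TensorAlgebra k A}
    (hx : x ∈ lengthLE k A m) : F x = 0 := by
  rw [← LinearMap.mem_ker]
  refine (Submodule.span_le.2 ?_) hx
  rintro _ ⟨l, hl, rfl⟩
  exact h l (by omega)

/-- A linear map between tensor algebras that lowers the length of words by at least `c`. -/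
def Lowers (c : ℤ) (f : TensorAlgebra k A →ₗ[k] TensorAlgebra k B) : Prop :=
  ∀ l : List A, f (word k l) ∈ lengthLE k B (l.length - c)

theorem VanishesBelow.comp_lowers {n : ℕ} {F : TensorAlgebra k B →ₗ[k] X}
    (h : VanishesBelow n F) {c : ℕ} {G : TensorAlgebra k A →ₗ[k] TensorAlgebra k B}
    (hG : Lowers c G) : VanishesBelow (n + c) (F ∘ₗ G) :=
  fun l hl => h.apply_eq_zero (by omega) (hG l)

namespace Lowers

variable {c c' : ℤ} {f g : TensorAlgebra k A →ₗ[k] TensorAlgebra k B}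

theorem conv (hf : Lowers c f) (hg : Lowers c' g) : Lowers (c + c') (f ⋆ g) := fun l => by
  rw [conv_word]
  refine Submodule.sum_mem _ fun i hi => ?_
  rw [Finset.mem_range] at hi
  have h := mul_mem_lengthLE (hf (l.take i)) (hg (l.drop i))
  have : ((l.take i).length - c + ((l.drop i).length - c') : ℤ) = l.length - (c + c') := by
    simp only [List.length_take, List.length_drop]
    omega
  rwa [this] at h

theorem ι_comp {n : ℕ} {F : TensorAlgebra k A →ₗ[k] B} (hF : VanishesBelow n F) :
    Lowers (n - 1) (ι k ∘ₗ F) := fun l => by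
  by_cases h : l.length < n
  · simp [hF l h]
  · rw [LinearMap.comp_apply, ← word_singleton]
    exact word_mem_lengthLE (by simp; omega)

theorem convUnit : Lowers 0 (convUnit k A (TensorAlgebra k B)) := fun l => by
  cases l with
  | nil => simpa using word_mem_lengthLE (k := k) (l := ([] : List B)) (n := 0) (by simp)
  | cons a l => simp

theorem of_eq_add_conv {φ K Z : TensorAlgebra k A →ₗ[k] TensorAlgebra k B} (hφ1 : φ 1 = 0)
    (hφ : Lowers 0 φ) (hK : Lowers c K) (hZ : Z = K + φ ⋆ Z) : Lowers c Z :=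
  mem_of_eq_add_conv hφ1 hZ (fun l => lengthLE k B (l.length - c)) hK fun l l' y hy => by
    have h := mul_mem_lengthLE (hφ l) hy
    have : (l.length - 0 + (l'.length - c) : ℤ) = (l ++ l').length - c := by
      push_cast [List.length_append]
      ring
    rwa [this] at h

theorem hat {F : TensorAlgebra k A →ₗ[k] B} (h : F 1 = 0) : Lowers 0 (hat F) :=
  of_eq_add_conv (φ := ι k ∘ₗ F) (by simp [h])
    (by simpa using Lowers.ι_comp (VanishesBelow.of_map_one h)) .convUnit (hat_eq h)

theorem _root_.AInfinity.IsCoalgHom.lowers (h : IsCoalgHom f) : Lowers 0 f := by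
  rw [h.eq_hat]
  exact hat h.pr_one

/-- Each term of the difference contains a block on which `F` and `G` differ; it has at least two
letters and contributes one. -/
theorem hat_sub_hat {F G : TensorAlgebra k A →ₗ[k] B} (hF : F 1 = 0) (hG : G 1 = 0)
    (h : VanishesBelow 2 (F - G)) : Lowers 1 (AInfinity.hat F - AInfinity.hat G) := by
  refine of_eq_add_conv (φ := ι k ∘ₗ G) (by simp [hG])
    (by simpa using Lowers.ι_comp (VanishesBelow.of_map_one hG)) ?_ (hat_sub_hat_eq hF hG)
  simpa using (Lowers.ι_comp h).conv (hat hF)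

theorem coder {n : ℕ} {E : TensorAlgebra k A →ₗ[k] B} (hf : IsCoalgHom f) (hg : IsCoalgHom g)
    (hE : VanishesBelow n E) : Lowers (n - 1) (coder f E g) := by
  have := hf.lowers.conv ((Lowers.ι_comp hE).conv hg.lowers)
  rwa [add_zero, zero_add] at this

end Lowers

end Filtration

/-! ### The suspended grading and its sign involution. -/

section Degrees

variable {k : Type u} [Field k]
variable {A : Type v} [AddCommGroup A] [Module k A]
variable {B : Type w} [AddCommGroup B] [Module k B]
variable {C : Type*} [AddCommGroup C] [Module k C]

local notation:70 f:70 "⋆" g:71 => conv f g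

/-- The entries of `l` are homogeneous, of the degrees listed in `ds`. -/
abbrev HasDegrees (𝒜 : ℤ → Submodule k A) (l : List A) (ds : List ℤ) : Prop :=
  List.Forall₂ (fun a d => a ∈ 𝒜 d) l ds

/-- The grading of the tensor algebra on the suspension: a word `a₁ ⋯ aₙ` has degree
`∑ (|aᵢ| + 1)`. -/
def barGrading (𝒜 : ℤ → Submodule k A) (n : ℤ) : Submodule k (TensorAlgebra k A) :=
  Submodule.span k {x | ∃ l ds, HasDegrees 𝒜 l ds ∧ ds.sum + l.length = n ∧ word k l = x}

variable {𝒜 : ℤ → Submodule k A} {ℬ : ℤ → Submodule k B} {𝒞 : ℤ → Submodule k C}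

theorem word_mem_barGrading {l : List A} {ds : List ℤ} (h : HasDegrees 𝒜 l ds) :
    word k l ∈ barGrading 𝒜 (ds.sum + l.length) := Submodule.subset_span ⟨l, ds, h, rfl, rfl⟩

theorem mul_mem_barGrading {m n : ℤ} {x y : TensorAlgebra k A} (hx : x ∈ barGrading 𝒜 m)
    (hy : y ∈ barGrading 𝒜 n) : x * y ∈ barGrading 𝒜 (m + n) := by
  have := Submodule.mul_mem_mul hx hy
  rw [barGrading, barGrading, Submodule.span_mul_span] at this
  refine Submodule.span_mono ?_ this
  rintro _ ⟨_, ⟨l, ds, hl, rfl, rfl⟩, _, ⟨l', ds', hl', rfl, rfl⟩, rfl⟩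
  exact ⟨l ++ l', ds ++ ds', List.rel_append hl hl',
    by push_cast [List.length_append, List.sum_append]; ring, word_append l l'⟩

theorem ι_mem_barGrading {n : ℤ} {a : A} (h : a ∈ 𝒜 n) : ι k a ∈ barGrading 𝒜 (n + 1) := by
  have := word_mem_barGrading (k := k) (𝒜 := 𝒜) (l := [a]) (ds := [n]) (by simpa using h)
  simpa [word_singleton] using this

theorem pr_mem_of_mem_barGrading {n : ℤ} {x : TensorAlgebra k A} (h : x ∈ barGrading 𝒜 n) :
    pr k A x ∈ 𝒜 (n - 1) := by
  rw [← Submodule.mem_comap]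
  refine (Submodule.span_le.2 ?_) h
  rintro _ ⟨l, ds, hl, rfl, rfl⟩
  rw [SetLike.mem_coe, Submodule.mem_comap]
  by_cases hl1 : l.length = 1
  · obtain ⟨a, rfl⟩ := List.length_eq_one_iff.1 hl1
    obtain ⟨d, ds, hd, hds, rfl⟩ := List.forall₂_cons_left_iff.1 hl
    obtain rfl := List.forall₂_nil_left_iff.1 hds
    simpa [word_singleton] using hd
  · rw [pr_word_of_length_ne hl1]
    exact Submodule.zero_mem _

/-- A linear map between tensor algebras, homogeneous of degree `e` for the suspended grading. -/
def BarHomogeneous (𝒜 : ℤ → Submodule k A) (ℬ : ℤ → Submodule k B) (e : ℤ)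
    (F : TensorAlgebra k A →ₗ[k] TensorAlgebra k B) : Prop :=
  ∀ l ds, HasDegrees 𝒜 l ds → F (word k l) ∈ barGrading ℬ (ds.sum + l.length + e)

/-- A linear map from the tensor algebra of `A` to `B`, homogeneous of degree `e` for the suspended
gradings. -/
def BarHomogeneousTo (𝒜 : ℤ → Submodule k A) (ℬ : ℤ → Submodule k B) (e : ℤ)
    (F : TensorAlgebra k A →ₗ[k] B) : Prop :=
  ∀ l ds, HasDegrees 𝒜 l ds → F (word k l) ∈ ℬ (ds.sum + l.length + e - 1)

namespace BarHomogeneousTo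

variable {e e' : ℤ} {F G : TensorAlgebra k A →ₗ[k] B}

theorem zero : BarHomogeneousTo 𝒜 ℬ e (0 : TensorAlgebra k A →ₗ[k] B) :=
  fun _ _ _ => Submodule.zero_mem _

theorem add (hF : BarHomogeneousTo 𝒜 ℬ e F) (hG : BarHomogeneousTo 𝒜 ℬ e G) :
    BarHomogeneousTo 𝒜 ℬ e (F + G) := fun l ds h => Submodule.add_mem _ (hF l ds h) (hG l ds h)

theorem sub (hF : BarHomogeneousTo 𝒜 ℬ e F) (hG : BarHomogeneousTo 𝒜 ℬ e G) :
    BarHomogeneousTo 𝒜 ℬ e (F - G) := fun l ds h => Submodule.sub_mem _ (hF l ds h) (hG l ds h)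

theorem map_mem (hF : BarHomogeneousTo 𝒜 ℬ e F) {n : ℤ} {x : TensorAlgebra k A}
    (hx : x ∈ barGrading 𝒜 n) : F x ∈ ℬ (n + e - 1) := by
  rw [← Submodule.mem_comap]
  refine (Submodule.span_le.2 ?_) hx
  rintro _ ⟨l, ds, hl, rfl, rfl⟩
  exact hF l ds hl

theorem limit (h : ∀ n, ∃ G, BarHomogeneousTo 𝒜 ℬ e G ∧ VanishesBelow n (F - G)) :
    BarHomogeneousTo 𝒜 ℬ e F := fun l ds hl => by
  obtain ⟨G, hG, h⟩ := h (l.length + 1)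
  rw [sub_eq_zero.1 (h l (by simp))]
  exact hG l ds hl

theorem comp_left (hF : BarHomogeneousTo 𝒜 ℬ e F) {g : B →ₗ[k] C} {c : ℤ}
    (hg : ∀ n x, x ∈ ℬ n → g x ∈ 𝒞 (n + c)) (h : e' = e + c) :
    BarHomogeneousTo 𝒜 𝒞 e' (g ∘ₗ F) := fun l ds hl => by
  rw [show ds.sum + (l.length : ℤ) + e' - 1 = ds.sum + l.length + e - 1 + c by rw [h]; ring]
  exact hg _ _ (hF l ds hl)

theorem ι_comp (hF : BarHomogeneousTo 𝒜 ℬ e F) : BarHomogeneous 𝒜 ℬ e (ι k ∘ₗ F) :=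
  fun l ds hl => by
    have := ι_mem_barGrading (k := k) (hF l ds hl)
    rwa [sub_add_cancel] at this

theorem pr : BarHomogeneousTo 𝒜 𝒜 0 (pr k A) := fun l ds hl => by
  have := pr_mem_of_mem_barGrading (word_mem_barGrading (k := k) hl)
  rwa [add_zero]

end BarHomogeneousTo

namespace BarHomogeneous

variable {e e' e'' : ℤ} {F G : TensorAlgebra k A →ₗ[k] TensorAlgebra k B}

theorem sub (hF : BarHomogeneous 𝒜 ℬ e F) (hG : BarHomogeneous 𝒜 ℬ e G) :
    BarHomogeneous 𝒜 ℬ e (F - G) := fun l ds h => Submodule.sub_mem _ (hF l ds h) (hG l ds h)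

theorem compTo {L : TensorAlgebra k B →ₗ[k] C} (hL : BarHomogeneousTo ℬ 𝒞 e' L)
    (hF : BarHomogeneous 𝒜 ℬ e F) (h : e'' = e + e') :
    BarHomogeneousTo 𝒜 𝒞 e'' (L ∘ₗ F) := fun l ds hl => by
  rw [h, ← add_assoc]
  exact hL.map_mem (hF l ds hl)

theorem hasDegrees_take_drop {l : List A} {ds : List ℤ} (h : HasDegrees 𝒜 l ds) (i : ℕ) :
    HasDegrees 𝒜 (l.take i) (ds.take i) ∧ HasDegrees 𝒜 (l.drop i) (ds.drop i) :=
  ⟨List.forall₂_take i h, List.forall₂_drop i h⟩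

theorem conv (hF : BarHomogeneous 𝒜 ℬ e F) (hG : BarHomogeneous 𝒜 ℬ e' G) (h : e'' = e + e') :
    BarHomogeneous 𝒜 ℬ e'' (F ⋆ G) := fun l ds hl => by
  rw [conv_word]
  refine Submodule.sum_mem _ fun i hi => ?_
  rw [Finset.mem_range] at hi
  obtain ⟨h1, h2⟩ := hasDegrees_take_drop hl i
  have := mul_mem_barGrading (hF _ _ h1) (hG _ _ h2)
  convert this using 2
  have hs := List.sum_take_add_sum_drop ds i
  have hl : ((l.take i).length + (l.drop i).length : ℤ) = l.length := by
    simp only [List.length_take, List.length_drop]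
    omega
  rw [h, ← hs, ← hl]
  ring

theorem convUnit : BarHomogeneous 𝒜 ℬ 0 (convUnit k A (TensorAlgebra k B)) := fun l ds hl => by
  cases hl with
  | nil => simpa using word_mem_barGrading (k := k) (𝒜 := ℬ) (l := []) (ds := []) .nil
  | cons => simp

theorem of_eq_add_conv {φ K Z : TensorAlgebra k A →ₗ[k] TensorAlgebra k B} (hφ1 : φ 1 = 0)
    (hφ : BarHomogeneous 𝒜 ℬ 0 φ) (hK : BarHomogeneous 𝒜 ℬ e K) (hZ : Z = K + φ ⋆ Z) :
    BarHomogeneous 𝒜 ℬ e Z := by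
  -- A word does not determine the degrees of its letters, since `0` lies in every component; hence
  -- the intersection over all admissible lists of degrees.
  have key := mem_of_eq_add_conv hφ1 hZ (fun l => ⨅ (ds : List ℤ) (_ : HasDegrees 𝒜 l ds),
    barGrading ℬ (ds.sum + l.length + e)) (fun l => by
      simp only [Submodule.mem_iInf]
      exact hK l) (fun l l' y hy => by
      simp only [Submodule.mem_iInf] at hy ⊢
      intro ds hds
      obtain ⟨h1, h2⟩ := hasDegrees_take_drop hds l.length
      rw [List.take_left] at h1
      rw [List.drop_left] at h2
      have := mul_mem_barGrading (hφ _ _ h1) (hy _ h2)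
      convert this using 2
      rw [← List.sum_take_add_sum_drop ds l.length]
      push_cast [List.length_append]
      ring)
  intro l ds hl
  have := key l
  simp only [Submodule.mem_iInf] at this
  exact this ds hl

theorem hat {F : TensorAlgebra k A →ₗ[k] B} (h : F 1 = 0) (hF : BarHomogeneousTo 𝒜 ℬ 0 F) :
    BarHomogeneous 𝒜 ℬ 0 (hat F) :=
  of_eq_add_conv (φ := ι k ∘ₗ F) (by simp [h]) hF.ι_comp .convUnit (hat_eq h)

theorem coder (hF : BarHomogeneous 𝒜 ℬ 0 F) (hG : BarHomogeneous 𝒜 ℬ 0 G)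
    {E : TensorAlgebra k A →ₗ[k] B} (hE : BarHomogeneousTo 𝒜 ℬ e E) :
    BarHomogeneous 𝒜 ℬ e (coder F E G) :=
  hF.conv (hE.ι_comp.conv hG (add_zero e).symm) (zero_add e).symm

theorem tmap {f : A →ₗ[k] B} (hf : ∀ n x, x ∈ 𝒜 n → f x ∈ ℬ n) :
    BarHomogeneous 𝒜 ℬ 0 (tmap f) := fun l ds hl => by
  rw [tmap_word, add_zero]
  have : HasDegrees ℬ (l.map f) ds := by
    rw [HasDegrees, List.forall₂_map_left_iff]
    exact List.Forall₂.imp (fun a d h => hf d a h) hl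
  simpa using word_mem_barGrading (k := k) this

theorem id : BarHomogeneous 𝒜 𝒜 0 (LinearMap.id : TensorAlgebra k A →ₗ[k] _) := fun l ds hl => by
  simpa using word_mem_barGrading (k := k) hl

end BarHomogeneous

variable [DirectSum.Decomposition 𝒜] [DirectSum.Decomposition ℬ]

theorem ext_homogeneous_word {X : Type*} [AddCommGroup X] [Module k X]
    {f g : TensorAlgebra k A →ₗ[k] X}
    (h : ∀ l ds, HasDegrees 𝒜 l ds → f (word k l) = g (word k l)) : f = g := by
  -- The span of homogeneous words is stable under left multiplication by any letter, hence contains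
  -- every word.
  let S := Submodule.span k {x : TensorAlgebra k A | ∃ l ds, HasDegrees 𝒜 l ds ∧ word k l = x}
  have hmul (a : A) {y : TensorAlgebra k A} (hy : y ∈ S) : ι k a * y ∈ S := by
    induction hy using Submodule.span_induction with
    | zero => simp
    | add x y _ _ hx hy => rw [mul_add]; exact S.add_mem hx hy
    | smul c x _ hx => rw [mul_smul_comm]; exact S.smul_mem c hx
    | mem x hx =>
      obtain ⟨l, ds, hl, rfl⟩ := hx
      induction a using DirectSum.Decomposition.inductionOn 𝒜 with
      | zero => simp
      | @homogeneous i m =>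
        exact Submodule.subset_span ⟨(m : A) :: l, i :: ds, .cons m.2 hl, word_cons _ _⟩
      | add m m' hm hm' => rw [map_add, add_mul]; exact S.add_mem hm hm'
  have hS (l : List A) : word k l ∈ S := by
    induction l with
    | nil => exact Submodule.subset_span ⟨[], [], .nil, rfl⟩
    | cons a l ih => rw [word_cons]; exact hmul a ih
  have hker : S ≤ LinearMap.ker (f - g) := by
    refine Submodule.span_le.2 ?_
    rintro _ ⟨l, ds, hl, rfl⟩
    simp [h l ds hl]
  refine ext_word fun l => sub_eq_zero.1 ?_
  simpa using hker (hS l)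

variable (𝒜) in
/-- The sign involution of the suspension of `A`. -/
def tau : A →ₗ[k] A := -signInv 𝒜

theorem tau_of_mem {n : ℤ} {a : A} (h : a ∈ 𝒜 n) : tau 𝒜 a = ((n + 1).negOnePow : ℤ) • a := by
  rw [tau, LinearMap.neg_apply, signInv_of_mem 𝒜 h, Int.negOnePow_succ]
  simp

theorem tau_tau (a : A) : tau 𝒜 (tau 𝒜 a) = a := by
  simp [tau, signInv_signInv]

theorem tau_comp_tau : tau 𝒜 ∘ₗ tau 𝒜 = LinearMap.id := LinearMap.ext tau_tau

theorem tau_mem {n : ℤ} {a : A} (h : a ∈ 𝒜 n) : tau 𝒜 a ∈ 𝒜 n := by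
  rw [tau_of_mem h]
  exact zsmul_mem h _

theorem tmap_tau_tmap_tau : tmap (tau 𝒜) ∘ₗ tmap (tau 𝒜) = LinearMap.id := by
  rw [tmap_comp, tau_comp_tau, tmap_id]

theorem tmap_tau_of_mem {n : ℤ} {x : TensorAlgebra k A} (h : x ∈ barGrading 𝒜 n) :
    tmap (tau 𝒜) x = (n.negOnePow : ℤ) • x := by
  have hle : barGrading 𝒜 n ≤ LinearMap.ker (tmap (tau 𝒜) - (n.negOnePow : ℤ) • LinearMap.id) := by
    refine Submodule.span_le.2 ?_
    rintro _ ⟨l, ds, hl, rfl, rfl⟩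
    simp only [SetLike.mem_coe, LinearMap.mem_ker, LinearMap.sub_apply, tmap_word,
      LinearMap.smul_apply, LinearMap.id_apply, sub_eq_zero]
    clear h
    induction hl with
    | nil => simp
    | @cons a d l ds hd hl ih =>
      rw [List.map_cons, word_cons, ih, tau_of_mem hd, word_cons, map_zsmul, smul_mul_assoc,
        mul_smul_comm, smul_smul, List.sum_cons, List.length_cons]
      congr 1
      rw [← Units.val_mul, ← Int.negOnePow_add]
      congr 2
      push_cast
      ring
  have := hle h
  rwa [LinearMap.mem_ker, LinearMap.sub_apply, sub_eq_zero] at this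

/-- `tmap tau` is `(-1) ^ n` in degree `n`, so passing it through a map of degree `e` costs `(-1) ^
e`. -/
theorem BarHomogeneous.tmap_tau_comp {e : ℤ} {F : TensorAlgebra k A →ₗ[k] TensorAlgebra k B}
    (hF : BarHomogeneous 𝒜 ℬ e F) :
    AInfinity.tmap (tau ℬ) ∘ₗ F = (e.negOnePow : ℤ) • (F ∘ₗ AInfinity.tmap (tau 𝒜)) := by
  refine ext_homogeneous_word (𝒜 := 𝒜) fun l ds hl => ?_
  rw [LinearMap.comp_apply, tmap_tau_of_mem (hF l ds hl), LinearMap.smul_apply,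
    LinearMap.comp_apply, tmap_tau_of_mem (word_mem_barGrading hl), map_zsmul, smul_smul,
    Int.negOnePow_add, mul_comm, Units.val_mul]

theorem BarHomogeneous.comm_tau {F : TensorAlgebra k A →ₗ[k] TensorAlgebra k B}
    (hF : BarHomogeneous 𝒜 ℬ 0 F) :
    AInfinity.tmap (tau ℬ) ∘ₗ F = F ∘ₗ AInfinity.tmap (tau 𝒜) := by
  simpa using hF.tmap_tau_comp

theorem BarHomogeneous.anticomm_tau {e : ℤ} {F : TensorAlgebra k A →ₗ[k] TensorAlgebra k B}
    (hF : BarHomogeneous 𝒜 ℬ e F) (he : Odd e) :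
    AInfinity.tmap (tau ℬ) ∘ₗ F = -(F ∘ₗ AInfinity.tmap (tau 𝒜)) := by
  simpa [Int.negOnePow_odd e he] using hF.tmap_tau_comp

theorem BarHomogeneousTo.tau_apply {e : ℤ} {F : TensorAlgebra k A →ₗ[k] B}
    (hF : BarHomogeneousTo 𝒜 ℬ e F) (x : TensorAlgebra k A) :
    tau ℬ (F x) = (e.negOnePow : ℤ) • F (AInfinity.tmap (tau 𝒜) x) := by
  have h1 := LinearMap.congr_fun hF.ι_comp.tmap_tau_comp x
  have h2 := congrArg (AInfinity.pr k B) h1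
  rw [LinearMap.comp_apply, LinearMap.comp_apply, ← LinearMap.comp_apply (f := AInfinity.tmap _),
    tmap_comp_ι, LinearMap.smul_apply, map_zsmul, LinearMap.comp_apply, LinearMap.comp_apply,
    LinearMap.comp_apply, pr_ι, pr_ι] at h2
  exact h2

end Degrees

/-! ### The bar construction, inverses of morphisms and transfer along the inclusion. -/

section BarConstruction

variable {k : Type u} [Field k]
variable {A : Type v} [AddCommGroup A] [Module k A]
variable {B : Type w} [AddCommGroup B] [Module k B]
variable {C : Type*} [AddCommGroup C] [Module k C]
variable {𝒜 : ℤ → Submodule k A} [DirectSum.Decomposition 𝒜]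
variable {ℬ : ℤ → Submodule k B} [DirectSum.Decomposition ℬ]
variable {𝒞 : ℤ → Submodule k C}

theorem vanishesBelow_two {X : Type*} [AddCommGroup X] [Module k X]
    {F : TensorAlgebra k A →ₗ[k] X} (h1 : F 1 = 0) (hι : F ∘ₗ ι k = 0) :
    VanishesBelow 2 F := fun l hl => by
  match l, hl with
  | [], _ => exact h1
  | [a], _ => rw [word_singleton]; exact LinearMap.congr_fun hι a

theorem VanishesBelow.comp_ι {X : Type*} [AddCommGroup X] [Module k X]
    {F : TensorAlgebra k A →ₗ[k] X} (h : VanishesBelow 2 F) : F ∘ₗ ι k = 0 := by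
  ext a
  rw [LinearMap.comp_apply, ← word_singleton]
  exact h [a] (by simp)

theorem hat_ι {F : TensorAlgebra k A →ₗ[k] B} (h : F 1 = 0) (a : A) :
    hat F (ι k a) = ι k (F (ι k a)) := by
  rw [← word_singleton, hat_eq h, LinearMap.add_apply, conv_word]
  simp [Finset.sum_range_succ, hat_one h, h]

theorem hat_word_pair {F : TensorAlgebra k A →ₗ[k] B} (h : F 1 = 0) (a a' : A) :
    hat F (word k [a, a']) = word k [F (ι k a), F (ι k a')] + ι k (F (word k [a, a'])) := by
  rw [hat_eq h, LinearMap.add_apply, conv_word, convUnit_word_cons]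
  simp [Finset.sum_range_succ, hat_one h, h, hat_ι h, word_cons]

theorem tmap_eq_hat (f : A →ₗ[k] B) : tmap f = hat (f ∘ₗ pr k A) := by
  rw [← pr_comp_tmap]
  exact (isCoalgHom_tmap f).eq_hat

theorem IsCoder.zero (Φ Ψ : TensorAlgebra k A →ₗ[k] TensorAlgebra k B) : IsCoder Φ Ψ 0 where
  comul x := by simp
  counit x := by simp

theorem IsCoder.eq_zero {Φ Ψ D : TensorAlgebra k A →ₗ[k] TensorAlgebra k B}
    (hΦ : IsCoalgHom Φ) (hD : IsCoder Φ Ψ D) (h : pr k B ∘ₗ D = 0) : D = 0 :=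
  hD.ext hΦ (.zero Φ Ψ) (by rw [h, LinearMap.comp_zero])

/-- The square of a coderivation along `τ` and the identity that anticommutes with `τ`. -/
theorem IsCoder.square {τ D : TensorAlgebra k A →ₗ[k] TensorAlgebra k A}
    (hD : IsCoder τ LinearMap.id D) (hτ : τ ∘ₗ τ = LinearMap.id) (hτD : τ ∘ₗ D = -(D ∘ₗ τ)) :
    IsCoder LinearMap.id LinearMap.id (D ∘ₗ D) where
  comul x := by
    -- The cross terms `τD ⊗ D` and `Dτ ⊗ D` cancel; the remaining two carry `τ² = id` on the left.
    have h0 (y : TensorAlgebra k A ⊗[k] TensorAlgebra k A) :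
        TensorProduct.map (τ ∘ₗ D) D y + TensorProduct.map (D ∘ₗ τ) D y = 0 := by
      rw [← LinearMap.add_apply, ← TensorProduct.map_add_left, hτD, neg_add_cancel,
        TensorProduct.map_zero_left, LinearMap.zero_apply]
    have h1 := h0 (Coalgebra.comul x)
    rw [LinearMap.comp_apply, hD.comul, hD.comul]
    simp only [map_add, TensorProduct.map_map, hτ, LinearMap.id_comp, LinearMap.comp_id]
    rw [add_assoc, ← add_assoc (TensorProduct.map (τ ∘ₗ D) D _), h1, zero_add]
  counit x := hD.counit _

/-- The anticommutator of two coderivations that anticommute with `τ`. -/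
theorem IsCoder.anticommutator {τ g D H : TensorAlgebra k A →ₗ[k] TensorAlgebra k A}
    (hD : IsCoder τ LinearMap.id D) (hH : IsCoder τ g H) (hτ : τ ∘ₗ τ = LinearMap.id)
    (hτD : τ ∘ₗ D = -(D ∘ₗ τ)) (hτH : τ ∘ₗ H = -(H ∘ₗ τ)) (hgD : g ∘ₗ D = D ∘ₗ g) :
    IsCoder LinearMap.id g (D ∘ₗ H + H ∘ₗ D) where
  comul x := by
    have h0 {D H' : TensorAlgebra k A →ₗ[k] TensorAlgebra k A} (hτD : τ ∘ₗ D = -(D ∘ₗ τ))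
        (y : TensorAlgebra k A ⊗[k] TensorAlgebra k A) :
        TensorProduct.map (τ ∘ₗ D) H' y = -TensorProduct.map (D ∘ₗ τ) H' y := by
      rw [eq_neg_iff_add_eq_zero, ← LinearMap.add_apply, ← TensorProduct.map_add_left, hτD,
        neg_add_cancel, TensorProduct.map_zero_left, LinearMap.zero_apply]
    rw [LinearMap.add_apply, map_add, LinearMap.comp_apply, LinearMap.comp_apply, hD.comul,
      hH.comul, hH.comul, hD.comul]
    simp only [map_add, TensorProduct.map_map, hτ, LinearMap.id_comp, LinearMap.comp_id, h0 hτD,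
      h0 hτH, hgD, TensorProduct.map_add_left, TensorProduct.map_add_right, LinearMap.add_apply]
    abel
  counit x := by simp [hD.counit, hH.counit]

/-- From `g ⊗ g - id ⊗ id = id ⊗ (g - id) + (g - id) ⊗ g`. -/
theorem IsCoder.sub_id {g : TensorAlgebra k A →ₗ[k] TensorAlgebra k A} (hg : IsCoalgHom g) :
    IsCoder LinearMap.id g (g - LinearMap.id) where
  comul x := by
    have h1 : TensorProduct.map LinearMap.id g (Coalgebra.comul (R := k) x) =
        TensorProduct.map LinearMap.id (g - LinearMap.id) (Coalgebra.comul (R := k) x) +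
          Coalgebra.comul (R := k) x := by
      conv_lhs => rw [← sub_add_cancel g LinearMap.id, TensorProduct.map_add_right]
      simp
    have h2 : TensorProduct.map g g (Coalgebra.comul (R := k) x) =
        TensorProduct.map (g - LinearMap.id) g (Coalgebra.comul (R := k) x) +
          TensorProduct.map LinearMap.id g (Coalgebra.comul (R := k) x) := by
      rw [← LinearMap.add_apply, ← TensorProduct.map_add_left, sub_add_cancel]
    rw [LinearMap.sub_apply, map_sub, hg.comul, h2, h1, LinearMap.id_apply]
    abel
  counit x := by simp [hg.counit]

variable (𝒜) in
/-- The coderivation of the tensor coalgebra of the suspension with component `b`. -/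
def codiff (b : TensorAlgebra k A →ₗ[k] A) : TensorAlgebra k A →ₗ[k] TensorAlgebra k A :=
  coder (tmap (tau 𝒜)) b LinearMap.id

theorem isCoder_codiff (b : TensorAlgebra k A →ₗ[k] A) :
    IsCoder (tmap (tau 𝒜)) LinearMap.id (codiff 𝒜 b) :=
  isCoder_coder (isCoalgHom_tmap _) .id b

theorem pr_comp_codiff (b : TensorAlgebra k A →ₗ[k] A) : pr k A ∘ₗ codiff 𝒜 b = b :=
  pr_comp_coder (isCoalgHom_tmap _) .id b

theorem pr_codiff (b : TensorAlgebra k A →ₗ[k] A) (x) : pr k A (codiff 𝒜 b x) = b x :=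
  LinearMap.congr_fun (pr_comp_codiff b) x

theorem codiff_sub (b b' : TensorAlgebra k A →ₗ[k] A) :
    codiff 𝒜 (b - b') = codiff 𝒜 b - codiff 𝒜 b' := by
  rw [codiff, coder, LinearMap.comp_sub, sub_conv, conv_sub]
  rfl

theorem homogeneous_tmap_tau : BarHomogeneous 𝒜 𝒜 0 (tmap (tau 𝒜)) :=
  .tmap fun _ _ => tau_mem

theorem homogeneous_codiff {e : ℤ} {b : TensorAlgebra k A →ₗ[k] A}
    (hb : BarHomogeneousTo 𝒜 𝒜 e b) : BarHomogeneous 𝒜 𝒜 e (codiff 𝒜 b) :=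
  homogeneous_tmap_tau.coder .id hb

theorem codiff_ι {b : TensorAlgebra k A →ₗ[k] A} (hb : b 1 = 0) (a : A) :
    codiff 𝒜 b (ι k a) = ι k (b (ι k a)) := by
  have := vanishesBelow_coder_sub (isCoalgHom_tmap (tau 𝒜)).map_one IsCoalgHom.id.map_one
    (VanishesBelow.of_map_one hb) [a] (by simp)
  rw [word_singleton, LinearMap.sub_apply, sub_eq_zero] at this
  exact this

theorem isCoder_codiff_square {b : TensorAlgebra k A →ₗ[k] A}
    (hb : BarHomogeneousTo 𝒜 𝒜 (-1) b) :
    IsCoder LinearMap.id LinearMap.id (codiff 𝒜 b ∘ₗ codiff 𝒜 b) :=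
  (isCoder_codiff b).square tmap_tau_tmap_tau ((homogeneous_codiff hb).anticomm_tau (by decide))

theorem codiff_square_eq_coder {b : TensorAlgebra k A →ₗ[k] A}
    (hb : BarHomogeneousTo 𝒜 𝒜 (-1) b) :
    codiff 𝒜 b ∘ₗ codiff 𝒜 b = coder LinearMap.id (b ∘ₗ codiff 𝒜 b) LinearMap.id := by
  rw [(isCoder_codiff_square hb).eq_coder .id .id, ← LinearMap.comp_assoc, pr_comp_codiff]

variable (𝒜) in
/-- An `A_∞`-structure, seen as a coderivation of the tensor coalgebra of the suspension. -/
structure IsBarStructure (b : TensorAlgebra k A →ₗ[k] A) : Prop where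
  map_one : b 1 = 0
  homogeneous : BarHomogeneousTo 𝒜 𝒜 (-1) b
  comp_codiff : b ∘ₗ codiff 𝒜 b = 0

variable (𝒜 ℬ) in
/-- An `A_∞`-morphism, seen as a map of tensor coalgebras. -/
structure IsBarMorphism (b : TensorAlgebra k A →ₗ[k] A) (b' : TensorAlgebra k B →ₗ[k] B)
    (F : TensorAlgebra k A →ₗ[k] B) : Prop where
  map_one : F 1 = 0
  homogeneous : BarHomogeneousTo 𝒜 ℬ 0 F
  comm : F ∘ₗ codiff 𝒜 b = b' ∘ₗ hat F

theorem IsBarStructure.codiff_codiff {b : TensorAlgebra k A →ₗ[k] A} (hb : IsBarStructure 𝒜 b) :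
    codiff 𝒜 b ∘ₗ codiff 𝒜 b = 0 :=
  (isCoder_codiff_square hb.homogeneous).eq_zero .id
    (by rw [← LinearMap.comp_assoc, pr_comp_codiff, hb.comp_codiff])

/-- The defect of `hat F` from being a map of complexes. -/
theorem codiff_comp_hat_sub {b : TensorAlgebra k A →ₗ[k] A} {b' : TensorAlgebra k B →ₗ[k] B}
    {F : TensorAlgebra k A →ₗ[k] B} (hF1 : F 1 = 0) (hF : BarHomogeneousTo 𝒜 ℬ 0 F) :
    codiff ℬ b' ∘ₗ hat F - hat F ∘ₗ codiff 𝒜 b =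
      coder (hat F ∘ₗ tmap (tau 𝒜)) (b' ∘ₗ hat F - F ∘ₗ codiff 𝒜 b) (hat F) := by
  have hc := isCoalgHom_hat hF1
  have h1 : IsCoder (hat F ∘ₗ tmap (tau 𝒜)) (hat F) (codiff ℬ b' ∘ₗ hat F) := by
    have := (isCoder_codiff (𝒜 := ℬ) b').comp_right hc
    rwa [(BarHomogeneous.hat hF1 hF).comm_tau, LinearMap.id_comp] at this
  have h2 : IsCoder (hat F ∘ₗ tmap (tau 𝒜)) (hat F) (hat F ∘ₗ codiff 𝒜 b) :=
    (isCoder_codiff (𝒜 := 𝒜) b).comp_left hc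
  rw [(h1.sub h2).eq_coder (hc.comp (isCoalgHom_tmap _)) hc, LinearMap.comp_sub,
    ← LinearMap.comp_assoc, pr_comp_codiff, ← LinearMap.comp_assoc, pr_comp_hat hF1]

theorem coder_zero (Φ Ψ : TensorAlgebra k A →ₗ[k] TensorAlgebra k B) : coder Φ 0 Ψ = 0 := by
  refine ext_word fun l => ?_
  rw [coder, conv_word]
  refine Finset.sum_eq_zero fun i _ => ?_
  rw [conv_word]
  simp

theorem IsBarMorphism.codiff_comp_hat {b : TensorAlgebra k A →ₗ[k] A}
    {b' : TensorAlgebra k B →ₗ[k] B} {F : TensorAlgebra k A →ₗ[k] B}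
    (hF : IsBarMorphism 𝒜 ℬ b b' F) : codiff ℬ b' ∘ₗ hat F = hat F ∘ₗ codiff 𝒜 b := by
  rw [← sub_eq_zero, codiff_comp_hat_sub hF.map_one hF.homogeneous, hF.comm, sub_self, coder_zero]

theorem IsBarMorphism.comp {b : TensorAlgebra k A →ₗ[k] A} {b' : TensorAlgebra k B →ₗ[k] B}
    {b'' : TensorAlgebra k C →ₗ[k] C} {F : TensorAlgebra k A →ₗ[k] B}
    {G : TensorAlgebra k B →ₗ[k] C} (hG : IsBarMorphism ℬ 𝒞 b' b'' G)
    (hF : IsBarMorphism 𝒜 ℬ b b' F) : IsBarMorphism 𝒜 𝒞 b b'' (G ∘ₗ hat F) where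
  map_one := by rw [LinearMap.comp_apply, hat_one hF.map_one, hG.map_one]
  homogeneous := BarHomogeneous.compTo hG.homogeneous (.hat hF.map_one hF.homogeneous) rfl
  comm := by
    rw [← hat_comp_hat hG.map_one hF.map_one, LinearMap.comp_assoc, ← hF.codiff_comp_hat,
      ← LinearMap.comp_assoc, hG.comm, LinearMap.comp_assoc]

/-- A map of tensor coalgebras whose linear part is the identity has a right inverse. -/
theorem exists_right_inverse {𝒜 : ℤ → Submodule k A} {F : TensorAlgebra k A →ₗ[k] A} (h1 : F 1 = 0)
    (hF : BarHomogeneousTo 𝒜 𝒜 0 F) (hι : F ∘ₗ ι k = LinearMap.id) :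
    ∃ G : TensorAlgebra k A →ₗ[k] A, G 1 = 0 ∧ BarHomogeneousTo 𝒜 𝒜 0 G ∧
      G ∘ₗ ι k = LinearMap.id ∧ hat F ∘ₗ hat G = LinearMap.id := by
  have hL : (F - pr k A) ∘ₗ ι k = 0 := by rw [LinearMap.sub_comp, hι, pr_comp_ι, sub_self]
  -- The equation `F ∘ hat G = pr`, solved for its linear term `G`; the rest `F - pr` kills single
  -- letters.
  obtain ⟨G, ⟨hG1, hG⟩, hfix⟩ := exists_fixedPoint
    (fun G : TensorAlgebra k A →ₗ[k] A => pr k A - (F - pr k A) ∘ₗ hat G)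
    (fun G => G 1 = 0 ∧ BarHomogeneousTo 𝒜 𝒜 0 G) ⟨rfl, .zero⟩
    (fun G ⟨hG1, hG⟩ => ⟨by simp [hat_one hG1, h1],
      BarHomogeneousTo.pr.sub (BarHomogeneous.compTo (hF.sub .pr) (.hat hG1 hG) rfl)⟩)
    (fun G h => ⟨by
      obtain ⟨G', ⟨h1, -⟩, h⟩ := h 1
      simpa [h1] using h [] (by simp), .limit fun n => by
        obtain ⟨G', ⟨-, h2⟩, h⟩ := h n
        exact ⟨G', h2, h⟩⟩)
    (fun n G G' ⟨hG, _⟩ ⟨hG', _⟩ h => by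
      rw [sub_sub_sub_cancel_left, ← neg_sub]
      exact (VanishesBelow.comp_hat_sub_hat hG hG' h hL).neg)
  have hGι (a : A) : G (ι k a) = a := by
    rw [← hfix, LinearMap.sub_apply, LinearMap.comp_apply, hat_ι hG1, pr_ι,
      ← LinearMap.comp_apply (f := F - pr k A), hL]
    simp
  refine ⟨G, hG1, hG, LinearMap.ext hGι, ?_⟩
  rw [hat_comp_hat h1 hG1, ← hat_pr]
  congr 1
  have h2 : pr k A ∘ₗ hat G = G := pr_comp_hat hG1
  rw [LinearMap.sub_comp, h2] at hfix
  calc F ∘ₗ hat G = pr k A - (pr k A - (F ∘ₗ hat G - G)) + G := by abel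
    _ = pr k A := by rw [hfix]; abel

/-- An `A_∞`-morphism whose linear part is the identity is an isomorphism. -/
theorem IsBarMorphism.exists_inverse {b b' : TensorAlgebra k A →ₗ[k] A}
    {F : TensorAlgebra k A →ₗ[k] A} (hF : IsBarMorphism 𝒜 𝒜 b b' F)
    (hι : F ∘ₗ ι k = LinearMap.id) :
    ∃ G : TensorAlgebra k A →ₗ[k] A, IsBarMorphism 𝒜 𝒜 b' b G ∧
      hat F ∘ₗ hat G = LinearMap.id ∧ hat G ∘ₗ hat F = LinearMap.id := by
  obtain ⟨G, hG1, hG, hGι, hFG⟩ := exists_right_inverse hF.map_one hF.homogeneous hι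
  obtain ⟨G', hG'1, -, -, hGG'⟩ := exists_right_inverse hG1 hG hGι
  have hGF : hat G ∘ₗ hat F = LinearMap.id := by
    rw [← hGG']
    -- The right inverse `G` has itself a right inverse `G'`, and then `hat F = hat G'`.
    congr 1
    calc hat F = hat F ∘ₗ (hat G ∘ₗ hat G') := by rw [hGG', LinearMap.comp_id]
      _ = hat G' := by rw [← LinearMap.comp_assoc, hFG, LinearMap.id_comp]
  refine ⟨G, ⟨hG1, hG, ?_⟩, hFG, hGF⟩
  have h : hat G ∘ₗ codiff 𝒜 b' = codiff 𝒜 b ∘ₗ hat G := by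
    calc hat G ∘ₗ codiff 𝒜 b' = hat G ∘ₗ codiff 𝒜 b' ∘ₗ (hat F ∘ₗ hat G) := by
          rw [hFG, LinearMap.comp_id]
      _ = hat G ∘ₗ (codiff 𝒜 b' ∘ₗ hat F) ∘ₗ hat G := rfl
      _ = (hat G ∘ₗ hat F) ∘ₗ codiff 𝒜 b ∘ₗ hat G := by rw [hF.codiff_comp_hat]; rfl
      _ = codiff 𝒜 b ∘ₗ hat G := by rw [hGF, LinearMap.id_comp]
  have := congrArg (fun L => pr k A ∘ₗ L) h
  simpa only [← LinearMap.comp_assoc, pr_comp_hat hG1, pr_comp_codiff] using this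

variable (𝒜 ℬ) in
/-- A homotopy retraction of the complex `(A, d)` onto the graded space `B` with zero differential. -/
structure Contraction (d : A →ₗ[k] A) where
  i : B →ₗ[k] A
  p : A →ₗ[k] B
  h : A →ₗ[k] A
  i_mem : ∀ n x, x ∈ ℬ n → i x ∈ 𝒜 n
  p_mem : ∀ n x, x ∈ 𝒜 n → p x ∈ ℬ n
  h_mem : ∀ n x, x ∈ 𝒜 n → h x ∈ 𝒜 (n + 1)
  p_i : ∀ x, p (i x) = x
  d_i : ∀ x, d (i x) = 0
  p_d : ∀ x, p (d x) = 0
  homotopy : ∀ x, d (h x) + h (d x) = i (p x) - x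

/-- The part of `b` of arity at least two. -/
def higherPart (b : TensorAlgebra k A →ₗ[k] A) : TensorAlgebra k A →ₗ[k] A :=
  b - (b ∘ₗ ι k) ∘ₗ pr k A

theorem higherPart_comp_ι (b : TensorAlgebra k A →ₗ[k] A) : higherPart b ∘ₗ ι k = 0 := by
  rw [higherPart, LinearMap.sub_comp, LinearMap.comp_assoc, pr_comp_ι, LinearMap.comp_id, sub_self]

theorem apply_eq_add_higherPart (b : TensorAlgebra k A →ₗ[k] A) (x : TensorAlgebra k A) :
    b x = b (ι k (pr k A x)) + higherPart b x := by
  simp [higherPart]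

theorem IsBarStructure.higherPart_one {b : TensorAlgebra k A →ₗ[k] A} (hb : IsBarStructure 𝒜 b) :
    higherPart b 1 = 0 := by simp [higherPart, hb.map_one]

theorem IsBarStructure.linear_mem {b : TensorAlgebra k A →ₗ[k] A} (hb : IsBarStructure 𝒜 b)
    {n : ℤ} {a : A} (ha : a ∈ 𝒜 n) : b (ι k a) ∈ 𝒜 (n + -1) := by
  have := hb.homogeneous.map_mem (ι_mem_barGrading (k := k) ha)
  convert this using 2
  ring

theorem IsBarStructure.homogeneous_linear {b : TensorAlgebra k A →ₗ[k] A}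
    (hb : IsBarStructure 𝒜 b) : BarHomogeneousTo 𝒜 𝒜 (-1) ((b ∘ₗ ι k) ∘ₗ pr k A) :=
  BarHomogeneousTo.pr.comp_left (fun _ _ h => hb.linear_mem h) (zero_add _).symm

theorem IsBarStructure.homogeneous_higherPart {b : TensorAlgebra k A →ₗ[k] A}
    (hb : IsBarStructure 𝒜 b) : BarHomogeneousTo 𝒜 𝒜 (-1) (higherPart b) :=
  hb.homogeneous.sub hb.homogeneous_linear

theorem IsBarStructure.linear_linear {b : TensorAlgebra k A →ₗ[k] A} (hb : IsBarStructure 𝒜 b)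
    (a : A) : b (ι k (b (ι k a))) = 0 := by
  rw [← codiff_ι (𝒜 := 𝒜) hb.map_one]
  exact LinearMap.congr_fun hb.comp_codiff _

/-- What remains of `b ∘ codiff b = 0` after removing `d d = 0`: with `L` the higher part, `d L = -L
∘ codiff b`. -/
theorem IsBarStructure.linear_higherPart {b : TensorAlgebra k A →ₗ[k] A}
    (hb : IsBarStructure 𝒜 b) (x : TensorAlgebra k A) :
    b (ι k (higherPart b x)) = -higherPart b (codiff 𝒜 b x) := by
  have h1 : b (codiff 𝒜 b x) = 0 := LinearMap.congr_fun hb.comp_codiff x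
  rw [apply_eq_add_higherPart, pr_codiff, apply_eq_add_higherPart b x, map_add, map_add,
    hb.linear_linear, zero_add] at h1
  exact eq_neg_of_add_eq_zero_left h1

/-- A contraction transfers an `A_∞`-structure, with an `A_∞`-morphism that extends `i`. -/
theorem Contraction.exists_transfer {b : TensorAlgebra k A →ₗ[k] A} (hb : IsBarStructure 𝒜 b)
    (c : Contraction 𝒜 ℬ (b ∘ₗ ι k)) :
    ∃ (b' : TensorAlgebra k B →ₗ[k] B) (I : TensorAlgebra k B →ₗ[k] A),
      IsBarStructure ℬ b' ∧ IsBarMorphism ℬ 𝒜 b' b I ∧ I ∘ₗ ι k = c.i ∧ b' ∘ₗ ι k = 0 ∧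
        ∀ x y, b' (word k [x, y]) = c.p (b (word k [c.i x, c.i y])) := by
  have hL := higherPart_comp_ι b
  have hL1 := hb.higherPart_one
  -- The right-hand side gains a letter because `higherPart b` kills single letters.
  obtain ⟨I, ⟨hI1, hI⟩, hfix⟩ := exists_fixedPoint
    (fun I : TensorAlgebra k B →ₗ[k] A => c.i ∘ₗ pr k B + c.h ∘ₗ higherPart b ∘ₗ hat I)
    (fun I => I 1 = 0 ∧ BarHomogeneousTo ℬ 𝒜 0 I) ⟨rfl, .zero⟩
    (fun I ⟨hI1, hI⟩ => ⟨by simp [hat_one hI1, hL1],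
      (BarHomogeneousTo.pr.comp_left (c := 0) (by simpa using c.i_mem) rfl).add
        ((BarHomogeneous.compTo hb.homogeneous_higherPart (.hat hI1 hI) rfl).comp_left c.h_mem
          (by norm_num))⟩)
    (fun I h => ⟨by
      obtain ⟨I', ⟨h1, -⟩, h⟩ := h 1
      simpa [h1] using h [] (by simp), .limit fun n => by
        obtain ⟨I', ⟨-, h2⟩, h⟩ := h n
        exact ⟨I', h2, h⟩⟩)
    (fun n I I' ⟨hI, _⟩ ⟨hI', _⟩ h => by
      rw [add_sub_add_left_eq_sub, ← LinearMap.comp_sub]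
      exact (VanishesBelow.comp_hat_sub_hat hI hI' h hL).comp c.h)
  have hIapp (x : TensorAlgebra k B) : I x = c.i (pr k B x) + c.h (higherPart b (hat I x)) := by
    conv_lhs => rw [← hfix]
    rfl
  have hLι (a : A) : higherPart b (ι k a) = 0 := LinearMap.congr_fun hL a
  have hIι (x : B) : I (ι k x) = c.i x := by
    rw [hIapp, hat_ι hI1, hLι, pr_ι, map_zero, add_zero]
  let b' : TensorAlgebra k B →ₗ[k] B := c.p ∘ₗ higherPart b ∘ₗ hat I
  have hb'app (x : TensorAlgebra k B) : b' x = c.p (higherPart b (hat I x)) := rfl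
  have hb'1 : b' 1 = 0 := by rw [hb'app, hat_one hI1, hL1, map_zero]
  have hb'h : BarHomogeneousTo ℬ ℬ (-1) b' :=
    (BarHomogeneous.compTo hb.homogeneous_higherPart (.hat hI1 hI) (e'' := -1)
      (by norm_num)).comp_left (c := 0) (by simpa using c.p_mem) (add_zero _).symm
  have hdefect := codiff_comp_hat_sub (b := b') (b' := b) hI1 hI
  -- The homotopy identity is applied to `L (hat I x)`, and `d L` is rewritten by
  -- `linear_higherPart`. Since `d i = 0`, what remains is the defect of `hat I` under `h L`.
  have hE : b ∘ₗ hat I - I ∘ₗ codiff ℬ b' =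
      c.h ∘ₗ higherPart b ∘ₗ (codiff 𝒜 b ∘ₗ hat I - hat I ∘ₗ codiff ℬ b') := by
    ext x
    have h1 := c.homotopy (higherPart b (hat I x))
    rw [LinearMap.comp_apply, LinearMap.comp_apply, hb.linear_higherPart, map_neg,
      ← sub_eq_add_neg, sub_eq_iff_eq_add] at h1
    simp only [LinearMap.sub_apply, LinearMap.comp_apply, map_sub]
    rw [hIapp (codiff ℬ b' x), pr_codiff, hb'app, apply_eq_add_higherPart, pr_hat hI1,
      hIapp x, map_add, map_add, h1, show b (ι k (c.i (pr k B x))) = 0 from c.d_i _]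
    abel
  have hE0 : b ∘ₗ hat I - I ∘ₗ codiff ℬ b' = 0 := by
    refine VanishesBelow.of_succ fun n hn => ?_
    rw [hE, hdefect]
    exact (VanishesBelow.comp_coder (((isCoalgHom_hat hI1).comp (isCoalgHom_tmap _)).map_one)
      (hat_one hI1) hn hL).comp c.h
  have hcomm : I ∘ₗ codiff ℬ b' = b ∘ₗ hat I := (sub_eq_zero.1 hE0).symm
  rw [hE0, coder_zero, sub_eq_zero] at hdefect
  -- Moving both coderivations across `I` turns the left-hand side into `b ∘ codiff b ∘ hat I`.
  have hsq : I ∘ₗ codiff ℬ b' ∘ₗ codiff ℬ b' = 0 := by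
    rw [← LinearMap.comp_assoc, hcomm, LinearMap.comp_assoc, ← hdefect, ← LinearMap.comp_assoc,
      hb.comp_codiff, LinearMap.zero_comp]
  have hQ : b' ∘ₗ codiff ℬ b' = 0 := by
    refine VanishesBelow.of_succ fun n hn => ?_
    -- Up to terms that gain a letter, `I` acts on the square of `codiff b'` as `i` on its
    -- component; applying `p` recovers that component.
    have h1 : (I - c.i ∘ₗ pr k B) ∘ₗ ι k = 0 := by
      ext x
      simp [hIι]
    have h2 := (VanishesBelow.comp_coder IsCoalgHom.id.map_one IsCoalgHom.id.map_one hn h1).comp c.p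
    rw [← codiff_square_eq_coder hb'h, LinearMap.sub_comp, hsq, zero_sub, LinearMap.comp_assoc,
      ← LinearMap.comp_assoc _ _ (pr k B), pr_comp_codiff] at h2
    have h3 := h2.neg
    have h4 : c.p ∘ₗ c.i = LinearMap.id := LinearMap.ext c.p_i
    rwa [LinearMap.comp_neg, neg_neg, ← LinearMap.comp_assoc, h4, LinearMap.id_comp] at h3
  refine ⟨b', I, ⟨hb'1, hb'h, hQ⟩, ⟨hI1, hI, hcomm⟩, LinearMap.ext hIι, ?_, fun x y => ?_⟩
  · ext x
    rw [LinearMap.comp_apply, hb'app, hat_ι hI1, hLι, map_zero, LinearMap.zero_apply]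
  · rw [hb'app, hat_word_pair hI1, map_add, hLι, add_zero, hIι, hIι,
      apply_eq_add_higherPart b, pr_word_of_length_ne (by simp)]
    simp

end BarConstruction

/-! ### Transfer along the projection. -/

section Projection

variable {k : Type u} [Field k]
variable {A : Type v} [AddCommGroup A] [Module k A]
variable {B : Type w} [AddCommGroup B] [Module k B]
variable {𝒜 : ℤ → Submodule k A} [DirectSum.Decomposition 𝒜]
variable {ℬ : ℤ → Submodule k B}

namespace Contraction

variable {b : TensorAlgebra k A →ₗ[k] A}

/-- The homotopy on the tensor algebra induced by a contraction. -/
def hatHomotopy {d : A →ₗ[k] A} (c : Contraction 𝒜 ℬ d) :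
    TensorAlgebra k A →ₗ[k] TensorAlgebra k A :=
  coder (tmap (tau 𝒜)) (c.h ∘ₗ pr k A) (tmap (c.i ∘ₗ c.p))

theorem homogeneous_hatHomotopy {d : A →ₗ[k] A} (c : Contraction 𝒜 ℬ d) :
    BarHomogeneous 𝒜 𝒜 1 c.hatHomotopy :=
  homogeneous_tmap_tau.coder (.tmap fun n x hx => c.i_mem n _ (c.p_mem n x hx))
    (BarHomogeneousTo.pr.comp_left c.h_mem (zero_add 1).symm)

theorem lowers_hatHomotopy {d : A →ₗ[k] A} (c : Contraction 𝒜 ℬ d) :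
    Lowers 0 c.hatHomotopy := by
  have := Lowers.coder (n := 1) (isCoalgHom_tmap (tau 𝒜)) (isCoalgHom_tmap (c.i ∘ₗ c.p))
    (E := c.h ∘ₗ pr k A) (.of_map_one (by simp))
  rwa [Nat.cast_one, sub_self] at this

/-- A coderivation whose component is `d i pr = 0`. -/
theorem codiff_linear_comp_tmap (c : Contraction 𝒜 ℬ (b ∘ₗ ι k)) :
    codiff 𝒜 ((b ∘ₗ ι k) ∘ₗ pr k A) ∘ₗ tmap c.i = 0 := by
  refine ((isCoder_codiff _).comp_right (isCoalgHom_tmap c.i)).eq_zero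
    ((isCoalgHom_tmap _).comp (isCoalgHom_tmap _)) ?_
  rw [← LinearMap.comp_assoc, pr_comp_codiff, LinearMap.comp_assoc, pr_comp_tmap,
    ← LinearMap.comp_assoc, show (b ∘ₗ ι k) ∘ₗ c.i = 0 from LinearMap.ext c.d_i,
    LinearMap.zero_comp]

theorem tmap_comp_codiff_linear (c : Contraction 𝒜 ℬ (b ∘ₗ ι k)) :
    tmap c.p ∘ₗ codiff 𝒜 ((b ∘ₗ ι k) ∘ₗ pr k A) = 0 := by
  refine ((isCoder_codiff _).comp_left (isCoalgHom_tmap c.p)).eq_zero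
    ((isCoalgHom_tmap _).comp (isCoalgHom_tmap _)) ?_
  rw [← LinearMap.comp_assoc, pr_comp_tmap, LinearMap.comp_assoc, pr_comp_codiff,
    ← LinearMap.comp_assoc, show c.p ∘ₗ (b ∘ₗ ι k) = 0 from LinearMap.ext c.p_d,
    LinearMap.zero_comp]

/-- Both sides are coderivations along `id` and `tmap (i p)`, so it suffices to compare components,
where the identity is the homotopy on `A`. -/
theorem hatHomotopy_homotopy (hb : IsBarStructure 𝒜 b) (c : Contraction 𝒜 ℬ (b ∘ₗ ι k)) :
    codiff 𝒜 ((b ∘ₗ ι k) ∘ₗ pr k A) ∘ₗ c.hatHomotopy +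
      c.hatHomotopy ∘ₗ codiff 𝒜 ((b ∘ₗ ι k) ∘ₗ pr k A) =
        tmap (c.i ∘ₗ c.p) - LinearMap.id := by
  have hh : IsCoder (tmap (tau 𝒜)) (tmap (c.i ∘ₗ c.p)) c.hatHomotopy :=
    isCoder_coder (isCoalgHom_tmap _) (isCoalgHom_tmap _) _
  have hprh : pr k A ∘ₗ c.hatHomotopy = c.h ∘ₗ pr k A :=
    pr_comp_coder (isCoalgHom_tmap _) (isCoalgHom_tmap _) _
  refine IsCoder.ext .id (IsCoder.anticommutator (isCoder_codiff _) hh tmap_tau_tmap_tau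
    ((homogeneous_codiff hb.homogeneous_linear).anticomm_tau (by decide))
    (c.homogeneous_hatHomotopy.anticomm_tau (by decide)) ?_)
    (.sub_id (isCoalgHom_tmap _)) ?_
  · rw [← tmap_comp, LinearMap.comp_assoc, c.tmap_comp_codiff_linear, LinearMap.comp_zero,
      ← LinearMap.comp_assoc, c.codiff_linear_comp_tmap, LinearMap.zero_comp]
  · rw [LinearMap.comp_add, LinearMap.comp_sub, ← LinearMap.comp_assoc, ← LinearMap.comp_assoc,
      pr_comp_codiff, hprh, LinearMap.comp_assoc, hprh, LinearMap.comp_assoc _ _ c.h,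
      pr_comp_codiff, pr_comp_tmap]
    ext x
    exact c.homotopy (pr k A x)

theorem codiff_linear_square (hb : IsBarStructure 𝒜 b) :
    codiff 𝒜 ((b ∘ₗ ι k) ∘ₗ pr k A) ∘ₗ codiff 𝒜 ((b ∘ₗ ι k) ∘ₗ pr k A) = 0 := by
  refine (isCoder_codiff_square hb.homogeneous_linear).eq_zero .id ?_
  rw [← LinearMap.comp_assoc, pr_comp_codiff, LinearMap.comp_assoc, pr_comp_codiff]
  ext x
  exact hb.linear_linear _

/-- A contraction transfers an `A_∞`-structure, with an `A_∞`-morphism that extends `p`. -/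
theorem exists_cotransfer [DirectSum.Decomposition ℬ] (hb : IsBarStructure 𝒜 b) (c : Contraction 𝒜 ℬ (b ∘ₗ ι k)) :
    ∃ (b' : TensorAlgebra k B →ₗ[k] B) (P : TensorAlgebra k A →ₗ[k] B),
      IsBarStructure ℬ b' ∧ IsBarMorphism 𝒜 ℬ b b' P ∧ P ∘ₗ ι k = c.p := by
  set d := (b ∘ₗ ι k) ∘ₗ pr k A with hd
  set H := c.hatHomotopy with hH
  have hH0 : Lowers 0 H := c.lowers_hatHomotopy
  have hH1 : BarHomogeneous 𝒜 𝒜 1 H := c.homogeneous_hatHomotopy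
  have hi0 : Lowers 0 (tmap c.i) := (isCoalgHom_tmap c.i).lowers
  have hplus : Lowers 1 (codiff 𝒜 (higherPart b)) := by
    have := Lowers.coder (n := 2) (isCoalgHom_tmap (tau 𝒜)) .id
      (vanishesBelow_two hb.higherPart_one (higherPart_comp_ι b))
    rwa [show ((2 : ℕ) : ℤ) - 1 = 1 by norm_num] at this
  have hplush := homogeneous_codiff hb.homogeneous_higherPart
  have hsum : codiff 𝒜 b = codiff 𝒜 d + codiff 𝒜 (higherPart b) := by
    rw [higherPart, codiff_sub]
    abel
  have hpr : VanishesBelow 1 (c.p ∘ₗ pr k A) := .of_map_one (by simp)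
  -- The unknown is `X`; both `P` and `b' = X ∘ tmap i` are expressed through it.
  let P (X : TensorAlgebra k A →ₗ[k] B) : TensorAlgebra k A →ₗ[k] B := c.p ∘ₗ pr k A + X ∘ₗ H
  have hXH {n : ℕ} {X : TensorAlgebra k A →ₗ[k] B} (hX : VanishesBelow n X) :
      VanishesBelow n (X ∘ₗ H) := hX.comp_lowers (c := 0) (by simpa using hH0)
  have hP1 {X : TensorAlgebra k A →ₗ[k] B} (hX : VanishesBelow 2 X) : P X 1 = 0 :=
    (hpr.add ((hXH hX).mono one_le_two)).map_one le_rfl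
  have hPp {X : TensorAlgebra k A →ₗ[k] B} : P X - c.p ∘ₗ pr k A = X ∘ₗ H := by
    simp [P]
  have hPh {X : TensorAlgebra k A →ₗ[k] B} (hX : BarHomogeneousTo 𝒜 ℬ (-1) X) :
      BarHomogeneousTo 𝒜 ℬ 0 (P X) :=
    (BarHomogeneousTo.pr.comp_left (c := 0) (by simpa using c.p_mem) rfl).add
      (BarHomogeneous.compTo hX hH1 (by norm_num))
  have hXi {n : ℕ} {X : TensorAlgebra k A →ₗ[k] B} (hX : VanishesBelow n X) :
      VanishesBelow n (X ∘ₗ tmap c.i) := hX.comp_lowers (c := 0) (by simpa using hi0)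
  have hlow {X : TensorAlgebra k A →ₗ[k] B} (hX : VanishesBelow 2 X) :
      Lowers 1 (hat (P X) - tmap c.p) := by
    rw [tmap_eq_hat]
    exact .hat_sub_hat (hP1 hX) (by simp) (by rw [hPp]; exact hXH hX)
  have hith : BarHomogeneous ℬ 𝒜 0 (tmap c.i) := .tmap c.i_mem
  -- `X` is to be the nonlinear part of the morphism equation: `P` after the higher part of the
  -- coderivation, minus `b'` on `hat P - tmap p`. Each term gains a letter: the first and the
  -- difference `hat P - tmap p` involve maps that shorten words, and `b'` kills single letters.
  obtain ⟨X, ⟨hX2, hXh⟩, hfix⟩ := exists_fixedPoint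
    (fun X : TensorAlgebra k A →ₗ[k] B => P X ∘ₗ codiff 𝒜 (higherPart b) -
      (X ∘ₗ tmap c.i) ∘ₗ (hat (P X) - tmap c.p))
    (fun X => VanishesBelow 2 X ∧ BarHomogeneousTo 𝒜 ℬ (-1) X)
    ⟨fun _ _ => rfl, .zero⟩
    (fun X ⟨hX2, hX⟩ => ⟨.sub
      ((hpr.add ((hXH hX2).mono one_le_two)).comp_lowers (c := 1) (by simpa using hplus))
      (((hXi hX2).comp_lowers (c := 1) (by simpa using hlow hX2)).mono (by norm_num)),
      .sub (BarHomogeneous.compTo (hPh hX) hplush (by norm_num))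
        (BarHomogeneous.compTo (BarHomogeneous.compTo hX hith (e'' := -1) (by norm_num))
          (.sub (.hat (hP1 hX2) (hPh hX)) (.tmap c.p_mem)) (by norm_num))⟩)
    (fun X h => ⟨by
      obtain ⟨X', ⟨h1, -⟩, h⟩ := h 2
      simpa using h.add h1, .limit fun n => by
        obtain ⟨G', ⟨-, h2⟩, h⟩ := h n
        exact ⟨G', h2, h⟩⟩)
    (fun n X X' ⟨hX, _⟩ ⟨hX', _⟩ h => by
      have e : P X ∘ₗ codiff 𝒜 (higherPart b) - (X ∘ₗ tmap c.i) ∘ₗ (hat (P X) - tmap c.p) -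
          (P X' ∘ₗ codiff 𝒜 (higherPart b) - (X' ∘ₗ tmap c.i) ∘ₗ (hat (P X') - tmap c.p)) =
          ((X - X') ∘ₗ H) ∘ₗ codiff 𝒜 (higherPart b) -
            ((X - X') ∘ₗ tmap c.i) ∘ₗ (hat (P X) - tmap c.p) -
            ((X' ∘ₗ tmap c.i) ∘ₗ hat (P X) - (X' ∘ₗ tmap c.i) ∘ₗ hat (P X')) := by
        ext x
        simp only [P, LinearMap.sub_apply, LinearMap.comp_apply, LinearMap.add_apply, map_sub]
        abel
      rw [e]
      refine .sub (.sub ?_ ?_) ?_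
      · exact (hXH h).comp_lowers (c := 1) (by simpa using hplus)
      · exact (hXi h).comp_lowers (c := 1) (by simpa using hlow hX)
      · refine VanishesBelow.comp_hat_sub_hat (hP1 hX) (hP1 hX') ?_ (hXi hX').comp_ι
        have : P X - P X' = (X - X') ∘ₗ H := by
          simp [P, LinearMap.sub_comp]
        rw [this]
        exact hXH h)
  let b' : TensorAlgebra k B →ₗ[k] B := X ∘ₗ tmap c.i
  have hb'2 : VanishesBelow 2 b' := hXi hX2
  have hb'h : BarHomogeneousTo ℬ ℬ (-1) b' := BarHomogeneous.compTo hXh hith (by norm_num)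
  have hPX1 := hP1 hX2
  have hPXh := hPh hXh
  have hhom := c.hatHomotopy_homotopy hb
  rw [← hd, ← hH] at hhom
  have hip : tmap (c.i ∘ₗ c.p) = tmap c.i ∘ₗ tmap c.p := (tmap_comp _ _).symm
  have hfix' : P X ∘ₗ codiff 𝒜 (higherPart b) = X + b' ∘ₗ hat (P X) - b' ∘ₗ tmap c.p := by
    have : X = P X ∘ₗ codiff 𝒜 (higherPart b) - b' ∘ₗ (hat (P X) - tmap c.p) := hfix.symm
    rw [LinearMap.comp_sub] at this
    conv_rhs => enter [1, 1]; rw [this]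
    abel
  have hPd : P X ∘ₗ codiff 𝒜 d = X ∘ₗ H ∘ₗ codiff 𝒜 d := by
    have : (c.p ∘ₗ pr k A) ∘ₗ codiff 𝒜 d = 0 := by
      rw [LinearMap.comp_assoc, pr_comp_codiff]
      ext x
      exact c.p_d _
    simp only [P, LinearMap.add_comp, this, zero_add, LinearMap.comp_assoc]
  set E := P X ∘ₗ codiff 𝒜 b - b' ∘ₗ hat (P X) with hE
  have hE1 : E = X ∘ₗ H ∘ₗ codiff 𝒜 d + X - b' ∘ₗ tmap c.p := by
    rw [hE, hsum, LinearMap.comp_add, hPd, hfix']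
    abel
  -- As `b' ∘ tmap p = X ∘ tmap (i p)`, the homotopy on the tensor algebra applies.
  have hb'p : b' ∘ₗ tmap c.p =
      X + X ∘ₗ codiff 𝒜 d ∘ₗ H + X ∘ₗ H ∘ₗ codiff 𝒜 d := by
    have h1 : tmap c.i ∘ₗ tmap c.p =
        LinearMap.id + (codiff 𝒜 d ∘ₗ H + H ∘ₗ codiff 𝒜 d) := by
      rw [hhom, hip]
      abel
    simp only [b', LinearMap.comp_assoc]
    rw [h1, LinearMap.comp_add, LinearMap.comp_add, LinearMap.comp_id]
    abel
  have hXd : X ∘ₗ codiff 𝒜 d = E ∘ₗ codiff 𝒜 d := by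
    rw [hE1, LinearMap.sub_comp, LinearMap.add_comp, LinearMap.comp_assoc _ _ b',
      c.tmap_comp_codiff_linear, LinearMap.comp_assoc _ _ X, LinearMap.comp_assoc _ _ H,
      codiff_linear_square hb]
    simp
  -- The defect `E` is thus recovered from `E ∘ codiff d`, and only the latter needs to be
  -- controlled.
  have hE2 : E = -((E ∘ₗ codiff 𝒜 d) ∘ₗ H) := by
    rw [← hXd]
    conv_lhs => rw [hE1, hb'p]
    rw [LinearMap.comp_assoc]
    abel
  have hdefect := codiff_comp_hat_sub (b := b) (b' := b') hPX1 hPXh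
  -- Compose the definition of `E` with `codiff b`, whose square is zero, and move `codiff b` across
  -- `hat P` at the cost of the defect.
  have hEb : E ∘ₗ codiff 𝒜 b + (b' ∘ₗ codiff ℬ b') ∘ₗ hat (P X) =
      b' ∘ₗ coder (hat (P X) ∘ₗ tmap (tau 𝒜)) (-E) (hat (P X)) := by
    have : -E = b' ∘ₗ hat (P X) - P X ∘ₗ codiff 𝒜 b := by rw [hE]; abel
    rw [this, ← hdefect, hE, LinearMap.sub_comp, LinearMap.comp_assoc, hb.codiff_codiff,
      LinearMap.comp_sub]
    simp only [LinearMap.comp_assoc, LinearMap.comp_zero]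
    abel
  have hlowi : Lowers 1 (hat (P X) ∘ₗ tmap c.i - LinearMap.id) := by
    have e1 : P X ∘ₗ tmap c.i - pr k B = (X ∘ₗ H) ∘ₗ tmap c.i := by
      have : (c.p ∘ₗ pr k A) ∘ₗ tmap c.i = pr k B := by
        rw [LinearMap.comp_assoc, pr_comp_tmap, ← LinearMap.comp_assoc,
          show c.p ∘ₗ c.i = LinearMap.id from LinearMap.ext c.p_i, LinearMap.id_comp]
      simp only [P, LinearMap.add_comp, this]
      abel
    rw [← hat_pr (k := k) (A := B), tmap_eq_hat, hat_comp_hat hPX1 (by simp), ← tmap_eq_hat]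
    refine .hat_sub_hat (by simp [(isCoalgHom_tmap c.i).map_one, hPX1]) (by simp) ?_
    rw [e1]
    exact hXi (hXH hX2)
  -- Neither vanishing can be shown first: the morphism defect and the failure of `b'` to be a
  -- structure are coupled by `hEb`, so they are killed together.
  have key (n : ℕ) : VanishesBelow n E ∧ VanishesBelow n (b' ∘ₗ codiff ℬ b') := by
    induction n with
    | zero => exact ⟨.zero _, .zero _⟩
    | succ n ih =>
      obtain ⟨hEn, hQn⟩ := ih
      have h1 : VanishesBelow (n + 1)
          (E ∘ₗ codiff 𝒜 d + (b' ∘ₗ codiff ℬ b') ∘ₗ hat (P X)) := by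
        have e : E ∘ₗ codiff 𝒜 d + (b' ∘ₗ codiff ℬ b') ∘ₗ hat (P X) =
            b' ∘ₗ coder (hat (P X) ∘ₗ tmap (tau 𝒜)) (-E) (hat (P X)) -
              E ∘ₗ codiff 𝒜 (higherPart b) := by
          rw [← hEb, hsum, LinearMap.comp_add]
          abel
        rw [e]
        exact .sub (VanishesBelow.comp_coder
          (((isCoalgHom_hat hPX1).comp (isCoalgHom_tmap _)).map_one) (hat_one hPX1) hEn.neg
            hb'2.comp_ι) (hEn.comp_lowers (c := 1) (by simpa using hplus))
      -- Restricting along `tmap i` removes `E ∘ codiff d`, and `hat P ∘ tmap i` is the identity up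
      -- to shorter words.
      have h2 : VanishesBelow (n + 1) (b' ∘ₗ codiff ℬ b') := by
        have h3 := h1.comp_lowers (c := 0) (by simpa using hi0)
        rw [LinearMap.add_comp, LinearMap.comp_assoc _ _ E, c.codiff_linear_comp_tmap,
          LinearMap.comp_zero, zero_add] at h3
        have h4 := hQn.comp_lowers (c := 1) (by simpa using hlowi)
        rw [LinearMap.comp_sub, LinearMap.comp_id, ← LinearMap.comp_assoc] at h4
        simpa using h3.sub h4
      refine ⟨?_, h2⟩
      have h3 := h1.sub (h2.comp_lowers (c := 0) (by simpa using Lowers.hat hPX1))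
      rw [add_sub_cancel_right] at h3
      rw [hE2]
      exact (h3.comp_lowers (c := 0) (by simpa using hH0)).neg
  refine ⟨b', P X, ⟨hb'2.map_one one_le_two, hb'h, VanishesBelow.eq_zero fun n => (key n).2⟩,
    ⟨hPX1, hPXh, sub_eq_zero.1 (VanishesBelow.eq_zero fun n => (key n).1)⟩, ?_⟩
  rw [LinearMap.add_comp, (hXH hX2).comp_ι, add_zero, LinearMap.comp_assoc, pr_comp_ι,
    LinearMap.comp_id]

end Contraction

end Projection

/-! ### Contraction of a complex onto its homology. -/

section Homology

variable {k : Type u} [Field k]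
variable {A : Type v} [AddCommGroup A] [Module k A]
variable {B : Type v} [AddCommGroup B] [Module k B]
variable {𝒜 : ℤ → Submodule k A} [DirectSum.Decomposition 𝒜]
variable {ℬ : ℤ → Submodule k B} [DirectSum.Decomposition ℬ]

variable (𝒜 ℬ) in
/-- The homogeneous part of degree `e` of a linear map. -/
def homogeneousPart (e : ℤ) (f : A →ₗ[k] B) : A →ₗ[k] B :=
  DirectSum.toModule k ℤ B (fun n => Structure.proj ℬ (n + e) ∘ₗ f ∘ₗ (𝒜 n).subtype) ∘ₗ
    (DirectSum.decomposeLinearEquiv 𝒜).toLinearMap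

theorem homogeneousPart_of_mem (e : ℤ) (f : A →ₗ[k] B) {n : ℤ} {a : A} (ha : a ∈ 𝒜 n) :
    homogeneousPart 𝒜 ℬ e f a = Structure.proj ℬ (n + e) (f a) := by
  have h := DirectSum.decomposeLinearEquiv_apply_coe 𝒜 n ⟨a, ha⟩
  simp only at h
  simp [homogeneousPart, h]

theorem proj_mem (n : ℤ) (x : A) : Structure.proj 𝒜 n x ∈ 𝒜 n :=
  (DirectSum.decompose 𝒜 x n).2

theorem proj_of_mem {n : ℤ} {x : A} (hx : x ∈ 𝒜 n) : Structure.proj 𝒜 n x = x :=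
  DirectSum.decompose_of_mem_same 𝒜 hx

theorem homogeneousPart_mem (e : ℤ) (f : A →ₗ[k] B) (n : ℤ) (a : A) (ha : a ∈ 𝒜 n) :
    homogeneousPart 𝒜 ℬ e f a ∈ ℬ (n + e) := by
  rw [homogeneousPart_of_mem e f ha]
  exact proj_mem _ _

/-- Over a field the differential splits onto its image. Keeping only the degree `1` part of the
extended splitting preserves the identity because the differential is homogeneous of degree `-1`. -/
theorem Structure.exists_generalized_inverse (S : Structure 𝒜) :
    ∃ q : A →ₗ[k] A, (∀ n x, x ∈ 𝒜 n → q x ∈ 𝒜 (n + 1)) ∧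
      ∀ x, S.diff (q (S.diff x)) = S.diff x := by
  obtain ⟨g, hg⟩ := S.diff.rangeRestrict.exists_rightInverse_of_surjective
    S.diff.range_rangeRestrict
  obtain ⟨q, hq⟩ := g.exists_extend
  have hqd (x : A) : S.diff (q (S.diff x)) = S.diff x := by
    have h1 := LinearMap.congr_fun hq ⟨S.diff x, x, rfl⟩
    have h2 := congrArg Subtype.val (LinearMap.congr_fun hg ⟨S.diff x, x, rfl⟩)
    simp only [LinearMap.comp_apply, Submodule.subtype_apply] at h1
    rw [h1]
    exact h2
  refine ⟨homogeneousPart 𝒜 𝒜 1 q, homogeneousPart_mem 1 q, fun x => ?_⟩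
  refine LinearMap.congr_fun (f := S.diff ∘ₗ homogeneousPart 𝒜 𝒜 1 q ∘ₗ S.diff)
    (g := S.diff) ?_ x
  refine DirectSum.decompose_lhom_ext 𝒜 fun n => ?_
  ext ⟨y, hy⟩
  simp only [LinearMap.comp_apply, Submodule.subtype_apply]
  rw [homogeneousPart_of_mem 1 q (S.diff_mem hy), S.diff_proj, hqd, add_sub_cancel_right,
    proj_of_mem (S.diff_mem hy)]

theorem Structure.exists_homogeneous_section (S : Structure 𝒜) :
    ∃ i : S.Homology →ₗ[k] A, (∀ n x, x ∈ S.homologyGrading n → i x ∈ 𝒜 n) ∧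
      ∃ hi : ∀ x, i x ∈ S.cycles, ∀ x, S.cls ⟨i x, hi x⟩ = x := by
  obtain ⟨s, hs⟩ := S.cls.exists_rightInverse_of_surjective
    (LinearMap.range_eq_top.2 S.cls_surjective)
  let i := homogeneousPart S.homologyGrading 𝒜 0 (S.cycles.subtype ∘ₗ s)
  have hi {n : ℤ} {x : S.Homology} (hx : x ∈ S.homologyGrading n) :
      i x = Structure.proj 𝒜 n (s x) := by
    have := homogeneousPart_of_mem (ℬ := 𝒜) 0 (S.cycles.subtype ∘ₗ s) hx
    rwa [add_zero] at this
  have hcyc (x : S.Homology) : i x ∈ S.cycles := by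
    refine LinearMap.congr_fun (f := S.diff ∘ₗ i) (g := 0) ?_ x
    refine DirectSum.decompose_lhom_ext S.homologyGrading fun n => ?_
    ext ⟨y, hy⟩
    simp only [LinearMap.comp_apply, Submodule.subtype_apply, hi hy]
    exact S.proj_mem_cycles n (s y).2
  refine ⟨i, fun n x hx => ?_, hcyc, fun x => ?_⟩
  · rw [hi hx]
    exact proj_mem n _
  · refine LinearMap.congr_fun (f := S.cls ∘ₗ i.codRestrict S.cycles hcyc) (g := LinearMap.id) ?_ x
    refine DirectSum.decompose_lhom_ext S.homologyGrading fun n => LinearMap.ext fun y => ?_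
    have h1 := S.homologyProj_cls n (s y)
    rw [show S.cls (s y) = y from LinearMap.congr_fun hs y, S.homologyProj_of_mem y.2] at h1
    simp only [LinearMap.comp_apply, Submodule.subtype_apply, LinearMap.id_apply]
    exact (congrArg S.cls (Subtype.ext (hi y.2))).trans h1.symm

/-- Over a field, every complex contracts onto its homology. -/
theorem Structure.exists_contraction (S : Structure 𝒜) :
    ∃ c : Contraction 𝒜 S.homologyGrading S.diff,
      (∀ x : S.cycles, c.p x = S.cls x) ∧
        ∃ hi : ∀ x, c.i x ∈ S.cycles, ∀ x, S.cls ⟨c.i x, hi x⟩ = x := by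
  obtain ⟨q, hq, hqd⟩ := S.exists_generalized_inverse
  obtain ⟨i, hi, hcyc, hcls⟩ := S.exists_homogeneous_section
  -- `d q d = d` makes `id - q d` a projection of `A` onto the cycles.
  let r : A →ₗ[k] S.cycles := (LinearMap.id - q ∘ₗ S.diff).codRestrict S.cycles fun x => by
    rw [S.mem_cycles, LinearMap.sub_apply, map_sub, LinearMap.comp_apply, hqd,
      LinearMap.id_apply, sub_self]
  have hr (x : A) : (r x : A) = x - q (S.diff x) := rfl
  have hrc (x : S.cycles) : r x = x := Subtype.ext <| by
    rw [hr, S.mem_cycles.1 x.2, map_zero, sub_zero]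
  have hpd (x : A) : S.cls (r (S.diff x)) = 0 := by
    rw [S.cls_eq_zero]
    exact ⟨x, by rw [hr, S.diff_diff, map_zero, sub_zero]⟩
  have hq' {n : ℤ} {x : A} (hx : x ∈ 𝒜 n) : q (S.diff x) ∈ 𝒜 n := by
    have := hq _ _ (S.diff_mem hx)
    rwa [sub_add_cancel] at this
  have hrm {n : ℤ} {x : A} (hx : x ∈ 𝒜 n) : (r x : A) ∈ 𝒜 n :=
    Submodule.sub_mem _ hx (hq' hx)
  have hpm {n : ℤ} {x : A} (hx : x ∈ 𝒜 n) : S.cls (r x) ∈ S.homologyGrading n :=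
    ⟨r x, hrm hx, rfl⟩
  -- The homotopy is `q (i p - r)`. As `i p x` and `r x` are cycles of the same class, their
  -- difference is a boundary, on which `d q` is the identity; `h d` contributes `-q d`, and `r + q
  -- d = id`.
  refine ⟨⟨i, S.cls ∘ₗ r, q ∘ₗ (i ∘ₗ S.cls ∘ₗ r - S.cycles.subtype ∘ₗ r), hi,
    fun n x hx => hpm hx, fun n x hx => hq n _ (Submodule.sub_mem _ (hi n _ (hpm hx)) (hrm hx)),
    fun x => ?_, fun x => S.mem_cycles.1 (hcyc x), hpd, fun x => ?_⟩, fun x => ?_, hcyc, hcls⟩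
  · rw [LinearMap.comp_apply, show r (i x) = ⟨i x, hcyc x⟩ from hrc ⟨i x, hcyc x⟩, hcls]
  · simp only [LinearMap.comp_apply, LinearMap.sub_apply, Submodule.subtype_apply, hpd, map_zero,
      zero_sub, map_neg]
    have h1 : S.cls (⟨i (S.cls (r x)), hcyc _⟩ - r x) = 0 := by rw [map_sub, hcls, sub_self]
    obtain ⟨y, hy⟩ := S.cls_eq_zero.1 h1
    rw [AddSubgroupClass.coe_sub] at hy
    rw [← hy, hqd, hy, hr, hr, S.diff_diff, map_zero, sub_zero]
    abel
  · change S.cls (r x) = _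
    rw [hrc]

end Homology

/-! ### Families of multilinear maps versus maps on the tensor algebra; signs of composition. -/

section Desuspension

variable {k : Type u} [Field k]
variable {A : Type v} [AddCommGroup A] [Module k A]
variable {B : Type v} [AddCommGroup B] [Module k B]
variable {C : Type v} [AddCommGroup C] [Module k C]
variable {𝒜 : ℤ → Submodule k A} [DirectSum.Decomposition 𝒜]
variable {ℬ : ℤ → Submodule k B} [DirectSum.Decomposition ℬ]

theorem tau_pow_of_even {n : ℕ} (h : Even n) (a : A) : (tau 𝒜 ^ n) a = a := by
  obtain ⟨m, rfl⟩ := h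
  have : tau 𝒜 * tau 𝒜 = 1 := tau_comp_tau
  rw [← two_mul, pow_mul, pow_two, this, one_pow, Module.End.one_apply]

theorem tau_pow_tau_pow (m n : ℕ) (a : A) : (tau 𝒜 ^ m) ((tau 𝒜 ^ n) a) = (tau 𝒜 ^ (m + n)) a := by
  rw [pow_add, Module.End.mul_apply]

theorem tau_pow_congr {m n : ℕ} (h : Even (m + n)) (a : A) : (tau 𝒜 ^ m) a = (tau 𝒜 ^ n) a := by
  calc (tau 𝒜 ^ m) a = (tau 𝒜 ^ (n + n)) ((tau 𝒜 ^ m) a) := (tau_pow_of_even ⟨n, rfl⟩ _).symm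
    _ = (tau 𝒜 ^ n) ((tau 𝒜 ^ (m + n)) a) := by
      rw [tau_pow_tau_pow, tau_pow_tau_pow, add_assoc, add_comm n m]
    _ = (tau 𝒜 ^ n) a := by rw [tau_pow_of_even h]

theorem tau_pow_eq (n : ℕ) (a : A) : (tau 𝒜 ^ n) a = (-1 : k) ^ n • (signInv 𝒜 ^ n) a := by
  induction n with
  | zero => simp
  | succ n ih =>
    rw [pow_succ', Module.End.mul_apply, ih, pow_succ' (signInv 𝒜), Module.End.mul_apply, tau]
    simp [pow_succ']

theorem tau_pow_mem {n : ℕ} {d : ℤ} {a : A} (h : a ∈ 𝒜 d) : (tau 𝒜 ^ n) a ∈ 𝒜 d := by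
  induction n with
  | zero => simpa using h
  | succ n ih =>
    rw [pow_succ', Module.End.mul_apply]
    exact tau_mem ih

theorem neg_one_pow_zsmul (n : ℕ) (a : A) : (-1 : ℤ) ^ n • a = (-1 : k) ^ n • a := by
  rw [← Int.cast_smul_eq_zsmul k]
  simp

variable (𝒜) in
/-- The sign twist that relates `A^{⊗ n}` to the tensor powers of the suspension. -/
def twist {n : ℕ} (a : Fin n → A) : Fin n → A := fun j => (tau 𝒜 ^ (n - 1 - j)) (a j)

theorem twist_twist {n : ℕ} (a : Fin n → A) : twist 𝒜 (twist 𝒜 a) = a := by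
  funext j
  rw [twist, twist, tau_pow_tau_pow, tau_pow_of_even ⟨_, rfl⟩]

variable (𝒜) in
/-- The linear map on the tensor algebra that corresponds to a family of multilinear maps. -/
def toBar (f : Family k A B) : TensorAlgebra k A →ₗ[k] B :=
  glue fun n => if n = 0 then 0 else (f n).compLinearMap fun j => tau 𝒜 ^ (n - 1 - j)

variable (𝒜) in
/-- The family of multilinear maps that corresponds to a linear map on the tensor algebra. -/
def ofBar (F : TensorAlgebra k A →ₗ[k] B) : Family k A B := fun n =>
  (F.compMultilinearMap (TensorAlgebra.tprod k A n)).compLinearMap fun j => tau 𝒜 ^ (n - 1 - j)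

theorem ofBar_apply (F : TensorAlgebra k A →ₗ[k] B) {n : ℕ} (a : Fin n → A) :
    ofBar 𝒜 F n a = F (word k (List.ofFn (twist 𝒜 a))) := by
  rw [← tprod_eq_word]
  rfl

theorem toBar_ofFn (f : Family k A B) {n : ℕ} (hn : n ≠ 0) (a : Fin n → A) :
    toBar 𝒜 f (word k (List.ofFn a)) = f n (twist 𝒜 a) := by
  rw [toBar, glue_ofFn, if_neg hn]
  rfl

/-- The member of arity zero is unconstrained and is discarded, so that `hat` applies. -/
theorem toBar_one (f : Family k A B) : toBar 𝒜 f 1 = 0 := by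
  rw [← word_nil, toBar, glue_word]
  rfl

theorem toBar_ι (f : Family k A B) (a : A) : toBar 𝒜 f (ι k a) = linPart f a := by
  have := toBar_ofFn (𝒜 := 𝒜) f one_ne_zero (fun _ : Fin 1 => a)
  rw [List.ofFn_succ, List.ofFn_zero, word_singleton] at this
  rw [this, linPart_apply]
  congr 1
  funext j
  simp [twist]

theorem toBar_ofBar {F : TensorAlgebra k A →ₗ[k] B} (h : F 1 = 0) : toBar 𝒜 (ofBar 𝒜 F) = F := by
  refine ext_word fun l => ?_
  rcases eq_or_ne l.length 0 with hl | hl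
  · obtain rfl := List.length_eq_zero_iff.1 hl
    rw [word_nil, toBar_one, h]
  · conv_lhs => rw [← List.ofFn_get l]
    rw [toBar_ofFn _ hl, ofBar_apply, twist_twist, List.ofFn_get]

theorem hasDegrees_ofFn {𝒜 : ℤ → Submodule k A} {n : ℕ} {a : Fin n → A} {d : Fin n → ℤ} :
    HasDegrees 𝒜 (List.ofFn a) (List.ofFn d) ↔ ∀ i, a i ∈ 𝒜 (d i) := by
  rw [HasDegrees, List.forall₂_iff_get]
  simp only [List.length_ofFn, List.get_eq_getElem, List.getElem_ofFn, true_and]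
  exact ⟨fun h i => h i i.2 i.2, fun h i hi _ => h ⟨i, hi⟩⟩

theorem HasDegree.toBar {ℬ : ℤ → Submodule k B} {f : Family k A B} {e e' : ℤ} (hf : HasDegree 𝒜 ℬ f e) (he : e' = e + 1) :
    BarHomogeneousTo 𝒜 ℬ e' (toBar 𝒜 f) := fun l ds hl => by
  have hlen := hl.length_eq
  rcases eq_or_ne l.length 0 with h0 | h0
  · obtain rfl := List.length_eq_zero_iff.1 h0
    rw [word_nil, toBar_one]
    exact Submodule.zero_mem _
  obtain ⟨n, a, rfl⟩ : ∃ (n : ℕ) (a : Fin n → A), List.ofFn a = l := ⟨_, _, List.ofFn_get l⟩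
  obtain ⟨m, d, rfl⟩ : ∃ (n : ℕ) (a : Fin n → ℤ), List.ofFn a = ds := ⟨_, _, List.ofFn_get ds⟩
  rw [List.length_ofFn, List.length_ofFn] at hlen
  subst hlen
  rw [List.length_ofFn] at h0
  have h := hf n (by omega) d (twist 𝒜 a) fun i => tau_pow_mem (hasDegrees_ofFn.1 hl i)
  rw [toBar_ofFn f h0, List.sum_ofFn, List.length_ofFn, he]
  convert h using 2
  ring

theorem BarHomogeneousTo.ofBar {ℬ : ℤ → Submodule k B} {F : TensorAlgebra k A →ₗ[k] B} {e e' : ℤ}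
    (hF : BarHomogeneousTo 𝒜 ℬ e' F) (he : e' = e + 1) : HasDegree 𝒜 ℬ (ofBar 𝒜 F) e := by
  intro n hn d a ha
  have h := hF (List.ofFn (twist 𝒜 a)) (List.ofFn d)
    (hasDegrees_ofFn.2 fun i => tau_pow_mem (ha i))
  rw [List.sum_ofFn, List.length_ofFn, he] at h
  rw [ofBar_apply]
  convert h using 2
  ring

theorem BarHomogeneousTo.tau_pow_apply {F : TensorAlgebra k A →ₗ[k] B} {e : ℤ}
    (hF : BarHomogeneousTo 𝒜 ℬ e F) (m : ℕ) {n : ℕ} (a : Fin n → A) :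
    (tau ℬ ^ m) (F (word k (List.ofFn a))) =
      ((-1 : k) ^ (m * e.natAbs)) • F (word k (List.ofFn fun j => (tau 𝒜 ^ m) (a j))) := by
  induction m with
  | zero => simp
  | succ m ih =>
    have hsign : ((e.negOnePow : ℤ) : k) = (-1 : k) ^ e.natAbs := by
      rcases Int.even_or_odd e with h | h
      · rw [Int.negOnePow_even e h, Even.neg_one_pow (Int.natAbs_even.2 h)]; simp
      · rw [Int.negOnePow_odd e h, Odd.neg_one_pow (Int.natAbs_odd.2 h)]; simp
    rw [pow_succ', Module.End.mul_apply, ih, map_smul, hF.tau_apply, tmap_word, List.map_ofFn,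
      ← Int.cast_smul_eq_zsmul k, hsign, smul_smul, Nat.succ_mul, pow_add, pow_succ' (tau 𝒜)]
    rfl

theorem sum_composition_succ {M : Type*} [AddCommMonoid M] (n : ℕ) (φ : List ℕ → M) :
    ∑ c : Composition (n + 1), φ c.blocks =
      ∑ i : Fin (n + 1), ∑ c : Composition (n - i), φ ((i + 1) :: c.blocks) := by
  rw [← Fintype.sum_sigma']
  symm
  refine Fintype.sum_bijective (fun x : Σ i : Fin (n + 1), Composition (n - i) =>
    (⟨(x.1 + 1) :: x.2.blocks, fun {j} hj => by
      rcases List.mem_cons.1 hj with rfl | h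
      · omega
      · exact x.2.blocks_pos h, by
      have := x.1.2
      rw [List.sum_cons, x.2.blocks_sum]
      omega⟩ : Composition (n + 1))) ⟨?_, ?_⟩ _ _ fun x => rfl
  · rintro ⟨i, c⟩ ⟨i', c'⟩ h
    have h := congrArg Composition.blocks h
    simp only [List.cons.injEq, add_left_inj] at h
    obtain ⟨h1, h2⟩ := h
    obtain rfl := Fin.ext h1
    obtain rfl := Composition.ext h2
    rfl
  · intro c
    obtain ⟨m, l, hl⟩ : ∃ m l, c.blocks = m :: l :=
      List.exists_cons_of_ne_nil fun h => by simp [Composition.blocks_eq_nil] at h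
    have hm : 0 < m := c.blocks_pos (by rw [hl]; simp)
    have hs := c.blocks_sum
    rw [hl, List.sum_cons] at hs
    refine ⟨⟨⟨m - 1, by omega⟩, ⟨l, fun {j} hj => c.blocks_pos (by rw [hl]; simp [hj]), ?_⟩⟩, ?_⟩
    · simp only
      omega
    · refine Composition.ext ?_
      simp only [hl, List.cons.injEq, and_true]
      omega

/-- Unrolls the recursion of `hat`: `sum_composition_succ` splits off the first block of a
composition just as `hat_eq` splits off the first block of a word. -/
theorem hat_word_eq_sum {F : TensorAlgebra k A →ₗ[k] B} (hF : F 1 = 0) (n : ℕ) (l : List A)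
    (hl : l.length = n) : hat F (word k l) =
      ∑ c : Composition n, word k ((l.splitWrtComposition c).map fun u => F (word k u)) := by
  simp only [List.splitWrtComposition]
  induction n using Nat.strong_induction_on generalizing l with
  | _ n ih =>
    rcases n with _ | n
    · obtain rfl := List.length_eq_zero_iff.1 hl
      rw [word_nil, hat_one hF, Fintype.sum_eq_single (Composition.ones 0)]
      · simp [List.splitWrtCompositionAux]
      · intro c hc
        refine absurd (Composition.ext ?_) hc
        rw [c.blocks_eq_nil.2 rfl, Composition.ones_blocks, List.replicate_zero]
    · have hne : l ≠ [] := by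
        rintro rfl
        simp at hl
      rw [hat_eq hF, LinearMap.add_apply, convUnit_word_of_ne hne, zero_add, conv_word, hl,
        Finset.sum_range_succ', List.take_zero, word_nil]
      simp only [LinearMap.comp_apply, hF, map_zero, zero_mul, add_zero]
      rw [sum_composition_succ n (fun bs => word k ((List.splitWrtCompositionAux l bs).map
        fun u => F (word k u))), ← Fin.sum_univ_eq_sum_range (fun i =>
          ι k (F (word k (l.take (i + 1)))) * hat F (word k (l.drop (i + 1)))) (n + 1)]
      refine Finset.sum_congr rfl fun i _ => ?_
      rw [ih (n - i) (by omega) (l.drop (i + 1)) (by simp; omega), Finset.mul_sum]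
      refine Finset.sum_congr rfl fun c _ => ?_
      rw [List.splitWrtCompositionAux_cons, List.map_cons, word_cons]

theorem splitWrtComposition_ofFn {X : Type*} {n : ℕ} (a : Fin n → X) (c : Composition n) :
    (List.ofFn a).splitWrtComposition c = List.ofFn fun j => List.ofFn (a ∘ c.embedding j) := by
  refine List.ext_getElem (by simp) fun j h1 h2 => ?_
  rw [List.getElem_splitWrtComposition, List.getElem_ofFn]
  have hj : j < c.length := by simpa using h2
  have hs := c.sizeUpTo_succ hj
  have hle := c.sizeUpTo_le (j + 1)
  refine List.ext_getElem ?_ fun p h3 h4 => ?_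
  · simp [Composition.blocksFun]
    omega
  · simp only [List.getElem_drop, List.getElem_take, List.getElem_ofFn, Function.comp_apply]
    exact congrArg a (Fin.ext (c.coe_embedding ⟨j, hj⟩ ⟨p, by simpa using h4⟩).symm)

theorem hat_ofFn {F : TensorAlgebra k A →ₗ[k] B} (hF : F 1 = 0) {n : ℕ} (a : Fin n → A) :
    hat F (word k (List.ofFn a)) = ∑ c : Composition n,
      word k (List.ofFn fun j => F (word k (List.ofFn (a ∘ c.embedding j)))) := by
  rw [hat_word_eq_sum hF n _ (by simp)]
  refine Finset.sum_congr rfl fun c _ => ?_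
  rw [splitWrtComposition_ofFn, List.map_ofFn]
  rfl

theorem signExp_eq {n : ℕ} (c : Composition n) : signExp c =
    ∑ j : Fin c.length, (∑ l ∈ Finset.Ioi j, (c.blocksFun l - 1)) * c.blocksFun j := by
  simp only [Finset.sum_mul]
  rw [signExp]
  exact Finset.sum_comm' (by simp)

/-- Each block after the `j`-th contributes its size minus one to the sum and one to `c.length - 1 -
j`. This fixes the parity of the exponents of `tau` in `compose_apply`. -/
theorem sizeUpTo_add_sum {n : ℕ} (c : Composition n) (j : Fin c.length) :
    c.sizeUpTo j + c.blocksFun j + (∑ l ∈ Finset.Ioi j, (c.blocksFun l - 1)) +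
      (c.length - 1 - j) = n := by
  have h1 : c.sizeUpTo j = ∑ l ∈ Finset.Iio j, c.blocksFun l := by
    rw [Composition.sizeUpTo, ← c.ofFn_blocksFun, List.sum_take_ofFn]
    refine Finset.sum_congr ?_ fun _ _ => rfl
    ext l
    simp only [Finset.mem_filter, Finset.mem_univ, true_and, Finset.mem_Iio, Fin.lt_def]
  have h2 : (∑ l ∈ Finset.Ioi j, (c.blocksFun l - 1)) + (c.length - 1 - j) =
      ∑ l ∈ Finset.Ioi j, c.blocksFun l := by
    rw [← Fin.card_Ioi, Finset.card_eq_sum_ones, ← Finset.sum_add_distrib]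
    exact Finset.sum_congr rfl fun l _ => Nat.sub_add_cancel (c.one_le_blocksFun l)
  rw [add_assoc, h2, h1]
  conv_rhs => rw [← c.sum_blocksFun]
  have h3 : (Finset.univ : Finset (Fin c.length)) = (Finset.Iio j ∪ {j}) ∪ Finset.Ioi j := by
    ext l
    simp only [Finset.mem_univ, Finset.mem_union, Finset.mem_Iio, Finset.mem_singleton,
      Finset.mem_Ioi, true_iff]
    rcases lt_trichotomy l j with h | h | h <;> simp [h]
  rw [h3, Finset.sum_union, Finset.sum_union, Finset.sum_singleton]
  · simp
  · rw [Finset.disjoint_left]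
    intro l hl
    simp only [Finset.mem_union, Finset.mem_Iio, Finset.mem_singleton] at hl
    rw [Finset.mem_Ioi]
    rcases hl with h | h
    · exact not_lt.2 h.le
    · simp [h]

/-- Composition of families is composition of the maps of tensor coalgebras. -/
theorem compose_apply (g : Family k B C) {f : Family k A B} (hf : HasDegree 𝒜 ℬ f (-1)) {n : ℕ}
    (hn : n ≠ 0) (a : Fin n → A) : compose 𝒜 g f n a =
      toBar ℬ g (hat (toBar 𝒜 f) (word k (List.ofFn (twist 𝒜 a)))) := by
  rw [hat_ofFn (toBar_one f), map_sum, compose, _root_.sum_apply]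
  refine Finset.sum_congr rfl fun c _ => ?_
  have hc : c.length ≠ 0 := by
    rw [← Nat.pos_iff_ne_zero, Composition.length_pos_iff]
    omega
  rw [toBar_ofFn g hc, _root_.smul_apply]
  have hbar := hf.toBar (e' := 0) (by norm_num)
  have key (j : Fin c.length) : twist ℬ (fun j => toBar 𝒜 f
      (word k (List.ofFn (twist 𝒜 a ∘ c.embedding j)))) j =
      ((-1 : k) ^ ((∑ l ∈ Finset.Ioi j, (c.blocksFun l - 1)) * c.blocksFun j)) •
        f (c.blocksFun j) (fun p => (signInv 𝒜 ^ (∑ l ∈ Finset.Ioi j, (c.blocksFun l - 1)))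
          (a (c.embedding j p))) := by
    rw [twist, hbar.tau_pow_apply, toBar_ofFn f (Nat.one_le_iff_ne_zero.1 (c.one_le_blocksFun j))]
    simp only [Int.natAbs_zero, mul_zero, pow_zero, one_smul]
    -- Three twists meet at each entry: of the outer tensor, of the block and of the whole word.
    -- Modulo two their exponents add up to `∑ (i_l - 1)` over the later blocks, the Koszul exponent
    -- of `blockTerm`. Since `tau = -signInv`, each entry also gives a scalar, and over all blocks
    -- these make up `signExp`.
    have h1 : twist 𝒜 (fun p => (tau 𝒜 ^ (c.length - 1 - j)) ((twist 𝒜 a ∘ c.embedding j) p)) =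
        fun p => (-1 : k) ^ (∑ l ∈ Finset.Ioi j, (c.blocksFun l - 1)) •
          (signInv 𝒜 ^ (∑ l ∈ Finset.Ioi j, (c.blocksFun l - 1))) (a (c.embedding j p)) := by
      funext p
      rw [← tau_pow_eq, twist, Function.comp_apply, twist, tau_pow_tau_pow, tau_pow_tau_pow]
      refine tau_pow_congr ?_ _
      have h2 := sizeUpTo_add_sum c j
      have h3 := p.2
      rw [c.coe_embedding]
      refine ⟨(c.blocksFun j - 1 - p) + (c.length - 1 - j) +
        ∑ l ∈ Finset.Ioi j, (c.blocksFun l - 1), ?_⟩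
      omega
    rw [h1, MultilinearMap.map_smul_univ]
    simp [pow_mul]
  rw [funext key, MultilinearMap.map_smul_univ, Finset.prod_pow_eq_pow_sum, ← signExp_eq,
    neg_one_pow_zsmul (k := k)]
  rfl

end Desuspension

/-! ### Signs of insertion. -/

section Insertion

variable {k : Type u} [Field k]
variable {A : Type v} [AddCommGroup A] [Module k A]
variable {B : Type v} [AddCommGroup B] [Module k B]
variable {𝒜 : ℤ → Submodule k A} [DirectSum.Decomposition 𝒜]

theorem codiff_word (M : TensorAlgebra k A →ₗ[k] A) (l : List A) :
    codiff 𝒜 M (word k l) = ∑ i ∈ Finset.range (l.length + 1),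
      ∑ j ∈ Finset.range (l.length - i + 1),
        word k ((l.take i).map (tau 𝒜) ++
          M (word k ((l.drop i).take j)) :: (l.drop i).drop j) := by
  rw [codiff, coder, conv_word]
  refine Finset.sum_congr rfl fun i _ => ?_
  rw [conv_word, Finset.mul_sum, List.length_drop]
  refine Finset.sum_congr rfl fun j _ => ?_
  rw [tmap_word, word_append, word_cons]
  rfl

/-- After twisting, each of the first `r` entries carries `tau ^ s`, which gives `signInv ^ s` and
in total `(-1) ^ (r * s)`; the inserted value carries `tau ^ t`, and pulling it through `toBar 𝒜 m`,
of degree `-1`, gives `(-1) ^ t`; the twists on the last `t` entries cancel. -/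
theorem insertAt_eq_toBar (f : Family k A B) {m : Family k A A} (hm : HasDegree 𝒜 𝒜 m (-2))
    {r s t n : ℕ} (hs : s ≠ 0) (hn : n = r + s + t) (a : ℕ → A) {l : List A}
    (hl : l = List.ofFn (twist 𝒜 fun i : Fin n => a i)) :
    (-1 : ℤ) ^ (r * s + t) • f (r + 1 + t) (insertAt 𝒜 m r s t a) =
      toBar 𝒜 f (word k ((l.take r).map (tau 𝒜) ++
        toBar 𝒜 m (word k ((l.drop r).take s)) :: (l.drop r).drop s)) := by
  have hlen : l.length = n := by rw [hl, List.length_ofFn]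
  have hget (i : ℕ) (hi : i < l.length) : l[i] = (tau 𝒜 ^ (n - 1 - i)) (a i) := by
    subst hl
    rw [List.getElem_ofFn]
    rfl
  have hmid : (l.drop r).take s =
      List.ofFn fun q : Fin s => (tau 𝒜 ^ (n - 1 - (r + q))) (a (r + q)) := by
    refine List.ext_getElem (by simp; omega) fun q h1 h2 => ?_
    rw [List.getElem_take, List.getElem_drop, hget, List.getElem_ofFn]
  have hword : (l.take r).map (tau 𝒜) ++
        toBar 𝒜 m (word k ((l.drop r).take s)) :: (l.drop r).drop s =
      List.ofFn fun j : Fin (r + 1 + t) => if (j : ℕ) < r then tau 𝒜 ((tau 𝒜 ^ (n - 1 - j)) (a j))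
        else if (j : ℕ) = r then toBar 𝒜 m (word k ((l.drop r).take s))
        else (tau 𝒜 ^ (n - 1 - (j + s - 1))) (a (j + s - 1)) := by
    refine List.ext_getElem (by simp; omega) fun j h1 h2 => ?_
    rw [List.getElem_ofFn, List.getElem_append]
    have hr : ((l.take r).map (tau 𝒜)).length = r := by simp; omega
    simp only [hr]
    split_ifs with h3 h4
    · rw [List.getElem_map, List.getElem_take, hget]
    · simp [h4]
    · obtain ⟨p, rfl⟩ : ∃ p, j = r + 1 + p := ⟨j - (r + 1), by omega⟩
      simp only [show r + 1 + p - r = p + 1 by omega, List.getElem_cons_succ]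
      rw [List.getElem_drop, List.getElem_drop, hget,
        show r + (s + p) = r + 1 + p + s - 1 by omega]
  have hbar := hm.toBar (e' := -1) (by norm_num)
  rw [hword, toBar_ofFn f (by omega)]
  have key : twist 𝒜 (fun j : Fin (r + 1 + t) =>
      if (j : ℕ) < r then tau 𝒜 ((tau 𝒜 ^ (n - 1 - j)) (a j))
        else if (j : ℕ) = r then toBar 𝒜 m (word k ((l.drop r).take s))
        else (tau 𝒜 ^ (n - 1 - (j + s - 1))) (a (j + s - 1))) =
      fun j : Fin (r + 1 + t) =>
        (if (j : ℕ) < r then (-1 : k) ^ s else if (j : ℕ) = r then (-1) ^ t else 1) •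
          insertAt 𝒜 m r s t a j := by
    funext j
    have hj := j.2
    rw [twist, insertAt]
    split_ifs with h1 h2
    · rw [← tau_pow_eq, ← Module.End.mul_apply (tau 𝒜), ← pow_succ', tau_pow_tau_pow]
      exact tau_pow_congr ⟨r + t - j + s, by omega⟩ _
    · rw [hmid, hbar.tau_pow_apply, toBar_ofFn m hs]
      simp only [Int.natAbs_neg, Int.natAbs_one, mul_one]
      rw [show r + 1 + t - 1 - (j : ℕ) = t by omega]
      congr 2
      funext q
      have := q.2
      rw [twist, tau_pow_tau_pow, tau_pow_tau_pow]
      exact tau_pow_of_even ⟨s - 1 - q + t, by omega⟩ _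
    · rw [tau_pow_tau_pow, one_smul]
      exact tau_pow_of_even ⟨r + t - j, by omega⟩ _
  rw [key, MultilinearMap.map_smul_univ, neg_one_pow_zsmul (k := k)]
  congr 1
  rw [Fin.prod_univ_add, Fin.prod_univ_castSucc]
  simp only [Fin.val_castAdd, Fin.val_castSucc, Fin.val_last, Fin.val_natAdd, Fin.is_lt, if_true,
    lt_self_iff_false, if_false, Finset.prod_const, Finset.card_univ, Fintype.card_fin]
  rw [Finset.prod_eq_one (s := (Finset.univ : Finset (Fin t))) fun x _ => by
    rw [if_neg (by omega), if_neg (by omega)], mul_one, pow_add, mul_comm r s, pow_mul]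

/-- Insertion into a family is composition with the coderivation of the tensor coalgebra. -/
theorem insertSum_eq (f : Family k A B) {m : Family k A A} (hm : HasDegree 𝒜 𝒜 m (-2)) (n : ℕ)
    (a : ℕ → A) : insertSum 𝒜 f m n a =
      toBar 𝒜 f (codiff 𝒜 (toBar 𝒜 m)
        (word k (List.ofFn (twist 𝒜 fun i : Fin n => a i)))) := by
  rw [codiff_word, map_sum, List.length_ofFn]
  simp only [map_sum]
  set l := List.ofFn (twist 𝒜 fun i : Fin n => a i) with hl
  have h0 (i : ℕ) : ∑ j ∈ Finset.range (n - i + 1), toBar 𝒜 f (word k ((l.take i).map (tau 𝒜) ++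
        toBar 𝒜 m (word k ((l.drop i).take j)) :: (l.drop i).drop j)) =
      ∑ j ∈ Finset.Icc 1 (n - i), toBar 𝒜 f (word k ((l.take i).map (tau 𝒜) ++
        toBar 𝒜 m (word k ((l.drop i).take j)) :: (l.drop i).drop j)) := by
    symm
    refine Finset.sum_subset (fun j hj => ?_) fun j hj hj' => ?_
    · simp at hj ⊢
      omega
    · obtain rfl : j = 0 := by
        simp at hj hj'
        omega
      rw [List.take_zero, word_nil, toBar_one, word_append, word_cons]
      simp
  simp only [h0]
  -- With the empty insertions removed, the sum is reordered so that the arity of the inserted map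
  -- is the outer index, as in `insertSum`.
  rw [Finset.sum_comm' (s' := fun s => Finset.range (n - s + 1)) (t' := Finset.Icc 1 n)
    (by intro x y; simp; omega), insertSum]
  refine Finset.sum_congr rfl fun s hs => ?_
  rw [Finset.Nat.sum_antidiagonal_eq_sum_range_succ_mk]
  refine Finset.sum_congr rfl fun r hr => ?_
  rw [Finset.mem_Icc] at hs
  rw [Finset.mem_range] at hr
  exact insertAt_eq_toBar f hm (by omega) (by omega) a hl

/-- As `twist` is an involution, the conditions on twisted words are conditions on all words. -/
theorem exists_twist_eq (l : List A) :
    ∃ a : ℕ → A, List.ofFn (twist 𝒜 fun i : Fin l.length => a i) = l := by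
  refine ⟨fun i => if h : i < l.length then twist 𝒜 l.get ⟨i, h⟩ else 0, ?_⟩
  have : (fun i : Fin l.length => if h : (i : ℕ) < l.length then twist 𝒜 l.get ⟨i, h⟩ else 0) =
      twist 𝒜 l.get := funext fun i => dif_pos i.2
  rw [this, twist_twist, List.ofFn_get]

end Insertion

/-! ### Dictionary between `A_∞`-objects and their bar versions. -/

section Equivalence

variable {k : Type u} [Field k]
variable {A : Type v} [AddCommGroup A] [Module k A]
variable {B : Type v} [AddCommGroup B] [Module k B]
variable {𝒜 : ℤ → Submodule k A} [DirectSum.Decomposition 𝒜]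
variable {ℬ : ℤ → Submodule k B} [DirectSum.Decomposition ℬ]

theorem codiff_one {b : TensorAlgebra k A →ₗ[k] A} (hb : b 1 = 0) : codiff 𝒜 b 1 = 0 := by
  rw [← word_nil, codiff_word]
  simp [hb, word_singleton]

theorem Structure.isBarStructure (S : Structure 𝒜) : IsBarStructure 𝒜 (toBar 𝒜 S.m) where
  map_one := toBar_one _
  homogeneous := S.degree.toBar (by norm_num)
  comp_codiff := ext_word fun l => by
    rcases eq_or_ne l.length 0 with hl | hl
    · obtain rfl := List.length_eq_zero_iff.1 hl
      rw [LinearMap.comp_apply, word_nil, codiff_one (toBar_one _), map_zero, LinearMap.zero_apply]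
    · obtain ⟨a, ha⟩ := exists_twist_eq (𝒜 := 𝒜) l
      rw [LinearMap.comp_apply, LinearMap.zero_apply, ← S.assoc l.length (by omega) a,
        insertSum_eq _ S.degree, ha]

/-- The `A_∞`-structure that corresponds to a coderivation of square zero. -/
def IsBarStructure.toStructure {b : TensorAlgebra k A →ₗ[k] A} (hb : IsBarStructure 𝒜 b) :
    Structure 𝒜 where
  m := ofBar 𝒜 b
  degree := hb.homogeneous.ofBar (by norm_num)
  assoc n hn a := by
    rw [insertSum_eq _ (hb.homogeneous.ofBar (by norm_num)), toBar_ofBar hb.map_one]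
    exact LinearMap.congr_fun hb.comp_codiff _

theorem IsBarStructure.toBar_toStructure {b : TensorAlgebra k A →ₗ[k] A}
    (hb : IsBarStructure 𝒜 b) : toBar 𝒜 hb.toStructure.m = b := toBar_ofBar hb.map_one

theorem Morphism.isBarMorphism {S : Structure 𝒜} {T : Structure ℬ} (φ : Morphism S T) :
    IsBarMorphism 𝒜 ℬ (toBar 𝒜 S.m) (toBar ℬ T.m) (toBar 𝒜 φ.f) where
  map_one := toBar_one _
  homogeneous := φ.degree.toBar (by norm_num)
  comm := ext_word fun l => by
    rcases eq_or_ne l.length 0 with hl | hl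
    · obtain rfl := List.length_eq_zero_iff.1 hl
      rw [LinearMap.comp_apply, word_nil, codiff_one (toBar_one _), map_zero, LinearMap.comp_apply,
        hat_one (toBar_one _), toBar_one]
    · obtain ⟨a, ha⟩ := exists_twist_eq (𝒜 := 𝒜) l
      have h := φ.comm l.length (by omega) a
      rw [insertSum_eq _ S.degree, compose_apply _ φ.degree hl, ha] at h
      exact h

/-- The `A_∞`-morphism that corresponds to a map of tensor coalgebras. -/
def IsBarMorphism.toMorphism {S : Structure 𝒜} {T : Structure ℬ} {F : TensorAlgebra k A →ₗ[k] B}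
    (hF : IsBarMorphism 𝒜 ℬ (toBar 𝒜 S.m) (toBar ℬ T.m) F) : Morphism S T where
  f := ofBar 𝒜 F
  degree := hF.homogeneous.ofBar (by norm_num)
  comm n hn a := by
    rw [insertSum_eq _ S.degree, compose_apply _ (hF.homogeneous.ofBar (by norm_num)) (by omega),
      toBar_ofBar hF.map_one]
    exact LinearMap.congr_fun hF.comm _

theorem linPart_ofBar {F : TensorAlgebra k A →ₗ[k] B} (h : F 1 = 0) (x : A) :
    linPart (ofBar 𝒜 F) x = F (ι k x) := by
  rw [← toBar_ι (𝒜 := 𝒜), toBar_ofBar h]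

theorem compose_ofBar_eq_idFamily {F : TensorAlgebra k A →ₗ[k] B} {G : TensorAlgebra k B →ₗ[k] A}
    (hF1 : F 1 = 0) (hF : BarHomogeneousTo 𝒜 ℬ 0 F) (hG1 : G 1 = 0)
    (h : hat G ∘ₗ hat F = LinearMap.id) {n : ℕ} (hn : 1 ≤ n) :
    compose 𝒜 (ofBar ℬ G) (ofBar 𝒜 F) n = idFamily k A n := by
  ext a
  rw [compose_apply _ (hF.ofBar (by norm_num)) (by omega), toBar_ofBar hF1, toBar_ofBar hG1,
    ← pr_hat hG1, ← LinearMap.comp_apply (f := hat G), h, LinearMap.id_apply, pr, glue_ofFn]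
  match n, hn with
  | 1, _ =>
    congr 1
    funext j
    simp [twist]
  | n + 2, _ => rfl

theorem isomorphic_of_isBarMorphism {S : Structure 𝒜} {T : Structure ℬ}
    {F : TensorAlgebra k A →ₗ[k] B} {G : TensorAlgebra k B →ₗ[k] A}
    (hF : IsBarMorphism 𝒜 ℬ (toBar 𝒜 S.m) (toBar ℬ T.m) F)
    (hG : IsBarMorphism ℬ 𝒜 (toBar ℬ T.m) (toBar 𝒜 S.m) G)
    (hGF : hat G ∘ₗ hat F = LinearMap.id) (hFG : hat F ∘ₗ hat G = LinearMap.id) :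
    Isomorphic S T :=
  ⟨hF.toMorphism, hG.toMorphism,
    fun _ hn => compose_ofBar_eq_idFamily hF.map_one hF.homogeneous hG.map_one hGF hn,
    fun _ hn => compose_ofBar_eq_idFamily hG.map_one hG.homogeneous hF.map_one hFG hn⟩

end Equivalence

/-! ### Existence and uniqueness of minimal models. -/

section MinimalModels

variable {k : Type u} [Field k]
variable {A : Type v} [AddCommGroup A] [Module k A]
variable {𝒜 : ℤ → Submodule k A} [DirectSum.Decomposition 𝒜]

theorem Structure.toBar_comp_ι (S : Structure 𝒜) : toBar 𝒜 S.m ∘ₗ ι k = S.diff :=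
  LinearMap.ext fun a => toBar_ι S.m a

theorem tau_comm {B : Type*} [AddCommGroup B] [Module k B] {ℬ : ℤ → Submodule k B}
    [DirectSum.Decomposition ℬ] {f : A →ₗ[k] B} (hf : ∀ n x, x ∈ 𝒜 n → f x ∈ ℬ n) (x : A) :
    f (tau 𝒜 x) = tau ℬ (f x) := by
  refine LinearMap.congr_fun (f := f ∘ₗ tau 𝒜) (g := tau ℬ ∘ₗ f) ?_ x
  refine DirectSum.decompose_lhom_ext 𝒜 fun n => ?_
  ext ⟨y, hy⟩
  simp only [LinearMap.comp_apply, Submodule.subtype_apply, tau_of_mem hy, tau_of_mem (hf n y hy),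
    map_zsmul]

theorem ofFn_twist_pair (x y : A) : List.ofFn (twist 𝒜 ![x, y]) = [tau 𝒜 x, y] := by
  simp [twist]

theorem Structure.exists_barContraction (S : Structure 𝒜) :
    ∃ c : Contraction 𝒜 S.homologyGrading (toBar 𝒜 S.m ∘ₗ ι k),
      (∀ x : S.cycles, c.p x = S.cls x) ∧
        ∃ hi : ∀ x, c.i x ∈ S.cycles, ∀ x, S.cls ⟨c.i x, hi x⟩ = x := by
  rw [S.toBar_comp_ι]
  exact S.exists_contraction

theorem Morphism.homologyMap_cls {B : Type v} [AddCommGroup B] [Module k B]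
    {ℬ : ℤ → Submodule k B} [DirectSum.Decomposition ℬ] {S : Structure 𝒜} {T : Structure ℬ}
    (φ : Morphism S T) (x : S.cycles) (h : linPart φ.f x ∈ T.cycles) :
    φ.homologyMap (S.cls x) = T.cls ⟨linPart φ.f x, h⟩ := rfl

theorem Structure.exists_minimalModel (S : Structure 𝒜) : Nonempty (MinimalModel S) := by
  obtain ⟨c, hp, hcyc, hcls⟩ := S.exists_barContraction
  obtain ⟨b', I, hb', hI, hIι, hb'ι, hb'₂⟩ := c.exists_transfer S.isBarStructure
  have hI' : IsBarMorphism S.homologyGrading 𝒜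
      (toBar S.homologyGrading hb'.toStructure.m) (toBar 𝒜 S.m) I := by
    rwa [hb'.toBar_toStructure]
  have hlin (x : S.Homology) : linPart hI'.toMorphism.f x = c.i x := by
    rw [← hIι]
    exact linPart_ofBar hI.map_one x
  have hdiff : hb'.toStructure.diff = 0 := by
    rw [← Structure.toBar_comp_ι, hb'.toBar_toStructure, hb'ι]
  have hid (x : hb'.toStructure.cycles) :
      hI'.toMorphism.homologyMap (hb'.toStructure.cls x) = (x : S.Homology) := by
    rw [Morphism.homologyMap_cls _ _ (by rw [hlin]; exact hcyc _)]
    simp only [hlin, hcls]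
  refine ⟨⟨hb'.toStructure, ?_, fun x y => ?_, hI'.toMorphism, ⟨?_, fun x => ?_⟩, hid⟩⟩
  · ext a
    have h : a = fun _ => a 0 := funext fun i => congrArg a (Subsingleton.elim _ _)
    rw [h]
    exact LinearMap.congr_fun hdiff (a 0)
  -- The twist on the pair puts `tau` on the first entry; `i` preserves degrees, so it commutes with
  -- `tau`, and the twist that relates `b` to `S.m` cancels it.
  · have h : hb'.toStructure.m 2 ![x, y] = c.p (S.m 2 ![c.i x, c.i y]) := by
      rw [show hb'.toStructure.m 2 = ofBar S.homologyGrading b' 2 from rfl, ofBar_apply,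
        ofFn_twist_pair, hb'₂, tau_comm c.i_mem, ← ofFn_twist_pair, toBar_ofFn _ two_ne_zero, twist_twist]
    calc hb'.toStructure.m 2 ![x, y] = c.p (S.cycleMul ⟨c.i x, hcyc x⟩ ⟨c.i y, hcyc y⟩) := h
      _ = S.inducedProduct x y := by rw [hp, ← S.inducedProduct_cls, hcls, hcls]
  · rw [injective_iff_map_eq_zero]
    intro x hx
    obtain ⟨x, rfl⟩ := hb'.toStructure.cls_surjective x
    rw [hid] at hx
    rw [show x = 0 from Subtype.ext hx, map_zero]
  · exact ⟨hb'.toStructure.cls ⟨x, by rw [Structure.mem_cycles, hdiff, LinearMap.zero_apply]⟩,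
      hid _⟩

theorem MinimalModel.linPart_incl {S : Structure 𝒜} (M : MinimalModel S) (x : S.Homology) :
    ∃ h : linPart M.incl.f x ∈ S.cycles, S.cls ⟨linPart M.incl.f x, h⟩ = x := by
  have hx : M.str.diff x = 0 := by
    rw [Structure.diff, linPart_apply, M.m_one, zero_apply]
  have h : linPart M.incl.f x ∈ S.cycles := by
    rw [Structure.mem_cycles, ← Morphism.linPart_diff, hx, map_zero]
  exact ⟨h, M.induces_id ⟨x, hx⟩⟩

theorem MinimalModel.isomorphic {S : Structure 𝒜} (M N : MinimalModel S) :
    Isomorphic M.str N.str := by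
  obtain ⟨c, hp, -⟩ := S.exists_barContraction
  obtain ⟨b₀, P, -, hP, hPι⟩ := c.exists_cotransfer S.isBarStructure
  have key (M : MinimalModel S) : ∃ F G,
      IsBarMorphism S.homologyGrading S.homologyGrading (toBar S.homologyGrading M.str.m) b₀ F ∧
      IsBarMorphism S.homologyGrading S.homologyGrading b₀ (toBar S.homologyGrading M.str.m) G ∧
      hat F ∘ₗ hat G = LinearMap.id ∧ hat G ∘ₗ hat F = LinearMap.id := by
    have hF := hP.comp M.incl.isBarMorphism
    -- The linear part of the composite is `p ∘ i_1`. It is the identity because `p` sends a cycle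
    -- to its class and `i_1 x` is a cycle of class `x`.
    obtain ⟨G, hG⟩ := hF.exists_inverse <| LinearMap.ext fun x => by
      obtain ⟨h, hx⟩ := M.linPart_incl x
      rw [LinearMap.comp_apply, LinearMap.comp_apply, hat_ι (toBar_one _), toBar_ι,
        ← LinearMap.comp_apply, hPι, LinearMap.id_apply]
      exact (hp ⟨_, h⟩).trans hx
    exact ⟨_, G, hF, hG⟩
  obtain ⟨F, F', hF, hF', hFF', hF'F⟩ := key M
  obtain ⟨G, G', hG, hG', hGG', hG'G⟩ := key N
  -- The two models are compared through the common structure `b₀`.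
  refine isomorphic_of_isBarMorphism (hG'.comp hF) (hF'.comp hG) ?_ ?_
  · rw [← hat_comp_hat hF'.map_one hG.map_one, ← hat_comp_hat hG'.map_one hF.map_one,
      LinearMap.comp_assoc, ← LinearMap.comp_assoc (hat F), hGG', LinearMap.id_comp, hF'F]
  · rw [← hat_comp_hat hF'.map_one hG.map_one, ← hat_comp_hat hG'.map_one hF.map_one,
      LinearMap.comp_assoc, ← LinearMap.comp_assoc (hat G), hFF', LinearMap.id_comp, hG'G]

end MinimalModels

end AInfinity

end

theorem mainTheorem1 {k : Type*} [Field k] {A : Type*} [AddCommGroup A] [Module k A]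
    (𝒜 : ℤ → Submodule k A) [DirectSum.Decomposition 𝒜] (S : AInfinity.Structure 𝒜) :
    Nonempty (AInfinity.MinimalModel S) ∧
      ∀ M N : AInfinity.MinimalModel S, AInfinity.Isomorphic M.str N.str := by
  exact ⟨S.exists_minimalModel, fun M N => M.isomorphic N⟩
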